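/- Let $\mathcal P\subset\mathbb R^3$ be a convex polyhedron (the convex hull of finitely many points, with nonempty interior) that is nonobtusely triangulated: its boundary surface is the union of finitely many triangles, called faces, any two of which are disjoint or meet exactly in a common vertex or a common edge, and every angle of every face is at most $\pi/2$. (Adjacent faces may be coplanar; in particular this includes every convex polyhedron all of whose facets are nonobtuse triangles.) For a face $B$, let $N_v(B)$ be the set consisting of $B$ and all faces that share at least one vertex with $B$. Then for every face $B$, $N_v(B)$ has a nonoverlapping petal unfolding. Here a petal unfolding of $N_v(B)$ is obtained by cutting a set of edges such that no edge of $B$ is cut, every edge with no endpoint on $B$ is cut, and at each vertex $b$ of $B$ exactly one edge is cut. (Equivalently, each face sharing an edge with $B$ is rotated about that edge into the plane of $B$, and at each vertex $b$ of $B$ the fan of remaining faces incident to $b$ is split into two consecutive, possibly empty groups, one attached to each of the two faces at $b$ that share an edge with $B$.) The faces in $N_v(B)$ are then placed congruently in the plane so that any two faces sharing an uncut edge remain attached along that edge and lie on opposite sides of it. The unfolding is nonoverlapping if the placed faces have pairwise disjoint interiors. -/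

import Mathlib

/-- Euclidean three-space. -/
abbrev Space3 : Type := EuclideanSpace ℝ (Fin 3)

/-- The Euclidean plane into which surfaces are unfolded. -/
abbrev Plane2 : Type := EuclideanSpace ℝ (Fin 2)

/-- A (solid, nondegenerate) convex polyhedron: the convex hull of finitely many points,
with nonempty interior. -/
def IsConvexPolyhedron (P : Set Space3) : Prop :=
  (∃ V : Finset Space3, P = convexHull ℝ (V : Set Space3)) ∧ (interior P).Nonempty

/-- The triangle with vertex set `t` has all its angles at most `π / 2`. -/
def IsNonobtuse (t : Finset Space3) : Prop :=
  ∀ a ∈ t, ∀ b ∈ t, ∀ c ∈ t, a ≠ b → b ≠ c → a ≠ c →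
    EuclideanGeometry.angle a b c ≤ Real.pi / 2

/-- The triangles of a simplicial complex, each given by its set of three vertices. -/
def triangles (K : Geometry.SimplicialComplex ℝ Space3) : Set (Finset Space3) :=
  {t | t ∈ K.faces ∧ t.card = 3}

/-- The edges of a simplicial complex, each given by its set of two endpoints. -/
def edges (K : Geometry.SimplicialComplex ℝ Space3) : Set (Finset Space3) :=
  {e | e ∈ K.faces ∧ e.card = 2}

/-- `K` presents `P` as a nonobtusely triangulated convex polyhedron: `K` is a finite simplicial
complex whose underlying space is the surface of the convex polyhedron `P`, and every triangle of
`K` is nonobtuse. (Adjacent triangles may or may not be coplanar.) -/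
structure IsNonobtuselyTriangulated (P : Set Space3)
    (K : Geometry.SimplicialComplex ℝ Space3) : Prop where
  polyhedron : IsConvexPolyhedron P
  finite : K.faces.Finite
  surface : K.space = frontier P
  nonobtuse : ∀ t ∈ triangles K, IsNonobtuse t

/-- The vertex-neighborhood `N_v(B)`: all triangles sharing at least a vertex with the triangle
`B`, including `B` itself. -/
def vertexNeighborhood (K : Geometry.SimplicialComplex ℝ Space3) (B : Finset Space3) :
    Set (Finset Space3) :=
  {t | t ∈ triangles K ∧ ∃ v ∈ t, v ∈ B}

/-- `C` is the set of cut edges of a petal unfolding of the vertex-neighborhood of `B`.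
No edge of `B` is cut; every edge having no vertex on `B` is cut; and at each vertex `b` of `B`
exactly one edge is cut. The last condition says that the cyclic sequence of triangles around `b`
is cut open at one edge leaving `B`, so that the fan of triangles at `b` lying strictly between
the two neighbours of `B` at `b` is split into two (possibly empty) consecutive groups, one
attached to each of these two neighbours. -/
structure IsPetalCut (K : Geometry.SimplicialComplex ℝ Space3) (B : Finset Space3)
    (C : Set (Finset Space3)) : Prop where
  subset_edges : C ⊆ edges K
  base_uncut : ∀ e ∈ C, ¬ e ⊆ B
  outer_cut : ∀ e ∈ edges K, Disjoint e B → e ∈ C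
  one_cut : ∀ b ∈ B, ∃! e, e ∈ C ∧ b ∈ e

/-- The image in the plane of the triangle `t`, given the images `φ` of its vertices. -/
def unfoldedTriangle (φ : Space3 → Plane2) (t : Finset Space3) : Set Plane2 :=
  convexHull ℝ (φ '' (t : Set Space3))

/-- `φ` develops the triangles of `N` into the plane after cutting along the edges in `C`:
each triangle `t` is placed congruently by `φ t`, and two triangles sharing an uncut edge stay
attached along that edge and lie on opposite sides of it. -/
structure IsUnfolding (N C : Set (Finset Space3))
    (φ : Finset Space3 → Space3 → Plane2) : Prop where
  congruent : ∀ t ∈ N, ∀ u ∈ t, ∀ v ∈ t, dist (φ t u) (φ t v) = dist u v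
  attached : ∀ t ∈ N, ∀ t' ∈ N, t ≠ t' → ∀ e : Finset Space3, e.card = 2 → e ⊆ t → e ⊆ t' →
    e ∉ C → ∀ v ∈ e, φ t v = φ t' v
  opposite : ∀ t ∈ N, ∀ t' ∈ N, t ≠ t' → ∀ e : Finset Space3, e.card = 2 → e ⊆ t → e ⊆ t' →
    e ∉ C → ∀ p ∈ t, p ∉ e → ∀ q ∈ t', q ∉ e →
      (affineSpan ℝ (φ t '' (e : Set Space3))).SOppSide (φ t p) (φ t' q)

/-- The unfolded triangles do not overlap: distinct ones have disjoint interiors. -/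
def IsNonoverlapping (N : Set (Finset Space3)) (φ : Finset Space3 → Space3 → Plane2) : Prop :=
  ∀ t ∈ N, ∀ t' ∈ N, t ≠ t' →
    Disjoint (interior (unfoldedTriangle (φ t) t)) (interior (unfoldedTriangle (φ t') t'))

/-- The vertex-neighborhood of `B` has a nonoverlapping petal unfolding. -/
def HasPetalUnfolding (K : Geometry.SimplicialComplex ℝ Space3) (B : Finset Space3) : Prop :=
  ∃ (C : Set (Finset Space3)) (φ : Finset Space3 → Space3 → Plane2),
    IsPetalCut K B C ∧ IsUnfolding (vertexNeighborhood K B) C φ ∧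
      IsNonoverlapping (vertexNeighborhood K B) φ

/-! The problem becomes planar: any two placed faces are separated by a straight line. Let `B` have
vertices z_0, z_1, z_2, counterclockwise, with angles β_i. The other faces at z_i form a fan; let
r_j be its edge lengths and A_j its cumulative angles, starting from side i. Its first and last
triangles are the neighbours of `B` across the two sides at z_i.

Only two facts about the polyhedron are needed, both supplied by `exists_isVertexFan`: the faces at
a vertex form one cyclic fan, and A_n + β_i ≤ 2π. For the first, projection along a direction
pointing inward from b is injective on the faces at b, so they project to a complete planar fan,
whose rays are sorted by argument (`IsPlanarFan.exists_enumeration`). For the second, normalise the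
heights of the edges to 1: the edge tips then form a convex polygon, and the spherical triangle
inequality at each tip bounds the apex angles by those of the planar fan (`sum_angle_le_two_pi`).

The cut is chosen so that both groups at z_i have total angle at most 3π/2 - β_i, the neighbours of
`B` included. As every step and β_i are at most π/2, a discrete intermediate value argument finds
such an edge (`exists_split`).

Since the faces are nonobtuse, the projection r_j cos A_j onto the side carrying a group does not
increase while it is nonnegative, and stays below its last nonnegative value (`radius_mul_cos_le`).
Hence: (1) triangles at z_i stay on the base's side of the line through the opposite side
(`opposite_nonneg`); (2) each triangle lies outside the side carrying its group, or behind the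
perpendicular at z_i to the other side there (`left_sides`, `right_sides`); (3) apart from the
neighbour of `B`, a group stays on its own vertex's side of the altitude from that neighbour's apex
(`left_altitude`, `right_altitude`). Triangles at different vertices are separated by combining
these (`disjoint_of_ne_vertex`). Triangles at one vertex occupy disjoint sectors, because the total
angle is at most 2π. -/

open Geometry

/-! ### Convex bodies and simplicial complexes near a boundary vertex -/

section LocalGeometry

variable {E : Type*} [NormedAddCommGroup E] [NormedSpace ℝ E]

/-- The point is a convex combination of `c`, with weight δσ, and of a point on the ray from `b`
along `x`. The bound on δ keeps δσ ≤ 1/2 and the rescaled parameter δ/(1 - δσ) at most `δ₀`. -/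
theorem exists_add_smul_mem_interior {P : Set E} (hP : Convex ℝ P) {b c x : E} (hb : b ∈ P)
    (hc : c ∈ interior P) {δ₀ σ : ℝ} (h0 : 0 < δ₀) (hx : b + δ₀ • x ∈ P) (hσ : 0 < σ) :
    ∃ δ₁ > (0 : ℝ), ∀ δ, 0 < δ → δ ≤ δ₁ → b + δ • (x + σ • (c - b)) ∈ interior P := by
  refine ⟨min (δ₀ / 2) (1 / (2 * σ)), by positivity, fun δ hδ hδ1 => ?_⟩
  have h1 : δ ≤ δ₀ / 2 := hδ1.trans (min_le_left _ _)
  have h2 : δ * σ ≤ 1 / 2 := by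
    have := hδ1.trans (min_le_right _ _)
    rw [le_div_iff₀ (by positivity)] at this
    linarith
  have h3 : 0 < 1 - δ * σ := by linarith
  have hy : b + (δ / (1 - δ * σ)) • x ∈ P := by
    have hle : δ / (1 - δ * σ) ≤ δ₀ := by
      rw [div_le_iff₀ h3]; nlinarith
    have ht : 0 ≤ δ / (1 - δ * σ) / δ₀ := by positivity
    have ht1 : δ / (1 - δ * σ) / δ₀ ≤ 1 := by rw [div_le_one h0]; exact hle
    have := hP.add_smul_sub_mem hb hx ⟨ht, ht1⟩
    convert this using 2
    rw [add_sub_cancel_left, smul_smul, div_mul_cancel₀ _ h0.ne']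
  have := hP.combo_self_interior_mem_interior hy hc h3.le (by positivity : 0 < δ * σ) (by ring)
  convert this using 1
  rw [smul_add (1 - δ * σ), smul_smul, mul_div_cancel₀ _ h3.ne']
  module

theorem AffineIndependent.weights_eq_zero {s : Finset E} (hs : AffineIndependent ℝ ((↑) : s → E))
    (w : E → ℝ) (h0 : ∑ v ∈ s, w v = 0) (h1 : ∑ v ∈ s, w v • v = 0) : ∀ v ∈ s, w v = 0 := by
  intro v hv
  have := (affineIndependent_iff.1 hs) Finset.univ (fun x => w x)
    (by rw [← h0]; exact Finset.sum_coe_sort s w)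
    (by rw [← h1]; exact Finset.sum_coe_sort s (fun v => w v • v)) ⟨v, hv⟩ (Finset.mem_univ _)
  exact this

variable {K : SimplicialComplex ℝ E}

/-- A relatively interior point of `s` determines `s`: if it also lies in `t`, it lies in the hull
of `s ∩ t`, and uniqueness of barycentric coordinates leaves no vertex of `s` outside `t`. -/
theorem Geometry.SimplicialComplex.subset_of_pos_weights {s t : Finset E} (hs : s ∈ K.faces)
    (ht : t ∈ K.faces) {a : E → ℝ} (ha : ∀ v ∈ s, 0 < a v) (h1 : ∑ v ∈ s, a v = 1)
    (hp : ∑ v ∈ s, a v • v ∈ convexHull ℝ (t : Set E)) : s ⊆ t := by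
  classical
  have hmem : ∑ v ∈ s, a v • v ∈ convexHull ℝ (s : Set E) :=
    (convex_convexHull ℝ _).sum_mem (fun v hv => (ha v hv).le) h1
      (fun v hv => subset_convexHull ℝ _ hv)
  have hst := K.inter_subset_convexHull hs ht ⟨hmem, hp⟩
  rw [← Finset.coe_inter, Finset.mem_convexHull'] at hst
  obtain ⟨w, -, hw1, hw⟩ := hst
  set w' : E → ℝ := fun v => if v ∈ t then w v else 0 with hw'
  have e1 : ∑ v ∈ s, w' v = 1 := by
    rw [← hw1, ← Finset.filter_mem_eq_inter, Finset.sum_filter]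
  have e2 : ∑ v ∈ s, w' v • v = ∑ v ∈ s, a v • v := by
    rw [← hw, ← Finset.filter_mem_eq_inter, Finset.sum_filter]
    exact Finset.sum_congr rfl fun v _ => by simp only [hw']; split_ifs <;> simp
  have := AffineIndependent.weights_eq_zero (K.indep hs) (fun v => a v - w' v)
    (by rw [Finset.sum_sub_distrib, h1, e1, sub_self])
    (by simp only [sub_smul]; rw [Finset.sum_sub_distrib, e2, sub_self])
  intro v hv
  by_contra hvt
  have h2 := this v hv
  simp only [hw', if_neg hvt, sub_zero] at h2
  exact (ha v hv).ne' h2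

theorem mem_convexHull_triple {b u v x : E} :
    x ∈ convexHull ℝ ({b, u, v} : Set E) ↔
      ∃ l m : ℝ, 0 ≤ l ∧ 0 ≤ m ∧ l + m ≤ 1 ∧ x = b + (l • (u - b) + m • (v - b)) := by
  constructor
  · intro h
    rw [convexHull_insert (by simp), convexHull_pair] at h
    simp only [mem_convexJoin, Set.mem_singleton_iff, exists_eq_left] at h
    obtain ⟨y, ⟨p, q, hp, hq, hpq, rfl⟩, r, s, hr, hs, hrs, rfl⟩ := h
    refine ⟨s * p, s * q, by positivity, by positivity, ?_, ?_⟩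
    · rw [← mul_add, hpq]; linarith
    · obtain rfl : r = 1 - s := by linarith
      obtain rfl : p = 1 - q := by linarith
      module
  · rintro ⟨l, m, hl, hm, hlm, rfl⟩
    have hb : b ∈ convexHull ℝ ({b, u, v} : Set E) := subset_convexHull ℝ _ (by simp)
    have hu : u ∈ convexHull ℝ ({b, u, v} : Set E) := subset_convexHull ℝ _ (by simp)
    have hv : v ∈ convexHull ℝ ({b, u, v} : Set E) := subset_convexHull ℝ _ (by simp)
    have := (convex_convexHull ℝ ({b, u, v} : Set E)).sum_mem (t := Finset.univ)
      (w := ![1 - l - m, l, m]) (z := ![b, u, v])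
      (by intro i _; fin_cases i <;> simp <;> linarith)
      (by simp [Fin.sum_univ_three]; ring)
      (by intro i _; fin_cases i <;> simp [hb, hu, hv])
    convert this using 1
    simp [Fin.sum_univ_three]
    module

/-- Translate a short segment through `b` parallel to `c - b` by a small multiple of `d`. One end
stays in the interior and the other outside `P`, so the segment meets the frontier. The faces
avoiding `b` form a closed set missing `b`, so the face met must contain `b`. This makes the
projected fan cover the plane. -/
theorem exists_mem_face_of_direction {P : Set E} (hP : Convex ℝ P) (hPc : IsClosed P)
    (hfin : K.faces.Finite) (hK : K.space = frontier P) {b c : E} (hb : {b} ∈ K.faces)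
    (hc : c ∈ interior P) (d : E) :
    ∃ s ∈ K.faces, b ∈ s ∧ ∃ σ : ℝ, ∃ δ > (0 : ℝ), b + δ • (d + σ • (c - b)) ∈
      convexHull ℝ (s : Set E) := by
  have hbf : b ∈ frontier P := by
    rw [← hK]; exact SimplicialComplex.mem_space_iff.2 ⟨{b}, hb, by simp⟩
  have hbP : b ∈ P := hPc.frontier_subset hbf
  have hbi : b ∉ interior P := hbf.2
  set F : Set E := ⋃ s ∈ {s ∈ K.faces | b ∉ s}, convexHull ℝ (s : Set E) with hF
  have hFc : IsClosed F := by
    refine (hfin.subset (Set.sep_subset _ _)).isClosed_biUnion fun s _ => ?_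
    exact (s.finite_toSet.isCompact_convexHull ℝ).isClosed
  have hbF : b ∈ Fᶜ := by
    simp only [hF, Set.mem_compl_iff, Set.mem_iUnion, not_exists]
    rintro s ⟨hs, hbs⟩ h
    exact hbs ((SimplicialComplex.vertex_mem_convexHull_iff hb hs).1 h)
  obtain ⟨ρ, hρ, hball⟩ := Metric.isOpen_iff.1 hFc.isOpen_compl b hbF
  set w := c - b with hw
  obtain ⟨τ, hτ, hτ1, hτρ⟩ : ∃ τ : ℝ, 0 < τ ∧ τ ≤ 1 ∧ τ * ‖w‖ < ρ / 2 := by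
    refine ⟨min 1 (ρ / (4 * (‖w‖ + 1))), by positivity, min_le_left _ _, ?_⟩
    have h1 : min 1 (ρ / (4 * (‖w‖ + 1))) ≤ ρ / (4 * (‖w‖ + 1)) := min_le_right _ _
    rw [le_div_iff₀ (by positivity)] at h1
    have : 0 < min 1 (ρ / (4 * (‖w‖ + 1))) := by positivity
    nlinarith
  have hin : b + τ • w ∈ interior P := by
    have := hP.combo_self_interior_mem_interior hbP hc (by linarith : 0 ≤ 1 - τ) hτ (by ring)
    convert this using 1
    rw [hw]; module
  -- Otherwise `b` would be a proper convex combination of this point and the interior point `c`,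
  -- hence interior.
  have hout : b - τ • w ∈ Pᶜ := by
    intro h
    apply hbi
    have := hP.combo_self_interior_mem_interior h hc (a := 1 / (1 + τ)) (b := τ / (1 + τ))
      (by positivity) (by positivity) (by field_simp)
    convert this using 1
    rw [hw, smul_sub, smul_smul]
    have : (1:ℝ) + τ ≠ 0 := by positivity
    match_scalars <;> field_simp <;> ring
  have hcont1 : ContinuousAt (fun δ : ℝ => b + τ • w + δ • d) 0 := by fun_prop
  have hcont2 : ContinuousAt (fun δ : ℝ => b - τ • w + δ • d) 0 := by fun_prop
  have hcont3 : ContinuousAt (fun δ : ℝ => |δ| * ‖d‖) 0 := by fun_prop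
  have ev1 := hcont1.eventually_mem (isOpen_interior.mem_nhds (by simpa using hin))
  have ev2 := hcont2.eventually_mem (hPc.isOpen_compl.mem_nhds (by simpa using hout))
  have ev3 := hcont3.eventually_lt_const (u := ρ / 2) (by simpa using hρ)
  obtain ⟨δ, ⟨⟨h1, h2⟩, h3⟩, hδ⟩ :=
    (((ev1.and ev2).and ev3).filter_mono nhdsWithin_le_nhds |>.and
      (self_mem_nhdsWithin (a := (0:ℝ)) (s := Set.Ioi 0))).exists
  have hδ : 0 < δ := hδ
  obtain ⟨q, hq, hqf⟩ : (segment ℝ (b - τ • w + δ • d) (b + τ • w + δ • d) ∩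
      frontier P).Nonempty := by
    by_contra hne
    obtain ⟨q, -, hq1, hq2⟩ := (convex_segment (𝕜 := ℝ) (b - τ • w + δ • d)
      (b + τ • w + δ • d)).isPreconnected _ _ isOpen_interior hPc.isOpen_compl
      (fun q hq => by
        by_contra h
        simp only [Set.mem_union, Set.mem_compl_iff, not_or, not_not] at h
        exact hne ⟨q, hq, subset_closure h.2, h.1⟩)
      ⟨_, right_mem_segment ℝ _ _, h1⟩ ⟨_, left_mem_segment ℝ _ _, h2⟩
    exact hq2 (interior_subset hq1)
  obtain ⟨p, r, hp, hr, hpr, rfl⟩ := hq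
  rw [← hK] at hqf
  obtain ⟨s, hs, hsq⟩ := SimplicialComplex.mem_space_iff.1 hqf
  have hq' : p • (b - τ • w + δ • d) + r • (b + τ • w + δ • d)
      = b + δ • (d + ((r - p) * τ / δ) • w) := by
    rw [smul_add δ, smul_smul, mul_div_cancel₀ _ hδ.ne']
    obtain rfl : p = 1 - r := by linarith
    module
  rw [hq'] at hsq
  refine ⟨s, hs, ?_, _, δ, hδ, hsq⟩
  by_contra hbs
  have : b + δ • (d + ((r - p) * τ / δ) • w) ∈ Fᶜ := by
    apply hball
    rw [Metric.mem_ball, dist_eq_norm, add_sub_cancel_left, smul_add, smul_smul,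
      mul_div_cancel₀ _ hδ.ne']
    refine (norm_add_le _ _).trans_lt ?_
    rw [norm_smul, norm_smul, Real.norm_eq_abs, Real.norm_eq_abs, abs_mul, abs_of_pos hτ]
    have : |r - p| ≤ 1 := by rw [abs_le]; constructor <;> linarith
    have : |r - p| * τ * ‖w‖ ≤ τ * ‖w‖ := by
      rw [mul_assoc]; exact mul_le_of_le_one_left (by positivity) this
    linarith
  exact this (Set.mem_biUnion (show s ∈ {s ∈ K.faces | b ∉ s} from ⟨hs, hbs⟩) hsq)

end LocalGeometry

/-! ### Complete fans of sectors in the plane -/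

section PlanarFan

open Complex

/-- The cross product of two plane vectors. -/
def cross (a b : ℂ) : ℝ := a.re * b.im - a.im * b.re

theorem cross_swap (a b : ℂ) : cross b a = -cross a b := by unfold cross; ring

theorem cross_self_eq_zero (a : ℂ) : cross a a = 0 := by unfold cross; ring

theorem cross_mul_mul (c a b : ℂ) : cross (c * a) (c * b) = normSq c * cross a b := by
  simp only [cross, mul_re, mul_im, normSq_apply]; ring

theorem cross_exp_exp (r s x y : ℝ) :
    cross (r * exp (x * I)) (s * exp (y * I)) = r * s * Real.sin (y - x) := by
  simp only [cross, re_ofReal_mul, im_ofReal_mul, exp_ofReal_mul_I_re, exp_ofReal_mul_I_im,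
    Real.sin_sub]
  ring

theorem sin_smul_exp_add (x y z : ℝ) :
    (Real.sin (z - y) : ℂ) * exp (x * I) + (Real.sin (y - x) : ℂ) * exp (z * I) =
      Real.sin (z - x) * exp (y * I) := by
  apply Complex.ext
  · simp only [add_re, re_ofReal_mul, exp_ofReal_mul_I_re, Real.sin_sub]
    ring
  · simp only [add_im, im_ofReal_mul, exp_ofReal_mul_I_im, Real.sin_sub]
    ring

theorem angle_exp_exp {r s x y : ℝ} (hr : 0 < r) (hs : 0 < s) (hxy : x ≤ y) (hyx : y - x ≤ Real.pi)
    {c : ℂ} (hc : c ≠ 0) :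
    InnerProductGeometry.angle (c * (r * exp (x * I))) (c * (s * exp (y * I))) = y - x := by
  rw [InnerProductGeometry.angle_comm, Complex.angle_eq_abs_arg]
  · have : c * (s * exp (y * I)) / (c * (r * exp (x * I))) = (s / r : ℝ) * exp ((y - x : ℝ) * I) := by
      rw [mul_div_mul_left _ _ hc]
      push_cast
      rw [sub_mul, exp_sub, mul_div_mul_comm]
    rw [this, arg_real_mul _ (by positivity), exp_mul_I, arg_cos_add_sin_mul_I]
    · exact abs_of_nonneg (by linarith)
    · exact ⟨by linarith [Real.pi_pos], hyx⟩
  · have := hs.ne'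
    simp [hc, this]
  · have := hr.ne'
    simp [hc, this]

/-- The rays `f v`, `v ∈ L`, and the sectors spanned by the pairs related by `T` form a complete
fan in the plane. -/
structure IsPlanarFan {α : Type*} (L : Finset α) (f : α → ℂ) (T : α → α → Prop) : Prop where
  mem_left : ∀ u v, T u v → u ∈ L
  symm : ∀ u v, T u v → T v u
  cover : ∀ z : ℂ, z ≠ 0 → (∃ v ∈ L, ∃ r : ℝ, 0 < r ∧ z = r * f v) ∨
    ∃ u v, T u v ∧ ∃ l m : ℝ, 0 < l ∧ 0 < m ∧ z = l * f u + m * f v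
  ray : ∀ u v x, T u v → x ∈ L → ∀ l m : ℝ, 0 ≤ l → 0 ≤ m → f x = l * f u + m * f v →
    x = u ∨ x = v
  ray_inj : ∀ u ∈ L, ∀ v ∈ L, ∀ r : ℝ, 0 < r → f u = r * f v → u = v
  ne_zero : ∀ v ∈ L, f v ≠ 0
  cross_ne : ∀ u v, T u v → cross (f u) (f v) ≠ 0
  sector_inj : ∀ u v u' v', T u v → T u' v' → ∀ l m l' m' : ℝ, 0 < l → 0 < m → 0 < l' → 0 < m' →
    l * f u + m * f v = l' * f u' + m' * f v' → (u = u' ∧ v = v') ∨ (u = v' ∧ v = u')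

variable {α : Type*} {L : Finset α} {f : α → ℂ} {T : α → α → Prop}

/-- With arguments normalised to (-π, π], the direction 1 lies strictly inside the sector, so the
two sines have opposite signs and the sector straddles angle 0. The cosine bounds keep both sides at
distance at least δ from 0. -/
theorem exists_sector_angles {δ l m α₀ β₀ : ℝ} (hδ' : δ ≤ Real.pi) (hl : 0 < l)
    (hm : 0 < m) (h : (1 : ℂ) = l * exp (α₀ * I) + m * exp (β₀ * I))
    (hα : Real.cos α₀ ≤ Real.cos δ) (hβ : Real.cos β₀ ≤ Real.cos δ) (hs : Real.sin α₀ < 0) :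
    ∃ α β : ℝ, exp (α * I) = exp (α₀ * I) ∧ exp (β * I) = exp (β₀ * I) ∧ α ≤ -δ ∧ δ ≤ β ∧
      β - α < Real.pi := by
  have key : ∀ γ : ℝ, ∃ γ' : ℝ, exp (γ' * I) = exp (γ * I) ∧ -Real.pi < γ' ∧ γ' ≤ Real.pi := by
    intro γ
    refine ⟨arg (exp (γ * I)), ?_, neg_pi_lt_arg _, arg_le_pi _⟩
    have := norm_mul_exp_arg_mul_I (exp (γ * I))
    rwa [norm_exp_ofReal_mul_I, ofReal_one, one_mul] at this
  obtain ⟨α, eα, hα1, hα2⟩ := key α₀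
  obtain ⟨β, eβ, hβ1, hβ2⟩ := key β₀
  have cα : Real.cos α = Real.cos α₀ := by simpa using congrArg re eα
  have sα : Real.sin α = Real.sin α₀ := by simpa using congrArg im eα
  have cβ : Real.cos β = Real.cos β₀ := by simpa using congrArg re eβ
  rw [← eα, ← eβ] at h
  have h1 := congrArg im h
  simp only [one_im, add_im, im_ofReal_mul, exp_ofReal_mul_I_im] at h1
  have h2 := congrArg re h
  simp only [one_re, add_re, re_ofReal_mul, exp_ofReal_mul_I_re] at h2
  rw [← sα] at hs
  rw [← cα] at hα
  rw [← cβ] at hβ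
  have sβ : 0 < Real.sin β := by
    by_contra hh
    nlinarith
  have hα0 : α < 0 := by
    by_contra hh
    exact absurd (Real.sin_nonneg_of_nonneg_of_le_pi (not_lt.1 hh) hα2) (by linarith)
  have hβ0 : 0 < β := by
    by_contra hh
    have := Real.sin_nonneg_of_nonneg_of_le_pi (x := -β) (by linarith) (by linarith)
    rw [Real.sin_neg] at this
    linarith
  have hd : 0 < Real.sin (β - α) := by
    have : -Real.sin α = m * Real.sin (β - α) := by
      rw [Real.sin_sub]
      linear_combination (-Real.sin α) * h2 + Real.cos α * h1
    by_contra hh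
    nlinarith
  refine ⟨α, β, eα, eβ, ?_, ?_, ?_⟩
  · by_contra hh
    have := Real.cos_lt_cos_of_nonneg_of_le_pi (x := -α) (y := δ) (by linarith) hδ' (by linarith)
    rw [Real.cos_neg] at this
    linarith
  · by_contra hh
    have := Real.cos_lt_cos_of_nonneg_of_le_pi (x := β) (y := δ) (by linarith) hδ' (by linarith)
    linarith
  · by_contra hh
    have := Real.sin_nonneg_of_nonneg_of_le_pi (x := (β - α) - Real.pi) (by linarith) (by linarith)
    rw [Real.sin_sub_pi] at this
    linarith

theorem exists_sector_coeff {α β γ : ℝ} (h1 : α ≤ γ) (h2 : γ ≤ β) (h3 : β - α < Real.pi)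
    (h4 : α < β) : ∃ l m : ℝ, 0 ≤ l ∧ 0 ≤ m ∧ (γ < β → 0 < l) ∧ (α < γ → 0 < m) ∧
      exp (γ * I) = l * exp (α * I) + m * exp (β * I) := by
  have hs : 0 < Real.sin (β - α) := Real.sin_pos_of_pos_of_lt_pi (by linarith) h3
  refine ⟨Real.sin (β - γ) / Real.sin (β - α), Real.sin (γ - α) / Real.sin (β - α),
    div_nonneg (Real.sin_nonneg_of_nonneg_of_le_pi (by linarith) (by linarith)) hs.le,
    div_nonneg (Real.sin_nonneg_of_nonneg_of_le_pi (by linarith) (by linarith)) hs.le,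
    fun h => div_pos (Real.sin_pos_of_pos_of_lt_pi (by linarith) (by linarith)) hs,
    fun h => div_pos (Real.sin_pos_of_pos_of_lt_pi (by linarith) (by linarith)) hs, ?_⟩
  have := sin_smul_exp_add α γ β
  have hs' : (Real.sin (β - α) : ℂ) ≠ 0 := by exact_mod_cast hs.ne'
  rw [ofReal_div, ofReal_div, div_mul_eq_mul_div, div_mul_eq_mul_div, ← add_div, this,
    mul_div_cancel_left₀ _ hs']

/-- The bisector of a gap between rays lies on no ray, so it lies in an open sector. The sides of
that sector are no closer to the bisector than `p` and `q` are, so the closed sector contains both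
rays, and `ray` makes `p` and `q` its sides. The angles `a`, `a'` are separate from `θ p`, `θ q`
because at the wrap-around `a'` is 2π while `θ q` is 0. -/
theorem IsPlanarFan.gap (hF : IsPlanarFan L f T) {c : ℂ} (hc : c ≠ 0) {θ ρ : α → ℝ}
    (hθ : ∀ x ∈ L, 0 ≤ θ x ∧ θ x < 2 * Real.pi) (hρ : ∀ x ∈ L, 0 < ρ x)
    (hf : ∀ x ∈ L, f x = c * (ρ x * exp (θ x * I))) {a a' : ℝ} (h0 : 0 ≤ a) (haa : a < a')
    (ha' : a' ≤ 2 * Real.pi) {p q : α} (hp : p ∈ L) (hq : q ∈ L)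
    (hfp : f p = c * (ρ p * exp (a * I))) (hfq : f q = c * (ρ q * exp (a' * I)))
    (hgap : ∀ x ∈ L, θ x ≤ a ∨ a' ≤ θ x) : T p q ∧ a' - a < Real.pi := by
  set m := (a + a') / 2 with hm
  set δ := (a' - a) / 2 with hδ
  have hδ0 : 0 < δ := by rw [hδ]; linarith
  have hδπ : δ ≤ Real.pi := by rw [hδ]; linarith
  have hcos : ∀ x ∈ L, Real.cos (θ x - m) ≤ Real.cos δ := by
    intro x hx
    obtain ⟨hx0, hx1⟩ := hθ x hx
    have hA : δ ≤ |θ x - m| := by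
      rcases hgap x hx with h | h
      · rw [abs_of_nonpos (by rw [hm]; linarith)]; rw [hm, hδ]; linarith
      · rw [abs_of_nonneg (by rw [hm]; linarith)]; rw [hm, hδ]; linarith
    -- Distances beyond π count the other way round the circle, so an upper bound is needed as well
    -- as a lower one.
    have hB : |θ x - m| ≤ 2 * Real.pi - δ := by
      rw [abs_le]; constructor <;> (rw [hm, hδ]; linarith)
    rw [← Real.cos_abs]
    rcases le_total (|θ x - m|) Real.pi with h | h
    · exact Real.cos_le_cos_of_nonneg_of_le_pi hδ0.le h hA
    · rw [← Real.cos_two_pi_sub]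
      exact Real.cos_le_cos_of_nonneg_of_le_pi hδ0.le (by linarith) (by linarith)
  have hshift : ∀ x ∈ L, f x = c * exp (m * I) * (ρ x * exp ((θ x - m : ℝ) * I)) := by
    intro x hx
    rw [hf x hx]
    have : exp (θ x * I) = exp (m * I) * exp ((θ x - m : ℝ) * I) := by
      rw [← exp_add]; congr 1; push_cast; ring
    rw [this]; ring
  have hfp' : f p = c * exp (m * I) * (ρ p * exp ((-δ : ℝ) * I)) := by
    rw [hfp]
    have : exp (a * I) = exp (m * I) * exp ((-δ : ℝ) * I) := by
      rw [← exp_add]; congr 1; rw [hm, hδ]; push_cast; ring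
    rw [this]; ring
  have hfq' : f q = c * exp (m * I) * (ρ q * exp (δ * I)) := by
    rw [hfq]
    have : exp (a' * I) = exp (m * I) * exp (δ * I) := by
      rw [← exp_add]; congr 1; rw [hm, hδ]; push_cast; ring
    rw [this]; ring
  have hz : c * exp (m * I) ≠ 0 := mul_ne_zero hc (exp_ne_zero _)
  set z := c * exp (m * I) with hzdef
  -- Here `u` is the side clockwise from the bisector; the opposite case is obtained by swapping `u`
  -- and `v`.
  have main : ∀ u v, T u v → ∀ l μ : ℝ, 0 < l → 0 < μ → z = l * f u + μ * f v →
      Real.sin (θ u - m) < 0 → T p q ∧ a' - a < Real.pi := by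
    intro u v huv l μ hl hμ h hs
    have hu := hF.mem_left u v huv
    have hv := hF.mem_left v u (hF.symm _ _ huv)
    have h1 : (1 : ℂ) = (l * ρ u : ℝ) * exp ((θ u - m : ℝ) * I) +
        (μ * ρ v : ℝ) * exp ((θ v - m : ℝ) * I) := by
      apply mul_left_cancel₀ hz
      conv_lhs => rw [mul_one, h, hshift u hu, hshift v hv]
      push_cast; ring
    have hρu := hρ u hu
    have hρv := hρ v hv
    obtain ⟨A, B, eA, eB, hA, hB, hAB⟩ := exists_sector_angles hδπ (by positivity)
      (by positivity) h1 (hcos u hu) (hcos v hv) hs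
    have hin : ∀ x ∈ L, ∀ γ : ℝ, A ≤ γ → γ ≤ B → f x = z * (ρ x * exp (γ * I)) →
        x = u ∨ x = v := by
      intro x hx γ h2 h3 h4
      obtain ⟨l', m', hl', hm', -, -, h5⟩ := exists_sector_coeff h2 h3 hAB (by linarith)
      have hρx := hρ x hx
      refine hF.ray u v x huv hx (ρ x * l' / ρ u) (ρ x * m' / ρ v) (by positivity)
        (by positivity) ?_
      have e1 : (ρ u : ℂ) ≠ 0 := by exact_mod_cast hρu.ne'
      have e2 : (ρ v : ℂ) ≠ 0 := by exact_mod_cast hρv.ne'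
      rw [h4, h5, hshift u hu, hshift v hv, eA, eB]
      push_cast
      field_simp
    have hpq : p ≠ q := by
      rintro rfl
      have e := hfp'.symm.trans hfq'
      have := mul_left_cancel₀ hz e
      have h6 : cross (ρ p * exp ((-δ : ℝ) * I)) (ρ p * exp (δ * I)) = 0 := by
        rw [this, cross_self_eq_zero]
      rw [cross_exp_exp] at h6
      have h7 : 0 < Real.sin (δ - -δ) :=
        Real.sin_pos_of_pos_of_lt_pi (by linarith) (by linarith)
      have := hρ p hp
      have : 0 < ρ p * ρ p * Real.sin (δ - -δ) := by positivity
      linarith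
    have hp1 := hin p hp (-δ) hA (by linarith) hfp'
    have hq1 := hin q hq δ (by linarith) hB hfq'
    refine ⟨?_, by rw [hδ] at hA hB; linarith⟩
    have hvu := hF.symm _ _ huv
    rcases hp1 with rfl | rfl <;> rcases hq1 with rfl | rfl
    · exact absurd rfl hpq
    · exact huv
    · exact hvu
    · exact absurd rfl hpq
  rcases hF.cover z hz with ⟨x, hx, r, hr, h⟩ | ⟨u, v, huv, l, μ, hl, hμ, h⟩
  · exfalso
    have hρx := hρ x hx
    have h1 : (1 : ℂ) = (r * ρ x : ℝ) * exp ((θ x - m : ℝ) * I) := by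
      apply mul_left_cancel₀ hz
      conv_lhs => rw [mul_one, h, hshift x hx]
      push_cast; ring
    have h2 := congrArg norm h1
    rw [norm_mul, norm_exp_ofReal_mul_I, norm_real, mul_one, norm_one,
      Real.norm_of_nonneg (by positivity)] at h2
    rw [← h2, ofReal_one, one_mul] at h1
    have h3 := congrArg re h1
    rw [exp_ofReal_mul_I_re, one_re] at h3
    have h4 := hcos x hx
    have h5 := Real.cos_lt_cos_of_nonneg_of_le_pi le_rfl hδπ hδ0
    rw [Real.cos_zero] at h5
    linarith
  · have hu := hF.mem_left u v huv
    have hv := hF.mem_left v u (hF.symm _ _ huv)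
    have hρu := hρ u hu
    have hρv := hρ v hv
    have h1 : (1 : ℂ) = (l * ρ u : ℝ) * exp ((θ u - m : ℝ) * I) +
        (μ * ρ v : ℝ) * exp ((θ v - m : ℝ) * I) := by
      apply mul_left_cancel₀ hz
      conv_lhs => rw [mul_one, h, hshift u hu, hshift v hv]
      push_cast; ring
    have h2 := congrArg im h1
    simp only [one_im, add_im, im_ofReal_mul, exp_ofReal_mul_I_im] at h2
    rcases lt_trichotomy (Real.sin (θ u - m)) 0 with hs | hs | hs
    · exact main u v huv l μ hl hμ h hs
    · exfalso
      have hlu : 0 < l * ρ u := by positivity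
      have hμv : 0 < μ * ρ v := by positivity
      rw [hs, mul_zero, zero_add] at h2
      have h3 : Real.sin (θ v - m) = 0 := by
        rcases mul_eq_zero.1 h2.symm with h | h
        · exact absurd h hμv.ne'
        · exact h
      apply hF.cross_ne u v huv
      rw [hshift u hu, hshift v hv, cross_mul_mul, cross_exp_exp, Real.sin_sub, h3, hs]
      ring
    · refine main v u (hF.symm _ _ huv) μ l hμ hl (by rw [h]; ring) ?_
      have hlu : 0 < l * ρ u * Real.sin (θ u - m) := by positivity
      have hμv : 0 < μ * ρ v := by positivity
      by_contra hh
      have : 0 ≤ μ * ρ v * Real.sin (θ v - m) := mul_nonneg hμv.le (not_lt.1 hh)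
      linarith

theorem exists_polar (z : ℂ) : ∃ t : ℝ, 0 ≤ t ∧ t < 2 * Real.pi ∧ z = ‖z‖ * exp (t * I) := by
  rcases le_or_gt 0 (arg z) with h | h
  · exact ⟨arg z, h, by linarith [arg_le_pi z, Real.pi_pos], (norm_mul_exp_arg_mul_I z).symm⟩
  · refine ⟨arg z + 2 * Real.pi, by linarith [neg_pi_lt_arg z, Real.pi_pos], by linarith, ?_⟩
    push_cast
    rw [add_mul, exp_add, exp_two_pi_mul_I, mul_one]
    exact (norm_mul_exp_arg_mul_I z).symm

/-- Arguments are measured from the ray of `b₁` and sorted; neighbouring rays span sectors by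
`IsPlanarFan.gap`. The gaps are each less than π and add up to 2π, whence `3 ≤ N`. Conversely,
`sector_inj` identifies any sector with the gap containing the direction `f u + f w`. The
orientation hypothesis puts `b₂` just before `b₁`, that is, last. -/
theorem IsPlanarFan.exists_enumeration (hF : IsPlanarFan L f T) {b₁ b₂ : α} (hT : T b₁ b₂)
    (hb : 0 < cross (f b₂) (f b₁)) :
    ∃ (N : ℕ) (v : ℕ → α), 3 ≤ N ∧ (∀ j, v (j + N) = v j) ∧
      (∀ i < N, ∀ j < N, v i = v j → i = j) ∧ (∀ x ∈ L, ∃ j < N, v j = x) ∧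
      (∀ j, T (v j) (v (j + 1))) ∧
      (∀ u w, T u w → ∃ j < N, (u = v j ∧ w = v (j + 1)) ∨ (u = v (j + 1) ∧ w = v j)) ∧
      (∀ j, 0 < cross (f (v j)) (f (v (j + 1)))) ∧
      ∑ j ∈ Finset.range N, InnerProductGeometry.angle (f (v j)) (f (v (j + 1))) = 2 * Real.pi ∧
      v 0 = b₁ ∧ v (N - 1) = b₂ := by
  classical
  have hb₁ : b₁ ∈ L := hF.mem_left _ _ hT
  set c := f b₁ with hcdef
  have hc : c ≠ 0 := hF.ne_zero _ hb₁
  choose θ₀ hθ₀ hθ₁ hθ₂ using exists_polar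
  set θ : α → ℝ := fun x => θ₀ (f x / c) with hθdef
  set ρ : α → ℝ := fun x => ‖f x / c‖ with hρdef
  have hθ : ∀ x ∈ L, 0 ≤ θ x ∧ θ x < 2 * Real.pi := fun x _ => ⟨hθ₀ _, hθ₁ _⟩
  have hρ : ∀ x ∈ L, 0 < ρ x := fun x hx => norm_pos_iff.2 (div_ne_zero (hF.ne_zero x hx) hc)
  have hf : ∀ x ∈ L, f x = c * (ρ x * exp (θ x * I)) := by
    intro x _
    rw [hρdef, hθdef, ← hθ₂, mul_div_cancel₀ _ hc]
  have hinj : ∀ x ∈ L, ∀ y ∈ L, θ x = θ y → x = y := by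
    intro x hx y hy h
    refine hF.ray_inj x hx y hy (ρ x / ρ y) (div_pos (hρ x hx) (hρ y hy)) ?_
    have : (ρ y : ℂ) ≠ 0 := by exact_mod_cast (hρ y hy).ne'
    rw [hf x hx, hf y hy, h]
    push_cast
    field_simp
  have hθb : θ b₁ = 0 := by
    have h1 := hf b₁ hb₁
    have h2 : ρ b₁ = 1 := by simp [hρdef, ← hcdef, hc]
    rw [h2, ← hcdef, ofReal_one, one_mul] at h1
    have h3 : exp (θ b₁ * I) = 1 := by
      apply mul_left_cancel₀ hc; rw [← h1, mul_one]
    obtain ⟨h4, h5⟩ := hθ b₁ hb₁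
    have h6 := congrArg re h3
    rw [exp_ofReal_mul_I_re, one_re] at h6
    exact (Real.cos_eq_one_iff_of_lt_of_lt (by linarith [Real.pi_pos]) h5).1 h6
  set S := L.image θ with hS
  set N := S.card with hN
  have hNpos : 0 < N := Finset.card_pos.2 ⟨θ b₁, Finset.mem_image_of_mem _ hb₁⟩
  set e := S.orderEmbOfFin hN.symm with he
  have hex : ∀ i : Fin N, ∃ x ∈ L, θ x = e i := by
    intro i
    exact Finset.mem_image.1 (Finset.orderEmbOfFin_mem S hN.symm i)
  choose x₀ hx₀ hx₁ using hex
  set v : ℕ → α := fun j => x₀ ⟨j % N, Nat.mod_lt _ hNpos⟩ with hv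
  -- The value 2π at `N` closes the cycle, matching `v N = v 0`, and makes the gaps telescope to 2π.
  set Θ : ℕ → ℝ := fun j => if h : j < N then e ⟨j, h⟩ else 2 * Real.pi with hΘ
  have hvL : ∀ j, v j ∈ L := fun j => hx₀ _
  have hvper : ∀ j, v (j + N) = v j := by intro j; simp [hv]
  have hvθ : ∀ j < N, θ (v j) = Θ j := by
    intro j hj
    simp only [hv, hΘ, hx₁, dif_pos hj, Nat.mod_eq_of_lt hj]
  have hsurj : ∀ x ∈ L, ∃ j < N, v j = x := by
    intro x hx
    have : θ x ∈ Set.range e := by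
      rw [he, Finset.range_orderEmbOfFin]; exact Finset.mem_image_of_mem _ hx
    obtain ⟨i, hi⟩ := this
    refine ⟨i, i.2, hinj _ (hvL _) _ hx ?_⟩
    rw [hvθ _ i.2, ← hi]; simp [hΘ]
  have hmono : ∀ i < N, ∀ j < N, i < j → Θ i < Θ j := by
    intro i hi j hj hij
    simp only [hΘ, dif_pos hi, dif_pos hj]
    exact e.strictMono hij
  have hvinj : ∀ i < N, ∀ j < N, v i = v j → i = j := by
    intro i hi j hj hij
    have : Θ i = Θ j := by rw [← hvθ i hi, ← hvθ j hj, hij]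
    rcases lt_trichotomy i j with h | h | h
    · exact absurd this (hmono i hi j hj h).ne
    · exact h
    · exact absurd this (hmono j hj i hi h).ne'
  have hΘN : Θ N = 2 * Real.pi := by simp [hΘ]
  have hv0 : v 0 = b₁ := by
    obtain ⟨j, hj, hjb⟩ := hsurj b₁ hb₁
    rcases Nat.eq_zero_or_pos j with rfl | h
    · exact hjb
    · exfalso
      have h1 := hmono 0 hNpos j hj h
      rw [← hvθ 0 hNpos, ← hvθ j hj, hjb, hθb] at h1
      linarith [(hθ _ (hvL 0)).1]
  have hΘ0 : Θ 0 = 0 := by rw [← hvθ 0 hNpos, hv0, hθb]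
  have hΘlt : ∀ j < N, Θ j < Θ (j + 1) := by
    intro j hj
    by_cases h : j + 1 < N
    · exact hmono j hj _ h (Nat.lt_succ_self j)
    · have : Θ (j + 1) = 2 * Real.pi := by simp only [hΘ, dif_neg h]
      rw [this, ← hvθ j hj]; exact (hθ _ (hvL j)).2
  have hfv : ∀ j < N, f (v j) = c * (ρ (v j) * exp (Θ j * I)) := by
    intro j hj; rw [hf _ (hvL j), hvθ j hj]
  have hfv' : ∀ j < N, f (v (j + 1)) = c * (ρ (v (j + 1)) * exp (Θ (j + 1) * I)) := by
    intro j hj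
    by_cases h : j + 1 < N
    · exact hfv _ h
    · have h1 : j + 1 = N := by omega
      have h2 : v (j + 1) = v 0 := by rw [h1]; simpa using hvper 0
      rw [h2, hfv 0 hNpos, h1, hΘ0, hΘN]
      push_cast
      rw [exp_two_pi_mul_I]; simp
  have hstep : ∀ j < N, T (v j) (v (j + 1)) ∧ Θ (j + 1) - Θ j < Real.pi := by
    intro j hj
    refine hF.gap hc hθ hρ hf ?_ (hΘlt j hj) ?_ (hvL _) (hvL _) (hfv j hj) (hfv' j hj) ?_
    · rw [← hvθ j hj]; exact (hθ _ (hvL j)).1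
    · by_cases h : j + 1 < N
      · rw [← hvθ _ h]; exact (hθ _ (hvL _)).2.le
      · simp [hΘ, h]
    · intro x hx
      obtain ⟨i, hi, rfl⟩ := hsurj x hx
      rw [hvθ i hi]
      rcases lt_trichotomy i j with h | h | h
      · exact Or.inl (hmono i hi j hj h).le
      · rw [h]; exact Or.inl le_rfl
      · right
        rcases Nat.lt_or_ge (j + 1) i with h' | h'
        · exact (hmono _ (by omega) _ hi h').le
        · have : i = j + 1 := by omega
          rw [this]
  have hcross : ∀ j < N, 0 < cross (f (v j)) (f (v (j + 1))) := by
    intro j hj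
    rw [hfv j hj, hfv' j hj, cross_mul_mul, cross_exp_exp]
    have h1 := hρ _ (hvL j)
    have h2 := hρ _ (hvL (j + 1))
    have h3 : 0 < Real.sin (Θ (j + 1) - Θ j) :=
      Real.sin_pos_of_pos_of_lt_pi (by linarith [hΘlt j hj]) (hstep j hj).2
    have h4 : 0 < normSq c := normSq_pos.2 hc
    positivity
  have hmod : ∀ j, v j = v (j % N) ∧ v (j + 1) = v (j % N + 1) := by
    intro j; simp [hv]
  have hsum : ∑ j ∈ Finset.range N, (Θ (j + 1) - Θ j) = 2 * Real.pi := by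
    rw [Finset.sum_range_sub, hΘN, hΘ0, sub_zero]
  have hN3 : 3 ≤ N := by
    by_contra h
    have : ∑ j ∈ Finset.range N, (Θ (j + 1) - Θ j) < ∑ j ∈ Finset.range N, Real.pi :=
      Finset.sum_lt_sum_of_nonempty ⟨0, Finset.mem_range.2 hNpos⟩
        fun j hj => (hstep j (Finset.mem_range.1 hj)).2
    rw [hsum, Finset.sum_const, Finset.card_range, nsmul_eq_mul] at this
    have h2 : (N : ℝ) ≤ 2 := by exact_mod_cast (by omega : N ≤ 2)
    nlinarith [Real.pi_pos]
  have hTall : ∀ u w, T u w →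
      ∃ j < N, (u = v j ∧ w = v (j + 1)) ∨ (u = v (j + 1) ∧ w = v j) := by
    intro u w huw
    have hcr := hF.cross_ne u w huw
    set z := f u + f w with hz
    have hcz : cross (f u) z = cross (f u) (f w) := by
      simp only [hz, cross, add_re, add_im]; ring
    have hcz' : cross z (f w) = cross (f u) (f w) := by
      simp only [hz, cross, add_re, add_im]; ring
    have hz0 : z ≠ 0 := by
      intro h; rw [h] at hcz; apply hcr; rw [← hcz]; simp [cross]
    have hφ : z = c * (‖z / c‖ * exp (θ₀ (z / c) * I)) := by
      rw [← hθ₂, mul_div_cancel₀ _ hc]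
    have hr : 0 < ‖z / c‖ := norm_pos_iff.2 (div_ne_zero hz0 hc)
    set r := ‖z / c‖
    have hφ0 := hθ₀ (z / c)
    have hφ1 := hθ₁ (z / c)
    set φ := θ₀ (z / c)
    obtain ⟨j, hj, hj1, hj2⟩ : ∃ j < N, Θ j ≤ φ ∧ φ < Θ (j + 1) := by
      have hP : ∃ j, φ < Θ (j + 1) := ⟨N - 1, by
        rw [Nat.sub_add_cancel hNpos, hΘN]; exact hφ1⟩
      have hlt : Nat.find hP < N := by
        have : Nat.find hP ≤ N - 1 := Nat.find_min' hP (by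
          rw [Nat.sub_add_cancel hNpos, hΘN]; exact hφ1)
        omega
      refine ⟨Nat.find hP, hlt, ?_, Nat.find_spec hP⟩
      rcases Nat.eq_zero_or_pos (Nat.find hP) with h | h
      · rw [h, hΘ0]; exact hφ0
      · have := Nat.find_min hP (m := Nat.find hP - 1) (by omega)
        rw [Nat.sub_add_cancel h] at this
        exact not_lt.1 this
    refine ⟨j, hj, ?_⟩
    rcases hj1.eq_or_lt with h | h
    · exfalso
      have hρj := hρ _ (hvL j)
      have hρj' : (ρ (v j) : ℂ) ≠ 0 := by exact_mod_cast hρj.ne'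
      have hr' : (r : ℂ) ≠ 0 := by exact_mod_cast hr.ne'
      have h1 : f (v j) = (ρ (v j) / r : ℝ) * z := by
        rw [hfv j hj, hφ, h]; push_cast; field_simp
      have h2 := hF.ray u w (v j) huw (hvL j) (ρ (v j) / r) (ρ (v j) / r) (by positivity)
        (by positivity) (by rw [h1, hz]; ring)
      rcases h2 with h2 | h2
      · rw [h2] at h1
        have : cross (f u) z = (ρ u / r) * cross z z := by
          conv_lhs => rw [h1]
          simp only [cross, re_ofReal_mul, im_ofReal_mul]; ring
        rw [cross_self_eq_zero, mul_zero, hcz] at this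
        exact hcr this
      · rw [h2] at h1
        have : cross z (f w) = (ρ w / r) * cross z z := by
          conv_lhs => rw [h1]
          simp only [cross, re_ofReal_mul, im_ofReal_mul]; ring
        rw [cross_self_eq_zero, mul_zero, hcz'] at this
        exact hcr this
    · obtain ⟨l, m, -, -, hl, hm, hlm⟩ := exists_sector_coeff h.le hj2.le (hstep j hj).2
        (hΘlt j hj)
      have h1 := hρ _ (hvL j)
      have h2 := hρ _ (hvL (j + 1))
      have hl := hl hj2
      have hm := hm h
      have e1 : (ρ (v j) : ℂ) ≠ 0 := by exact_mod_cast h1.ne'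
      have e2 : (ρ (v (j + 1)) : ℂ) ≠ 0 := by exact_mod_cast h2.ne'
      refine hF.sector_inj u w _ _ huw (hstep j hj).1 1 1 (r * l / ρ (v j))
        (r * m / ρ (v (j + 1))) one_pos one_pos (by positivity) (by positivity) ?_
      rw [ofReal_one, one_mul, one_mul, ← hz, hφ, hlm, hfv j hj, hfv' j hj]
      push_cast
      field_simp
  refine ⟨N, v, hN3, hvper, hvinj, hsurj, fun j => ?_, hTall, fun j => ?_, ?_, hv0, ?_⟩
  · rw [(hmod j).1, (hmod j).2]; exact (hstep _ (Nat.mod_lt _ hNpos)).1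
  · rw [(hmod j).1, (hmod j).2]; exact hcross _ (Nat.mod_lt _ hNpos)
  · rw [← hsum]
    refine Finset.sum_congr rfl fun j hj => ?_
    have hj := Finset.mem_range.1 hj
    rw [hfv j hj, hfv' j hj]
    exact angle_exp_exp (hρ _ (hvL j)) (hρ _ (hvL _)) (hΘlt j hj).le (hstep j hj).2.le hc
  · obtain ⟨j, hj, ⟨h1, h2⟩ | ⟨h1, h2⟩⟩ := hTall _ _ hT
    · exfalso
      have := hcross j hj
      rw [← h1, ← h2, cross_swap, ← hcdef] at this
      linarith
    · rcases Nat.lt_or_ge (j + 1) N with h | h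
      · have := hvinj (j + 1) h 0 hNpos (by rw [← h1, hv0])
        omega
      · have : N - 1 = j := by omega
        rw [this, h2]

end PlanarFan

/-! ### The face angles of a convex cone sum to at most 2π -/

section AngleSum

open InnerProductGeometry

variable {V : Type*} [NormedAddCommGroup V] [InnerProductSpace ℝ V]

theorem Finset.sum_range_shift_of_periodic {M : Type*} [AddCommMonoid M] {g : ℕ → M} {N : ℕ}
    (h : ∀ j, g (j + N) = g j) : ∑ j ∈ Finset.range N, g (j + 1) = ∑ j ∈ Finset.range N, g j := by
  rcases N with _ | N
  · simp
  · rw [Finset.sum_range_succ, Finset.sum_range_succ']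
    have := h 0
    rw [zero_add] at this
    rw [this]

/-- Cramer's rule. Its coefficients are those in which convexity of the height over three successive
rays is expressed. -/
theorem cross_combination (a b c : ℂ) : cross b c • a + cross a b • c = cross a c • b := by
  apply Complex.ext
  · simp [cross]; ring
  · simp [cross]; ring

theorem mem_span_nnreal_pair {x p q : V} {a b : ℝ} (ha : 0 ≤ a) (hb : 0 ≤ b)
    (h : x = a • p + b • q) : x ∈ Submodule.span NNReal {p, q} :=
  Submodule.mem_span_pair.2 ⟨⟨a, ha⟩, ⟨b, hb⟩, by rw [h]; rfl⟩

/-- Dividing each edge vector by its height gives `X j + w`, with the `X j` in a plane. Strict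
convexity of `h` makes the polygon of the `X j` convex at each vertex. The apex angles are `N * π`
minus the angles at the polygon's vertices. There the two planar angles add up to the angle between
the polygon's edges, while the two lifted ones add up to at least that angle by the triangle
inequality for angles. -/
theorem sum_angle_le_two_pi_of_strict (ι : ℂ →ₗᵢ[ℝ] V) (w : V)
    (hw : ∀ (y : ℂ) (r : ℝ), ι y + r • w = 0 → y = 0 ∧ r = 0) {N : ℕ} {y : ℕ → ℂ} {h : ℕ → ℝ}
    (hy : ∀ j, y (j + N) = y j) (hh : ∀ j, h (j + N) = h j) (hpos : ∀ j, 0 < h j)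
    (hcr : ∀ j, 0 < cross (y j) (y (j + 1)))
    (hconv : ∀ j, cross (y j) (y (j + 2)) * h (j + 1) <
      cross (y (j + 1)) (y (j + 2)) * h j + cross (y j) (y (j + 1)) * h (j + 2))
    (hsum : ∑ j ∈ Finset.range N, angle (y j) (y (j + 1)) = 2 * Real.pi) :
    ∑ j ∈ Finset.range N, angle (ι (y j) + h j • w) (ι (y (j + 1)) + h (j + 1) • w) ≤
      2 * Real.pi := by
  have hy0 : ∀ j, y j ≠ 0 := by
    intro j h0
    have := hcr j
    rw [h0] at this
    simp [cross] at this
  set X : ℕ → V := fun j => ι ((h j)⁻¹ • y j) with hX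
  set x : ℕ → V := fun j => X j + w with hx
  have hX0 : ∀ j, X j ≠ 0 := by
    intro j h0
    have h1 := (map_eq_zero_iff ι ι.injective).1 h0
    exact (smul_ne_zero (inv_ne_zero (hpos j).ne') (hy0 j)) h1
  have hx0 : ∀ j, x j ≠ 0 := by
    intro j h0
    have := (hw _ 1 (by rw [one_smul]; exact h0)).2
    exact one_ne_zero this
  have hXper : ∀ j, X (j + N) = X j := by intro j; simp only [hX, hy, hh]
  have hxper : ∀ j, x (j + N) = x j := by intro j; simp only [hx, hXper]
  have hxX : ∀ i j, x i - x j = X i - X j := by intro i j; simp only [hx]; abel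
  have hang : ∀ j, angle (ι (y j) + h j • w) (ι (y (j + 1)) + h (j + 1) • w) =
      angle (x j) (x (j + 1)) := by
    have e : ∀ j, ι (y j) + h j • w = h j • x j := by
      intro j
      simp only [hx, hX, map_smul, smul_add, smul_smul, mul_inv_cancel₀ (hpos j).ne', one_smul]
    intro j
    rw [e, e, angle_smul_left_of_pos _ _ (hpos _), angle_smul_right_of_pos _ _ (hpos _)]
  have hang' : ∀ j, angle (y j) (y (j + 1)) = angle (X j) (X (j + 1)) := by
    intro j
    simp only [hX, LinearIsometry.angle_map]
    rw [angle_smul_left_of_pos _ _ (inv_pos.2 (hpos _)),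
      angle_smul_right_of_pos _ _ (inv_pos.2 (hpos _))]
  -- Each triangle with apex 0 has angle sum π; a cyclic shift collects the remaining angles by
  -- polygon vertex.
  have key : ∀ g : ℕ → V, (∀ j, g j ≠ 0) → (∀ j, g (j + N) = g j) →
      ∑ j ∈ Finset.range N, angle (g j) (g (j + 1)) = N * Real.pi -
        ∑ j ∈ Finset.range N, (angle (g (j + 1)) (g (j + 1) - g (j + 2)) +
          angle (g (j + 1)) (g (j + 1) - g j)) := by
    intro g hg hgper
    have h1 : ∀ j, angle (g j) (g (j + 1)) =
        Real.pi - (angle (g j) (g j - g (j + 1)) + angle (g (j + 1)) (g (j + 1) - g j)) := by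
      intro j
      have := angle_add_angle_sub_add_angle_sub_eq_pi (g j) (hg (j + 1))
      linarith
    have h2 := Finset.sum_range_shift_of_periodic (N := N)
      (g := fun j => angle (g j) (g j - g (j + 1)))
      (fun j => by rw [hgper, show j + N + 1 = j + 1 + N by ring, hgper])
    rw [Finset.sum_congr rfl fun j _ => h1 j, Finset.sum_sub_distrib, Finset.sum_const,
      Finset.card_range, nsmul_eq_mul, Finset.sum_add_distrib, Finset.sum_add_distrib, ← h2]
  rw [Finset.sum_congr rfl fun j _ => hang' j, key X hX0 hXper] at hsum
  rw [Finset.sum_congr rfl fun j _ => hang j, key x hx0 hxper, ← hsum]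
  refine sub_le_sub_left (Finset.sum_le_sum fun j _ => ?_) _
  -- The radius vector lies in the cone of the vectors from the two neighbouring vertices, so it
  -- splits the angle between them. The denominator `D` is the convexity defect of `h`, positive by
  -- `hconv`.
  have hmem : X (j + 1) ∈ Submodule.span NNReal {x (j + 1) - x (j + 2), x (j + 1) - x j} := by
    have hc := hconv j
    set α := cross (y (j + 1)) (y (j + 2)) with hα
    set γ := cross (y j) (y (j + 1)) with hγ
    set κ := cross (y j) (y (j + 2)) with hκ
    set D := α * h j + γ * h (j + 2) - κ * h (j + 1) with hD
    have hDpos : 0 < D := by rw [hD]; linarith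
    have hαpos : 0 < α := hcr (j + 1)
    have hγpos : 0 < γ := hcr j
    have h0 := hpos j
    have h2 := hpos (j + 2)
    refine mem_span_nnreal_pair (a := γ * h (j + 2) / D) (b := α * h j / D) (by positivity)
      (by positivity) ?_
    have e := congrArg ι (cross_combination (y j) (y (j + 1)) (y (j + 2)))
    rw [map_add, map_smul, map_smul, map_smul, ← hα, ← hγ, ← hκ] at e
    have e' : ∀ i, ι (y i) = h i • X i := by
      intro i
      simp only [hX, map_smul, smul_smul, mul_inv_cancel₀ (hpos i).ne', one_smul]
    rw [e', e', e'] at e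
    have h3 : D • X (j + 1) = (γ * h (j + 2)) • (X (j + 1) - X (j + 2)) +
        (α * h j) • (X (j + 1) - X j) := by
      rw [hD]
      rw [← sub_eq_zero] at e ⊢
      rw [← e]
      module
    rw [hxX, hxX, div_eq_inv_mul, div_eq_inv_mul, mul_smul D⁻¹, mul_smul D⁻¹, ← smul_add, ← h3,
      smul_smul, inv_mul_cancel₀ hDpos.ne', one_smul]
  have h1 := angle_eq_angle_add_add_angle_add_of_mem_span (hX0 (j + 1)) hmem
  rw [← hxX, ← hxX, angle_comm (X (j + 1)) (x (j + 1) - x (j + 2)), ← h1,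
    angle_comm (x (j + 1)) (x (j + 1) - x (j + 2))]
  exact angle_le_angle_add_angle _ _ _

/-- The norm is strictly convex across rays: this is the strict triangle inequality applied to
`cross_combination`. -/
theorem cross_mul_norm_lt {a b c : ℂ} (hab : 0 < cross a b) (hbc : 0 < cross b c) :
    cross a c * ‖b‖ < cross b c * ‖a‖ + cross a b * ‖c‖ := by
  have hnot : ¬ SameRay ℝ (cross b c • a) (cross a b • c) := by
    intro h
    have ha : a ≠ 0 := by rintro rfl; simp [cross] at hab
    have hc : c ≠ 0 := by rintro rfl; simp [cross] at hbc
    obtain ⟨r, hr, h⟩ := (SameRay.exists_pos_right (h)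
      (smul_ne_zero hbc.ne' ha) (smul_ne_zero hab.ne' hc)).imp fun r h => h
    have h2 : cross b (cross b c • a) = r * cross b (cross a b • c) := by
      rw [h]; simp [cross]; ring
    have h3 : cross b (cross b c • a) = - (cross b c * cross a b) := by simp [cross]; ring
    have h4 : cross b (cross a b • c) = cross a b * cross b c := by simp [cross]; ring
    rw [h3, h4] at h2
    have : 0 < cross b c * cross a b := by positivity
    have : 0 < r * (cross a b * cross b c) := by positivity
    linarith
  have h1 := norm_add_lt_of_not_sameRay hnot
  rw [cross_combination, norm_smul, norm_smul, norm_smul, Real.norm_of_nonneg hbc.le,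
    Real.norm_of_nonneg hab.le] at h1
  exact (mul_le_mul_of_nonneg_right (le_abs_self _) (norm_nonneg _)).trans_lt h1

/-- Coplanar faces give equality in `hconv`, and edges in the supporting plane have height 0.
Replacing `h` by h + ε‖y‖ makes both strict, and the angle sum is continuous as ε tends to 0. -/
theorem sum_angle_le_two_pi (ι : ℂ →ₗᵢ[ℝ] V) (w : V)
    (hw : ∀ (y : ℂ) (r : ℝ), ι y + r • w = 0 → y = 0 ∧ r = 0) {N : ℕ} {y : ℕ → ℂ} {h : ℕ → ℝ}
    (hy : ∀ j, y (j + N) = y j) (hh : ∀ j, h (j + N) = h j) (hpos : ∀ j, 0 ≤ h j)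
    (hcr : ∀ j, 0 < cross (y j) (y (j + 1)))
    (hconv : ∀ j, cross (y j) (y (j + 2)) * h (j + 1) ≤
      cross (y (j + 1)) (y (j + 2)) * h j + cross (y j) (y (j + 1)) * h (j + 2))
    (hsum : ∑ j ∈ Finset.range N, angle (y j) (y (j + 1)) = 2 * Real.pi) :
    ∑ j ∈ Finset.range N, angle (ι (y j) + h j • w) (ι (y (j + 1)) + h (j + 1) • w) ≤
      2 * Real.pi := by
  have hy0 : ∀ j, y j ≠ 0 := by
    intro j h0
    have := hcr j
    rw [h0] at this
    simp [cross] at this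
  set F : ℝ → ℝ := fun ε => ∑ j ∈ Finset.range N, angle (ι (y j) + (h j + ε * ‖y j‖) • w)
    (ι (y (j + 1)) + (h (j + 1) + ε * ‖y (j + 1)‖) • w) with hF
  have hcont : ContinuousAt F 0 := by
    have hne : ∀ j, ι (y j) + (h j + 0 * ‖y j‖) • w ≠ 0 := fun j h0 => hy0 j (hw _ _ h0).1
    refine tendsto_finsetSum _ fun j _ => ?_
    have h1 : ContinuousAt (fun ε : ℝ => (ι (y j) + (h j + ε * ‖y j‖) • w,
        ι (y (j + 1)) + (h (j + 1) + ε * ‖y (j + 1)‖) • w)) 0 := by fun_prop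
    exact ContinuousAt.comp (f := fun ε : ℝ => (ι (y j) + (h j + ε * ‖y j‖) • w,
        ι (y (j + 1)) + (h (j + 1) + ε * ‖y (j + 1)‖) • w)) (x := (0:ℝ))
        (g := fun p : V × V => angle p.1 p.2) (continuousAt_angle (hne j) (hne (j + 1))) h1
  have hF0 : F 0 = ∑ j ∈ Finset.range N,
      angle (ι (y j) + h j • w) (ι (y (j + 1)) + h (j + 1) • w) := by
    simp [hF]
  rw [← hF0]
  refine le_of_tendsto (hcont.tendsto.mono_left (nhdsWithin_le_nhds (s := Set.Ioi 0))) ?_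
  filter_upwards [self_mem_nhdsWithin] with ε hε
  have hε : 0 < ε := hε
  refine sum_angle_le_two_pi_of_strict ι w hw (h := fun j => h j + ε * ‖y j‖) hy
    (fun j => by simp only [hy, hh]) (fun j => ?_) hcr (fun j => ?_) hsum
  · have h1 := hpos j
    have h2 := norm_pos_iff.2 (hy0 j)
    positivity
  · have h1 := hconv j
    have h2 := cross_mul_norm_lt (hcr j) (hcr (j + 1))
    nlinarith

end AngleSum

open Geometry

/-! ### Faces at a boundary vertex and projection along an inward direction -/

section VertexFan

variable {E : Type*} [NormedAddCommGroup E] [NormedSpace ℝ E]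

theorem exists_pos_smul_add_mem {P : Set E} (hP : Convex ℝ P) {b x y : E}
    (hx : ∃ δ > (0 : ℝ), b + δ • x ∈ P) (hy : ∃ δ > (0 : ℝ), b + δ • y ∈ P) :
    ∃ δ > (0 : ℝ), b + δ • (x + y) ∈ P := by
  obtain ⟨p, hp, hx⟩ := hx
  obtain ⟨q, hq, hy⟩ := hy
  refine ⟨p * q / (p + q), by positivity, ?_⟩
  have := hP hx hy (a := q / (p + q)) (b := p / (p + q)) (by positivity) (by positivity)
    (by field_simp; ring)
  convert this using 1
  have hpq : p + q ≠ 0 := by positivity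
  match_scalars <;> field_simp
  ring

theorem exists_pos_smul_smul_mem {P : Set E} {b x : E} (hb : b ∈ P)
    (hx : ∃ δ > (0 : ℝ), b + δ • x ∈ P) {a : ℝ} (ha : 0 ≤ a) :
    ∃ δ > (0 : ℝ), b + δ • (a • x) ∈ P := by
  rcases ha.eq_or_lt with rfl | ha
  · exact ⟨1, one_pos, by simpa using hb⟩
  · obtain ⟨p, hp, hx⟩ := hx
    refine ⟨p / a, by positivity, ?_⟩
    rwa [smul_smul, div_mul_cancel₀ _ ha.ne']

theorem Convex.add_smul_mem_of_le {P : Set E} (hP : Convex ℝ P) {b x : E} {δ δ' : ℝ} (hb : b ∈ P)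
    (hx : b + δ • x ∈ P) (h0 : 0 ≤ δ') (h1 : δ' ≤ δ) : b + δ' • x ∈ P := by
  rcases h0.eq_or_lt with rfl | h0
  · simpa using hb
  have hδ : 0 < δ := h0.trans_le h1
  have := hP.add_smul_sub_mem hb hx (t := δ' / δ) ⟨by positivity, by rw [div_le_one hδ]; exact h1⟩
  rwa [add_sub_cancel_left, smul_smul, div_mul_cancel₀ _ hδ.ne'] at this

variable {K : SimplicialComplex ℝ E}

theorem Geometry.SimplicialComplex.smul_nonpos_of_mem_face {P : Set E} (hP : Convex ℝ P)
    (hK : K.space = frontier P) {b c x x' : E} (hbP : b ∈ P)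
    (hc : c ∈ interior P) {s : Finset E} (hs : s ∈ K.faces) (hbs : b ∈ s) {δ δ' σ : ℝ}
    (hδ : 0 < δ) (hx : b + δ • x ∈ P) (hδ' : 0 < δ')
    (hx' : b + δ' • x' ∈ convexHull ℝ (s : Set E)) (h : x' = x + σ • (c - b)) : σ ≤ 0 := by
  by_contra hσ
  obtain ⟨δ₁, hδ₁, H⟩ := exists_add_smul_mem_interior hP hbP hc hδ hx (not_le.1 hσ)
  have h1 : 0 < min δ₁ δ' := lt_min hδ₁ hδ'
  have h2 := H _ h1 (min_le_left _ _)
  rw [← h] at h2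
  have h3 := (convex_convexHull ℝ (s : Set E)).add_smul_mem_of_le
    (subset_convexHull ℝ _ hbs) hx' h1.le (min_le_right _ _)
  have h4 : b + min δ₁ δ' • x' ∈ frontier P := by
    rw [← hK]; exact SimplicialComplex.mem_space_iff.2 ⟨s, hs, h3⟩
  exact h4.2 h2

/-- Moving inward from a direction of `P` enters the interior, which no face meets. Applied both
ways, this makes projection along `c - b` injective on the cones of the faces at `b`. -/
theorem Geometry.SimplicialComplex.smul_eq_zero_of_mem_face {P : Set E} (hP : Convex ℝ P)
    (hPc : IsClosed P) (hK : K.space = frontier P) {b c x x' : E}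
    (hc : c ∈ interior P) {s t : Finset E} (hs : s ∈ K.faces) (hbs : b ∈ s) (ht : t ∈ K.faces)
    (hbt : b ∈ t) {δ δ' σ : ℝ} (hδ : 0 < δ) (hx : b + δ • x ∈ convexHull ℝ (s : Set E))
    (hδ' : 0 < δ') (hx' : b + δ' • x' ∈ convexHull ℝ (t : Set E)) (h : x' = x + σ • (c - b)) :
    x = x' := by
  have hsub : ∀ {s}, s ∈ K.faces → convexHull ℝ (s : Set E) ⊆ P := fun {s} hs p hp =>
    hPc.frontier_subset (hK ▸ SimplicialComplex.mem_space_iff.2 ⟨s, hs, hp⟩)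
  have hbP : b ∈ P := hsub hs (subset_convexHull ℝ _ hbs)
  have h1 := smul_nonpos_of_mem_face hP hK hbP hc ht hbt hδ (hsub hs hx) hδ' hx' h
  have h2 := smul_nonpos_of_mem_face hP hK hbP hc hs hbs hδ' (hsub ht hx') hδ hx
    (σ := -σ) (by rw [h]; module)
  have : σ = 0 := by linarith
  rw [h, this]; simp

theorem Geometry.SimplicialComplex.mem_of_pair {t : Finset E} [DecidableEq E] {b x : E}
    (hs : ({b, x} : Finset E) ∈ K.faces) (ht : t ∈ K.faces) (hbx : b ≠ x) {δ : ℝ} (h0 : 0 < δ)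
    (h1 : δ < 1) (h : b + δ • (x - b) ∈ convexHull ℝ (t : Set E)) : x ∈ t := by
  have := SimplicialComplex.subset_of_pos_weights hs ht (a := fun v => if v = b then 1 - δ else δ)
    (fun v _ => by split_ifs <;> linarith)
    (by rw [Finset.sum_pair hbx]; simp [hbx.symm])
    (by
      rw [Finset.sum_pair hbx]
      simp only [if_true, if_neg hbx.symm]
      convert h using 1; module)
  exact this (by simp)

theorem Geometry.SimplicialComplex.subset_of_triple {t : Finset E} [DecidableEq E] {b u v : E}
    (hs : ({b, u, v} : Finset E) ∈ K.faces) (ht : t ∈ K.faces) (hbu : b ≠ u) (hbv : b ≠ v)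
    (huv : u ≠ v) {δ l m : ℝ} (h0 : 0 < δ) (hl : 0 < l) (hm : 0 < m) (h1 : δ * (l + m) < 1)
    (h : b + δ • (l • (u - b) + m • (v - b)) ∈ convexHull ℝ (t : Set E)) : {b, u, v} ⊆ t := by
  refine SimplicialComplex.subset_of_pos_weights hs ht
    (a := fun x => if x = b then 1 - δ * (l + m) else if x = u then δ * l else δ * m)
    (fun x _ => ?_) ?_ ?_
  · split_ifs
    · linarith
    · positivity
    · positivity
  · rw [Finset.sum_insert (by simp [hbu, hbv]), Finset.sum_pair huv]
    simp [hbu.symm, hbv.symm, huv.symm]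
    ring
  · rw [Finset.sum_insert (by simp [hbu, hbv]), Finset.sum_pair huv]
    simp only [if_true, if_neg hbu.symm, if_neg hbv.symm, if_neg huv.symm]
    convert h using 1; module

/-- A face with four vertices would be a solid tetrahedron inside the frontier of a closed set,
which has empty interior. -/
theorem Geometry.SimplicialComplex.card_le_three {K : SimplicialComplex ℝ Space3} {P : Set Space3}
    (hPc : IsClosed P) (hK : K.space = frontier P) {s : Finset Space3} (hs : s ∈ K.faces) :
    s.card ≤ 3 := by
  by_contra hcard
  have hind := K.indep hs
  have h4 : s.card = 4 := by
    have := hind.card_le_finrank_succ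
    rw [Fintype.card_coe] at this
    have h2 := Submodule.finrank_le (vectorSpan ℝ (Set.range ((↑) : s → Space3)))
    rw [finrank_euclideanSpace_fin] at h2
    omega
  have hspan : affineSpan ℝ (s : Set Space3) = ⊤ := by
    have := hind.affineSpan_eq_top_iff_card_eq_finrank_add_one.2
      (by rw [Fintype.card_coe, h4, finrank_euclideanSpace_fin])
    simpa using this
  have hne := interior_convexHull_nonempty_iff_affineSpan_eq_top.2 hspan
  obtain ⟨x, hx⟩ := hne
  have hsub : convexHull ℝ (s : Set Space3) ⊆ frontier P := by
    rw [← hK]; exact SimplicialComplex.convexHull_subset_space hs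
  have := interior_mono hsub hx
  rw [interior_frontier hPc] at this
  exact this

/-- The plane orthogonal to `n` is identified with ℂ, and `π` is the oblique projection to it along
`w`. The coefficient of `w` is the height, normalised to 1 at `w`. -/
theorem exists_projection {w n : Space3} (h : 0 < inner ℝ n w) :
    ∃ (ι : ℂ →ₗᵢ[ℝ] Space3) (π : Space3 →ₗ[ℝ] ℂ), (∀ y, π (ι y) = y) ∧ π w = 0 ∧
      (∀ x, x = ι (π x) + (inner ℝ n x / inner ℝ n w) • w) ∧
      ∀ (y : ℂ) (r : ℝ), ι y + r • w = 0 → y = 0 ∧ r = 0 := by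
  have hn : n ≠ 0 := by rintro rfl; simp at h
  have hfin : Module.finrank ℝ (ℝ ∙ n)ᗮ = 2 := by
    have : Fact (Module.finrank ℝ Space3 = 2 + 1) := ⟨by simp⟩
    exact Submodule.finrank_orthogonal_span_singleton hn
  let S := (ℝ ∙ n)ᗮ
  let e : ℂ ≃ₗᵢ[ℝ] S := Complex.orthonormalBasisOneI.equiv
    ((stdOrthonormalBasis ℝ S).reindex (finCongr hfin)) (Equiv.refl _)
  let ι : ℂ →ₗᵢ[ℝ] Space3 := S.subtypeₗᵢ.comp e.toLinearIsometry
  let q : Space3 →ₗ[ℝ] Space3 :=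
    LinearMap.id - ((innerSL ℝ n).toLinearMap.smulRight ((inner ℝ n w)⁻¹ • w))
  have hq : ∀ x, q x = x - (inner ℝ n x / inner ℝ n w) • w := by
    intro x
    simp only [q, LinearMap.sub_apply, LinearMap.id_apply, LinearMap.smulRight_apply,
      smul_smul, div_eq_mul_inv]
    rfl
  have hqS : ∀ x, q x ∈ S := by
    intro x
    rw [Submodule.mem_orthogonal_singleton_iff_inner_right, hq, inner_sub_right, inner_smul_right,
      div_mul_cancel₀ _ h.ne', sub_self]
  let π : Space3 →ₗ[ℝ] ℂ := e.symm.toLinearEquiv.toLinearMap.comp (q.codRestrict S hqS)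
  have hιn : ∀ y, inner ℝ n (ι y) = 0 := fun y =>
    (Submodule.mem_orthogonal_singleton_iff_inner_right.1 (e y).2)
  have hπ : ∀ x, ι (π x) = q x := by
    intro x
    change ((e (e.symm (q.codRestrict S hqS x)) : S) : Space3) = q x
    rw [LinearIsometryEquiv.apply_symm_apply]
    rfl
  refine ⟨ι, π, fun y => ?_, ?_, fun x => ?_, fun y r hyr => ?_⟩
  · apply ι.injective
    rw [hπ, hq, hιn]; simp
  · apply ι.injective
    rw [hπ, hq, div_self h.ne']; simp
  · rw [hπ, hq]; abel
  · have h1 := congrArg (fun x => inner ℝ n x) hyr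
    simp only [inner_add_right, inner_smul_right, hιn, inner_zero_right, zero_add] at h1
    have h2 : r = 0 := (mul_eq_zero.1 h1).resolve_right h.ne'
    refine ⟨?_, h2⟩
    rw [h2, zero_smul, add_zero] at hyr
    exact (map_eq_zero_iff ι ι.injective).1 hyr

theorem exists_supporting_vector {P : Set Space3} (hP : Convex ℝ P)
    {b c : Space3} (hb : b ∉ interior P) (hc : c ∈ interior P) :
    ∃ n : Space3, 0 < inner ℝ n (c - b) ∧ ∀ x ∈ P, 0 ≤ inner ℝ n (x - b) := by
  obtain ⟨g, hg⟩ := geometric_hahn_banach_open_point hP.interior isOpen_interior hb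
  refine ⟨-(InnerProductSpace.toDual ℝ Space3).symm g, ?_, fun x hx => ?_⟩
  · rw [inner_neg_left, InnerProductSpace.toDual_symm_apply, map_sub]
    linarith [hg c hc]
  · rw [inner_neg_left, InnerProductSpace.toDual_symm_apply, map_sub]
    have h1 : closure (interior P) ⊆ {x | g x ≤ g b} :=
      closure_minimal (fun x hx => (hg x hx).le) (isClosed_le g.continuous continuous_const)
    have h2 : x ∈ closure (interior P) := by
      rw [hP.closure_interior_eq_closure_of_nonempty_interior ⟨c, hc⟩]
      exact subset_closure hx
    have : g x ≤ g b := h1 h2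
    linarith

end VertexFan

open Geometry

/-! ### The faces at a vertex as a planar fan -/

section VertexFan

/-- The triangles of `K` at the vertex `b` other than `{b, b₁, b₂}` are the triangles
`{b, v j, v (j + 1)}`, `j < n`, in their order around `b`, from the edge `{b, b₁}` to the edge
`{b, b₂}`, and the angles at `b` sum to at most `2 * π`. -/
structure IsVertexFan (K : SimplicialComplex ℝ Space3) (b b₁ b₂ : Space3) (n : ℕ)
    (v : ℕ → Space3) : Prop where
  two_le : 2 ≤ n
  inj : ∀ i ≤ n, ∀ j ≤ n, v i = v j → i = j
  ne : ∀ j ≤ n, v j ≠ b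
  first : v 0 = b₁
  last : v n = b₂
  triangle : ∀ j < n, ∃ t ∈ triangles K, (t : Set Space3) = {b, v j, v (j + 1)}
  exhaust : ∀ t ∈ triangles K, b ∈ t →
    (t : Set Space3) = {b, b₁, b₂} ∨ ∃ j < n, (t : Set Space3) = {b, v j, v (j + 1)}
  edge : ∀ j ≤ n, ∃ e ∈ edges K, (e : Set Space3) = {b, v j}
  exhaust_edge : ∀ e ∈ edges K, b ∈ e → ∃ j ≤ n, (e : Set Space3) = {b, v j}
  sum_angle : ∑ j ∈ Finset.range n, EuclideanGeometry.angle (v j) b (v (j + 1)) +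
    EuclideanGeometry.angle b₁ b b₂ ≤ 2 * Real.pi

open scoped Classical in
-- Covering comes from `exists_mem_face_of_direction`. The incidence axioms come from injectivity of
-- the projection on the faces at `b`: an equality of projected directions lifts to space, where a
-- relatively interior point determines its face.
theorem exists_isPlanarFan {K : SimplicialComplex ℝ Space3} {P : Set Space3} (hP : Convex ℝ P)
    (hPc : IsClosed P) (hfin : K.faces.Finite) (hK : K.space = frontier P) {b c : Space3}
    (hb : {b} ∈ K.faces) (hc : c ∈ interior P) {ι : ℂ →ₗᵢ[ℝ] Space3} {π : Space3 →ₗ[ℝ] ℂ}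
    {h : Space3 → ℝ} (hπι : ∀ y, π (ι y) = y) (hπw : π (c - b) = 0)
    (hdec : ∀ x, x = ι (π x) + h x • (c - b))
    {L : Finset Space3} (hL : ∀ v, v ∈ L ↔ v ≠ b ∧ {b, v} ∈ K.faces) :
    IsPlanarFan L (fun v => π (v - b))
      (fun u v => {b, u, v} ∈ K.faces ∧ u ≠ v ∧ u ≠ b ∧ v ≠ b) := by
  have hdown : ∀ {u v : Space3}, ({b, u, v} : Finset Space3) ∈ K.faces → {b, u} ∈ K.faces :=
    fun {u v} hf => K.down_closed hf (by intro x; simp; tauto) (by simp)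
  have hpieq : ∀ {x x'}, π x = π x' → x' = x + (h x' - h x) • (c - b) := by
    intro x x' e
    have h1 := hdec x
    have h2 := hdec x'
    rw [← e] at h2
    rw [sub_smul]
    nth_rewrite 1 [h2]
    nth_rewrite 2 [h1]
    abel
  have hinj : ∀ {s t : Finset Space3} {x x' : Space3} {δ δ' : ℝ}, s ∈ K.faces → b ∈ s →
      t ∈ K.faces → b ∈ t → 0 < δ → b + δ • x ∈ convexHull ℝ (s : Set Space3) → 0 < δ' →
      b + δ' • x' ∈ convexHull ℝ (t : Set Space3) → π x = π x' → x = x' :=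
    fun hs hbs ht hbt hδ hx hδ' hx' e =>
      SimplicialComplex.smul_eq_zero_of_mem_face hP hPc hK hc hs hbs ht hbt hδ hx hδ' hx' (hpieq e)
  have hcone : ∀ {u v : Space3} {l m δ : ℝ}, 0 ≤ l → 0 ≤ m → 0 ≤ δ → δ * (l + m) ≤ 1 →
      b + δ • (l • (u - b) + m • (v - b)) ∈
        convexHull ℝ ((({b, u, v} : Finset Space3)) : Set Space3) := by
    intro u v l m δ hl hm hδ h1
    have : (((({b, u, v} : Finset Space3)) : Set Space3)) = {b, u, v} := by simp
    rw [this, mem_convexHull_triple]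
    exact ⟨δ * l, δ * m, by positivity, by positivity, by linarith, by
      rw [smul_add, smul_smul, smul_smul]⟩
  have hray : ∀ {v : Space3}, b + (1 : ℝ) • (v - b) ∈
      convexHull ℝ ((({b, v} : Finset Space3)) : Set Space3) := by
    intro v
    rw [one_smul, add_sub_cancel]
    exact subset_convexHull ℝ _ (by simp)
  have hδ : ∀ {l m : ℝ}, 0 ≤ l → 0 ≤ m → ∃ δ : ℝ, 0 < δ ∧ δ < 1 ∧ δ * (l + m) < 1 := by
    intro l m hl hm
    refine ⟨1 / (2 + (l + m)), by positivity, ?_, ?_⟩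
    · rw [div_lt_one (by positivity)]; linarith
    · rw [div_mul_eq_mul_div, one_mul, div_lt_one (by positivity)]; linarith
  have hzero : b + (1 : ℝ) • (0 : Space3) ∈
      convexHull ℝ ((({b} : Finset Space3)) : Set Space3) := by simp
  have hray' : ∀ u v x : Space3, ({b, u, v} : Finset Space3) ∈ K.faces → x ∈ L → ∀ l m : ℝ,
      0 ≤ l → 0 ≤ m → π (x - b) = l * π (u - b) + m * π (v - b) → x = u ∨ x = v := by
    intro u v x hf hx l m hl hm e
    obtain ⟨hxb, hxf⟩ := (hL x).1 hx
    obtain ⟨δ, h0, h1, h2⟩ := hδ hl hm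
    have e2 := hinj hf (by simp) hxf (by simp) h0 (hcone (u := u) (v := v) hl hm h0.le h2.le)
      one_pos hray (by rw [e, map_add, map_smul, map_smul, Complex.real_smul, Complex.real_smul])
    have h3 : b + δ • (x - b) ∈ convexHull ℝ ((({b, u, v} : Finset Space3)) : Set Space3) := by
      rw [← e2]; exact hcone hl hm h0.le h2.le
    have := SimplicialComplex.mem_of_pair hxf hf hxb.symm h0 h1 h3
    simp only [Finset.mem_insert, Finset.mem_singleton] at this
    tauto
  have hinjray : ∀ u ∈ L, ∀ v ∈ L, ∀ r : ℝ, 0 < r → π (u - b) = r * π (v - b) → u = v := by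
    intro u hu v hv r hr e
    have h1 := ((hL v).1 hv).2
    have h2 : ({b, v, v} : Finset Space3) ∈ K.faces := by simpa using h1
    simpa using hray' v v u h2 hu r 0 hr.le le_rfl (by rw [e]; simp)
  have hne : ∀ v ∈ L, π (v - b) ≠ 0 := by
    intro v hv e
    obtain ⟨hvb, hvf⟩ := (hL v).1 hv
    have := hinj hvf (by simp) hb (by simp) one_pos hray one_pos hzero (by rw [e, map_zero])
    exact hvb (sub_eq_zero.1 this)
  refine ⟨fun u v hT => ?_, fun u v hT => ?_, fun z hz => ?_, ?_, hinjray, hne, ?_, ?_⟩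
  · exact (hL u).2 ⟨hT.2.2.1, hdown hT.1⟩
  · refine ⟨?_, hT.2.1.symm, hT.2.2.2, hT.2.2.1⟩
    rw [Finset.pair_comm v u]; exact hT.1
  · obtain ⟨s, hs, hbs, σ, δ, hδ0, hx⟩ := exists_mem_face_of_direction hP hPc hfin hK hb hc (ι z)
    set x := ι z + σ • (c - b) with hxdef
    have hπx : π x = z := by rw [hxdef, map_add, map_smul, hπι, hπw]; simp
    have hcard := SimplicialComplex.card_le_three hPc hK hs
    -- Vertices and edges are written as triples with repetitions, so one computation handles all
    -- faces.
    have huv : ∃ u v : Space3, s = {b, u, v} := by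
      have h1 : (s.erase b).card ≤ 2 := by rw [Finset.card_erase_of_mem hbs]; omega
      have h2 : s = insert b (s.erase b) := (Finset.insert_erase hbs).symm
      rcases Nat.lt_or_ge (s.erase b).card 1 with h3 | h3
      · refine ⟨b, b, ?_⟩
        have : s.erase b = ∅ := Finset.card_eq_zero.1 (by omega)
        rw [h2, this]; simp
      · rcases Nat.lt_or_ge (s.erase b).card 2 with h4 | h4
        · obtain ⟨u, hu⟩ := Finset.card_eq_one.1 (show (s.erase b).card = 1 by omega)
          exact ⟨u, u, by rw [h2, hu]; simp⟩
        · obtain ⟨u, v, -, hu⟩ := Finset.card_eq_two.1 (show (s.erase b).card = 2 by omega)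
          exact ⟨u, v, by rw [h2, hu]⟩
    obtain ⟨u, v, rfl⟩ := huv
    have hco : ((({b, u, v} : Finset Space3)) : Set Space3) = {b, u, v} := by simp
    rw [hco, mem_convexHull_triple] at hx
    obtain ⟨l, m, hl, hm, -, hx⟩ := hx
    have hx2 : x = (l / δ) • (u - b) + (m / δ) • (v - b) := by
      have := add_left_cancel hx
      rw [div_eq_inv_mul, div_eq_inv_mul, mul_smul, mul_smul, ← smul_add, ← this, smul_smul,
        inv_mul_cancel₀ hδ0.ne', one_smul]
    have hz2 : z = (l / δ : ℝ) * π (u - b) + (m / δ : ℝ) * π (v - b) := by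
      rw [← hπx, hx2, map_add, map_smul, map_smul, Complex.real_smul, Complex.real_smul]
    have hswap : ({b, v, u} : Finset Space3) ∈ K.faces := by rw [Finset.pair_comm v u]; exact hs
    have single : ∀ {u v : Space3} {r : ℝ}, ({b, u, v} : Finset Space3) ∈ K.faces → 0 ≤ r →
        z = r * π (u - b) → ∃ v ∈ L, ∃ r : ℝ, 0 < r ∧ z = r * π (v - b) := by
      intro u v r hf hr e
      have hub : u ≠ b := by
        rintro rfl; apply hz; rw [e]; simp
      refine ⟨u, (hL u).2 ⟨hub, hdown hf⟩, r, ?_, e⟩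
      rcases hr.eq_or_lt with h0 | h0
      · exfalso; apply hz; rw [e, ← h0]; simp
      · exact h0
    by_cases hub : u = b
    · left; exact single hswap (r := m / δ) (by positivity) (by rw [hz2, hub]; simp)
    by_cases hvb : v = b
    · left; exact single hs (r := l / δ) (by positivity) (by rw [hz2, hvb]; simp)
    by_cases huv : u = v
    · left
      refine single hs (r := l / δ + m / δ) (by positivity) ?_
      rw [hz2, huv]; push_cast; ring
    rcases hl.eq_or_lt with h0 | hl
    · left; exact single hswap (r := m / δ) (by positivity) (by rw [hz2, ← h0]; simp)
    rcases hm.eq_or_lt with h0 | hm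
    · left; exact single hs (r := l / δ) (by positivity) (by rw [hz2, ← h0]; simp)
    right
    exact ⟨u, v, ⟨hs, huv, hub, hvb⟩, l / δ, m / δ, by positivity, by positivity, hz2⟩
  · intro u v x hT hx l m hl hm e
    exact hray' u v x hT.1 hx l m hl hm e
  · rintro u v ⟨hf, huv, hub, hvb⟩ hcr
    have hu : u ∈ L := (hL u).2 ⟨hub, hdown hf⟩
    have hv : v ∈ L := (hL v).2 ⟨hvb, hdown (by rw [Finset.pair_comm v u]; exact hf)⟩
    obtain ⟨r, hr⟩ : ∃ r : ℝ, π (u - b) = r * π (v - b) := by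
      have h1 := hne v hv
      set p := π (u - b)
      set q := π (v - b)
      refine ⟨(p.re * q.re + p.im * q.im) / Complex.normSq q, ?_⟩
      have h2 : Complex.normSq q ≠ 0 := (Complex.normSq_pos.2 h1).ne'
      have hcr : p.re * q.im - p.im * q.re = 0 := hcr
      rw [Complex.normSq_apply] at h2
      apply Complex.ext
      · rw [Complex.re_ofReal_mul, Complex.normSq_apply, eq_comm, div_mul_eq_mul_div,
          div_eq_iff h2]
        linear_combination (-q.im) * hcr
      · rw [Complex.im_ofReal_mul, Complex.normSq_apply, eq_comm, div_mul_eq_mul_div,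
          div_eq_iff h2]
        linear_combination q.re * hcr
    -- Opposite rays would give a positive combination projecting to 0. By injectivity it would be
    -- the vertex `b` itself, although it is relatively interior to the triangle.
    rcases lt_trichotomy r 0 with h0 | h0 | h0
    · obtain ⟨δ, h1, h2, h3⟩ := hδ zero_le_one (by linarith : 0 ≤ -r)
      have e := hinj hf (by simp) hb (by simp) h1
        (hcone (u := u) (v := v) zero_le_one (by linarith : 0 ≤ -r) h1.le h3.le) one_pos hzero
        (by
          rw [map_zero, map_add, map_smul, map_smul, hr, Complex.real_smul, Complex.real_smul]
          push_cast; ring)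
      have h4 := SimplicialComplex.subset_of_triple hf hb hub.symm hvb.symm huv h1 one_pos
        (by linarith : 0 < -r) h3 (by rw [e]; simp)
      have : u ∈ ({b} : Finset Space3) := h4 (by simp)
      exact hub (by simpa using this)
    · apply hne u hu; rw [hr, h0]; simp
    · exact huv (hinjray u hu v hv r h0 hr)
  · rintro u v u' v' ⟨hf, huv, hub, hvb⟩ ⟨hf', huv', hub', hvb'⟩ l m l' m' hl hm hl' hm' e
    obtain ⟨δ, h1, h2, h3⟩ := hδ hl.le hm.le
    obtain ⟨δ', h1', h2', h3'⟩ := hδ hl'.le hm'.le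
    have e2 := hinj hf (by simp) hf' (by simp) h1 (hcone hl.le hm.le h1.le h3.le) h1'
      (hcone (u := u') (v := v') hl'.le hm'.le h1'.le h3'.le)
      (by simp only [map_add, map_smul, Complex.real_smul]; exact e)
    have hsub : ({b, u, v} : Finset Space3) ⊆ {b, u', v'} := by
      have h0 : 0 < min δ δ' := lt_min h1 h1'
      refine SimplicialComplex.subset_of_triple hf hf' hub.symm hvb.symm huv h0 hl hm
        ((mul_le_mul_of_nonneg_right (min_le_left _ _) (by positivity)).trans_lt h3) ?_
      rw [e2]
      exact hcone hl'.le hm'.le h0.le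
        ((mul_le_mul_of_nonneg_right (min_le_right _ _) (by positivity)).trans h3'.le)
    have hu := hsub (show u ∈ _ by simp)
    have hv := hsub (show v ∈ _ by simp)
    simp only [Finset.mem_insert, Finset.mem_singleton, hub, hvb, false_or] at hu hv
    rcases hu with h1 | h1 <;> rcases hv with h2 | h2
    · exact absurd (h1.trans h2.symm) huv
    · exact Or.inl ⟨h1, h2⟩
    · exact Or.inr ⟨h1, h2⟩
    · exact absurd (h1.trans h2.symm) huv

end VertexFan

open Geometry

/-! ### Cyclic order and angle sum at a vertex -/

section VertexFan

theorem cross_conj (a b : ℂ) :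
    cross (Complex.conjLIE a) (Complex.conjLIE b) = -cross a b := by
  simp only [cross, Complex.conjLIE_apply, Complex.conj_re, Complex.conj_im]; ring

/-- Composing with complex conjugation changes the sign of the cross product, so a nonzero sign can
be made positive. -/
theorem exists_oriented_projection {w n x x' : Space3} (h : 0 < inner ℝ n w)
    (hx : ∀ π : Space3 →ₗ[ℝ] ℂ, ∀ ι : ℂ →ₗᵢ[ℝ] Space3, (∀ y, π (ι y) = y) → π w = 0 →
      (∀ x, x = ι (π x) + (inner ℝ n x / inner ℝ n w) • w) → cross (π x) (π x') ≠ 0) :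
    ∃ (ι : ℂ →ₗᵢ[ℝ] Space3) (π : Space3 →ₗ[ℝ] ℂ), (∀ y, π (ι y) = y) ∧ π w = 0 ∧
      (∀ x, x = ι (π x) + (inner ℝ n x / inner ℝ n w) • w) ∧
      (∀ (y : ℂ) (r : ℝ), ι y + r • w = 0 → y = 0 ∧ r = 0) ∧ 0 < cross (π x) (π x') := by
  obtain ⟨ι, π, h1, h2, h3, h4⟩ := exists_projection h
  rcases (hx π ι h1 h2 h3).lt_or_gt with h0 | h0
  · refine ⟨ι.comp Complex.conjLIE.toLinearIsometry,
      Complex.conjLIE.toLinearEquiv.toLinearMap.comp π, fun y => ?_, ?_, fun x => ?_,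
      fun y r hyr => ?_, ?_⟩
    · change Complex.conjLIE (π (ι (Complex.conjLIE y))) = y
      rw [h1]; simp
    · change Complex.conjLIE (π w) = 0
      rw [h2, map_zero]
    · change x = ι (Complex.conjLIE (Complex.conjLIE (π x))) + _
      have : Complex.conjLIE (Complex.conjLIE (π x)) = π x := by simp
      rw [this]; exact h3 x
    · obtain ⟨h5, h6⟩ := h4 (Complex.conjLIE y) r hyr
      exact ⟨(map_eq_zero_iff _ Complex.conjLIE.injective).1 h5, h6⟩
    · change 0 < cross (Complex.conjLIE (π x)) (Complex.conjLIE (π x'))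
      rw [cross_conj]; linarith
  · exact ⟨ι, π, h1, h2, h3, h4, h0⟩

theorem IsConvexPolyhedron.convex {P : Set Space3} (hP : IsConvexPolyhedron P) : Convex ℝ P := by
  obtain ⟨⟨V, rfl⟩, -⟩ := hP
  exact convex_convexHull ℝ _

theorem IsConvexPolyhedron.isClosed {P : Set Space3} (hP : IsConvexPolyhedron P) :
    IsClosed P := by
  obtain ⟨⟨V, rfl⟩, -⟩ := hP
  exact V.finite_toSet.isClosed_convexHull ℝ

open scoped Classical in
-- The projected fan is enumerated, and the heights of its edges above a supporting plane satisfy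
-- the hypotheses of `sum_angle_le_two_pi`. The base triangle is the last sector, from `b₂` back to
-- `b₁`; dropping it leaves one triangle fewer than there are rays.
theorem exists_isVertexFan {P : Set Space3} {K : SimplicialComplex ℝ Space3}
    (hPK : IsNonobtuselyTriangulated P K) {b b₁ b₂ : Space3} (hb₁ : b₁ ≠ b) (hb₂ : b₂ ≠ b)
    (hb₁₂ : b₁ ≠ b₂) (hT : {b, b₁, b₂} ∈ K.faces) :
    ∃ (n : ℕ) (v : ℕ → Space3), IsVertexFan K b b₁ b₂ n v := by
  have hP := hPK.polyhedron.convex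
  have hPc := hPK.polyhedron.isClosed
  have hfin := hPK.finite
  have hK := hPK.surface
  obtain ⟨c, hc⟩ := hPK.polyhedron.2
  have hb : {b} ∈ K.faces := K.down_closed hT (by simp) (by simp)
  have hsub : ∀ {s}, s ∈ K.faces → convexHull ℝ (s : Set Space3) ⊆ P := fun {s} hs p hp =>
    hPc.frontier_subset (hK ▸ SimplicialComplex.mem_space_iff.2 ⟨s, hs, hp⟩)
  have hbP : b ∈ P := hsub hb (by simp)
  have hbi : b ∉ interior P := by
    have : b ∈ frontier P := hK ▸ SimplicialComplex.mem_space_iff.2 ⟨_, hb, by simp⟩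
    exact this.2
  obtain ⟨n, hn, hnP⟩ := exists_supporting_vector hP hbi hc
  have hLfin : {v | v ≠ b ∧ ({b, v} : Finset Space3) ∈ K.faces}.Finite := by
    refine (hfin.biUnion fun s _ => s.finite_toSet).subset ?_
    rintro v ⟨-, hv⟩
    exact Set.mem_biUnion hv (by simp)
  set L := hLfin.toFinset with hLdef
  have hL : ∀ v, v ∈ L ↔ v ≠ b ∧ {b, v} ∈ K.faces := fun v => hLfin.mem_toFinset
  have hT' : ({b, b₂, b₁} : Finset Space3) ∈ K.faces := by rw [Finset.pair_comm]; exact hT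
  obtain ⟨ι, π, hπι, hπw, hdec, hind, hor⟩ := exists_oriented_projection (x := b₂ - b)
    (x' := b₁ - b) hn (fun π ι h1 h2 h3 =>
      (exists_isPlanarFan hP hPc hfin hK hb hc h1 h2 h3 hL).cross_ne b₂ b₁
        ⟨hT', hb₁₂.symm, hb₂, hb₁⟩)
  have hF := exists_isPlanarFan hP hPc hfin hK hb hc hπι hπw hdec hL
  obtain ⟨N, v, hN, hper, hinj, hsurj, hstep, hall, hcr, hsum, hv0, hvN⟩ :=
    hF.exists_enumeration (b₁ := b₁) (b₂ := b₂) ⟨hT, hb₁₂, hb₁, hb₂⟩ hor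
  set h : ℕ → ℝ := fun j => inner ℝ n (v j - b) / inner ℝ n (c - b) with hh
  have hvL : ∀ j, v j ≠ b ∧ {b, v j} ∈ K.faces := fun j => (hL _).1 (hF.mem_left _ _ (hstep j))
  have hvP : ∀ j, v j ∈ P := fun j => hsub (hvL j).2 (subset_convexHull ℝ _ (by simp))
  have hvdec : ∀ j, ι (π (v j - b)) + h j • (c - b) = v j - b := fun j => (hdec _).symm
  have hvcone : ∀ j, ∃ δ > (0 : ℝ), b + δ • (v j - b) ∈ P :=
    fun j => ⟨1, one_pos, by rw [one_smul, add_sub_cancel]; exact hvP j⟩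
  -- If this fails, κ times the middle edge vector is a cone combination of its neighbours plus a
  -- positive multiple of `c - b`. For κ ≤ 0 this makes `b` interior; for κ > 0 it makes the middle
  -- edge enter the interior.
  have hconv : ∀ j, cross (π (v j - b)) (π (v (j + 2) - b)) * h (j + 1) ≤
      cross (π (v (j + 1) - b)) (π (v (j + 2) - b)) * h j +
        cross (π (v j - b)) (π (v (j + 1) - b)) * h (j + 2) := by
    intro j
    have e := congrArg ι (cross_combination (π (v j - b)) (π (v (j + 1) - b)) (π (v (j + 2) - b)))
    have hα := hcr (j + 1)
    have hγ := hcr j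
    simp only [show j + 1 + 1 = j + 2 from rfl] at hα
    set α := cross (π (v (j + 1) - b)) (π (v (j + 2) - b))
    set γ := cross (π (v j - b)) (π (v (j + 1) - b))
    set κ := cross (π (v j - b)) (π (v (j + 2) - b))
    rw [map_add, map_smul, map_smul, map_smul] at e
    by_contra hlt
    set s := κ * h (j + 1) - (α * h j + γ * h (j + 2)) with hs
    have hspos : 0 < s := by rw [hs]; linarith
    have hx : ∃ δ > (0 : ℝ), b + δ • (α • (v j - b) + γ • (v (j + 2) - b)) ∈ P :=
      exists_pos_smul_add_mem hP (exists_pos_smul_smul_mem hbP (hvcone j) hα.le)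
        (exists_pos_smul_smul_mem hbP (hvcone (j + 2)) hγ.le)
    have hxeq : κ • (v (j + 1) - b) =
        α • (v j - b) + γ • (v (j + 2) - b) + s • (c - b) := by
      rw [← hvdec j, ← hvdec (j + 1), ← hvdec (j + 2), hs, smul_add κ, ← e]
      module
    rcases le_or_gt κ 0 with hκ | hκ
    · obtain ⟨δ, hδ, hx⟩ := exists_pos_smul_add_mem hP hx
        (exists_pos_smul_smul_mem hbP (hvcone (j + 1)) (neg_nonneg.2 hκ))
      obtain ⟨δ₁, hδ₁, H⟩ := exists_add_smul_mem_interior hP hbP hc hδ hx hspos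
      have := H δ₁ hδ₁ le_rfl
      rw [neg_smul, hxeq] at this
      apply hbi
      convert this using 1
      module
    · obtain ⟨δ, hδ, hx⟩ := hx
      have := SimplicialComplex.smul_nonpos_of_mem_face hP hK hbP hc (hvL (j + 1)).2 (by simp)
        (δ' := 1 / κ) hδ hx (by positivity)
        (by
          rw [smul_smul, one_div_mul_cancel hκ.ne', one_smul, add_sub_cancel]
          exact subset_convexHull ℝ _ (by simp)) hxeq
      linarith
  have hangle := sum_angle_le_two_pi ι (c - b) hind (N := N) (y := fun j => π (v j - b)) (h := h)
    (fun j => by simp only [hper]) (fun j => by simp only [hh, hper])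
    (fun j => div_nonneg (hnP _ (hvP j)) hn.le) hcr hconv hsum
  simp only [hvdec] at hangle
  obtain ⟨m, rfl⟩ : ∃ m, N = m + 1 := ⟨N - 1, by omega⟩
  simp only [Nat.add_sub_cancel] at hvN
  have hvm : v (m + 1) = v 0 := by simpa using hper 0
  have hcoe : ∀ x y z : Space3, (({x, y, z} : Finset Space3) : Set Space3) = {x, y, z} := by
    intros; simp
  refine ⟨m, v, by omega, fun i hi j hj => hinj i (by omega) j (by omega), fun j _ => (hvL j).1,
    hv0, hvN, fun j _ => ?_, fun t ht hbt => ?_, fun j _ => ?_, fun e he hbe => ?_, ?_⟩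
  · obtain ⟨h1, h2, h3, h4⟩ := hstep j
    exact ⟨_, ⟨h1, by rw [Finset.card_eq_three]; exact ⟨_, _, _, h3.symm, h4.symm, h2, rfl⟩⟩,
      hcoe _ _ _⟩
  · obtain ⟨u, w, huw, htb⟩ : ∃ u w, u ≠ w ∧ t.erase b = {u, w} := by
      have h1 : (t.erase b).card = 2 := by rw [Finset.card_erase_of_mem hbt, ht.2]
      obtain ⟨u, w, h2, h3⟩ := Finset.card_eq_two.1 h1
      exact ⟨u, w, h2, h3⟩
    have hu : u ≠ b := Finset.ne_of_mem_erase (s := t) (by rw [htb]; simp)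
    have hw : w ≠ b := Finset.ne_of_mem_erase (s := t) (by rw [htb]; simp)
    have hteq : t = {b, u, w} := by rw [← htb, Finset.insert_erase hbt]
    obtain ⟨j, hj, h1⟩ := hall u w ⟨hteq ▸ ht.1, huw, hu, hw⟩
    have h2 : (t : Set Space3) = {b, v j, v (j + 1)} := by
      rw [hteq, hcoe]
      rcases h1 with ⟨rfl, rfl⟩ | ⟨rfl, rfl⟩
      · rfl
      · rw [Set.pair_comm]
    rcases Nat.lt_or_ge j m with h | h
    · exact Or.inr ⟨j, h, h2⟩
    · left
      obtain rfl : j = m := by omega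
      rw [h2, hvm, hv0, hvN, Set.pair_comm]
  · exact ⟨{b, v j}, ⟨(hvL j).2, Finset.card_pair (hvL j).1.symm⟩, by simp⟩
  · obtain ⟨u, heb⟩ : ∃ u, e.erase b = {u} :=
      Finset.card_eq_one.1 (by rw [Finset.card_erase_of_mem hbe, he.2])
    have hu : u ≠ b := Finset.ne_of_mem_erase (s := e) (by rw [heb]; simp)
    have heq : e = {b, u} := by rw [← heb, Finset.insert_erase hbe]
    obtain ⟨j, hj, rfl⟩ := hsurj u ((hL u).2 ⟨hu, heq ▸ he.1⟩)
    exact ⟨j, by omega, by rw [heq]; simp⟩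
  · rw [Finset.sum_range_succ, hvm, hv0, hvN] at hangle
    unfold EuclideanGeometry.angle
    simp only [vsub_eq_sub]
    rw [InnerProductGeometry.angle_comm (b₁ - b)]
    exact hangle

end VertexFan

/-! ### Trigonometric estimates for one group of fan triangles -/

section Wing

open Real

/-- Up to angle π/2, expanding cos(A_j + f) drops a nonnegative sine product, and `hproj` bounds
r_{j+1} cos f by r_j. From π/2 to 3π/2 the projection is nonpositive, hence below the starting
value. -/
theorem radius_mul_cos_le {r A : ℕ → ℝ} {k : ℕ} (hr : ∀ j ≤ k, 0 < r j)
    (hmono : ∀ j < k, A j ≤ A (j + 1)) (hA0 : 0 ≤ A 0) (hAk : A k ≤ 3 * π / 2)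
    (hproj : ∀ j < k, r (j + 1) * cos (A (j + 1) - A j) ≤ r j)
    {i j : ℕ} (hi : 0 ≤ r i * cos (A i)) (hij : i ≤ j) (hj : j ≤ k) :
    r j * cos (A j) ≤ r i * cos (A i) := by
  have hA : ∀ j ≤ k, 0 ≤ A j := by
    intro j
    induction j with
    | zero => exact fun _ => hA0
    | succ j ih => exact fun h => (ih (by omega)).trans (hmono j (by omega))
  have hAle : ∀ m, m ≤ k → A (k - m) ≤ 3 * π / 2 := by
    intro m
    induction m with
    | zero => exact fun _ => hAk
    | succ m ih =>
      intro h
      have := hmono (k - (m + 1)) (by omega)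
      rw [show k - (m + 1) + 1 = k - m by omega] at this
      exact this.trans (ih (by omega))
  induction j, hij using Nat.le_induction with
  | base => exact le_rfl
  | succ j hij ih =>
    have ih := ih (by omega)
    rcases le_or_gt (π / 2) (A (j + 1)) with h | h
    · have h1 : A (j + 1) ≤ 3 * π / 2 := by
        have := hAle (k - (j + 1)) (by omega)
        rwa [show k - (k - (j + 1)) = j + 1 by omega] at this
      have : cos (A (j + 1)) ≤ 0 := cos_nonpos_of_pi_div_two_le_of_le h (by linarith)
      exact (mul_nonpos_of_nonneg_of_nonpos (hr _ hj).le this).trans hi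
    · have h0 := hA j (by omega)
      have h1 := hmono j (by omega)
      have h2 := hproj j (by omega)
      have h3 := hr (j + 1) hj
      set f := A (j + 1) - A j with hf
      have e : A (j + 1) = A j + f := by rw [hf]; ring
      have hf0 : 0 ≤ f := by rw [hf]; linarith
      have s1 : 0 ≤ sin (A j) := sin_nonneg_of_nonneg_of_le_pi h0 (by linarith)
      have s2 : 0 ≤ sin f := sin_nonneg_of_nonneg_of_le_pi hf0 (by linarith)
      have c1 : 0 ≤ cos (A j) := cos_nonneg_of_mem_Icc ⟨by linarith, by linarith⟩
      refine le_trans ?_ ih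
      rw [e, cos_add]
      have h4 : 0 ≤ r (j + 1) * (sin (A j) * sin f) := by positivity
      have h5 := mul_le_mul_of_nonneg_right h2 c1
      nlinarith

/-- The quantity is the signed distance of a wing vertex from the opposite side's line. For A ≤ π/2
the projection bound suffices; beyond that, β + β' ≥ π/2 and the cap on `A` keep A - β' in [0, π].
-/
theorem radius_mul_sin_sub_nonneg {r A c β β' : ℝ} (hr : 0 < r) (hA0 : 0 ≤ A)
    (hA : A ≤ 3 * π / 2 - β) (hβ' : 0 ≤ β') (hβ'' : β' ≤ π / 2) (hββ' : π / 2 ≤ β + β')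
    (hc : 0 ≤ c) (h : r * cos A ≤ c) : 0 ≤ c * sin β' + r * sin (A - β') := by
  have s1 : 0 ≤ sin β' := sin_nonneg_of_nonneg_of_le_pi hβ' (by linarith)
  rcases le_or_gt A (π / 2) with h1 | h1
  · have s2 : 0 ≤ sin A := sin_nonneg_of_nonneg_of_le_pi hA0 (by linarith)
    have c2 : 0 ≤ cos β' := cos_nonneg_of_mem_Icc ⟨by linarith, by linarith⟩
    rw [sin_sub]
    have h3 : 0 ≤ r * (sin A * cos β') := by positivity
    have h4 := mul_le_mul_of_nonneg_right h s1
    nlinarith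
  · have s2 : 0 ≤ sin (A - β') := sin_nonneg_of_nonneg_of_le_pi (by linarith) (by linarith)
    positivity

theorem sin_nonneg_or_cos_add_nonpos {A A' β : ℝ} (hA0 : 0 ≤ A) (hA : A ≤ A')
    (hA' : A' ≤ 3 * π / 2 - β) (hstep : A' ≤ A + π / 2) (hβ : 0 ≤ β) :
    (0 ≤ sin A ∧ 0 ≤ sin A') ∨ (cos (A + β) ≤ 0 ∧ cos (A' + β) ≤ 0) := by
  rcases le_or_gt A' π with h | h
  · exact Or.inl ⟨sin_nonneg_of_nonneg_of_le_pi hA0 (by linarith),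
      sin_nonneg_of_nonneg_of_le_pi (by linarith) h⟩
  · exact Or.inr ⟨cos_nonpos_of_pi_div_two_le_of_le (by linarith) (by linarith),
      cos_nonpos_of_pi_div_two_le_of_le (by linarith) (by linarith)⟩

/-- The line along the far edge of the first sector works unless the second sector extends more than
π past it. In that case the line along the far edge of the second sector works. -/
theorem exists_sin_nonpos_and_nonneg {a₁ a₂ a₃ a₄ : ℝ} (h12 : a₁ ≤ a₂) (h23 : a₂ ≤ a₃)
    (h34 : a₃ ≤ a₄) (h41 : a₄ ≤ a₁ + 2 * π) (h1 : a₂ - a₁ ≤ π / 2) (h2 : a₄ - a₃ ≤ π / 2) :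
    ∃ τ, sin (a₁ - τ) ≤ 0 ∧ sin (a₂ - τ) ≤ 0 ∧ 0 ≤ sin (a₃ - τ) ∧ 0 ≤ sin (a₄ - τ) := by
  have hπ := pi_pos
  rcases le_or_gt a₄ (a₂ + π) with h | h
  · exact ⟨a₂, sin_nonpos_of_nonpos_of_neg_pi_le (by linarith) (by linarith), by simp,
      sin_nonneg_of_nonneg_of_le_pi (by linarith) (by linarith),
      sin_nonneg_of_nonneg_of_le_pi (by linarith) (by linarith)⟩
  · exact ⟨a₄ - π, sin_nonpos_of_nonpos_of_neg_pi_le (by linarith) (by linarith),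
      sin_nonpos_of_nonpos_of_neg_pi_le (by linarith) (by linarith),
      sin_nonneg_of_nonneg_of_le_pi (by linarith) (by linarith),
      sin_nonneg_of_nonneg_of_le_pi (by linarith) (by linarith)⟩

/-- If an index with A_k ≤ M fails the second bound, then A_k < A_n - M ≤ M - π/2, so the next index
still satisfies the first. Continuing to `n - 1` contradicts `hlast`. -/
theorem exists_split {A : ℕ → ℝ} {n : ℕ} {M : ℝ} (hn : 2 ≤ n)
    (hstep : ∀ j < n, A (j + 1) ≤ A j + π / 2) (h1 : A 1 ≤ M)
    (hlast : A n - A (n - 1) ≤ M) (hM : A n ≤ 2 * M - π / 2) :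
    ∃ k, 0 < k ∧ k < n ∧ A k ≤ M ∧ A n - A k ≤ M := by
  by_contra hne
  push Not at hne
  have : ∀ k, 0 < k → k < n → A k ≤ M := by
    intro k hk
    induction k, hk using Nat.le_induction with
    | base => exact fun _ => h1
    | succ k hk ih =>
      intro hkn
      have h2 := hne k hk (by omega) (ih (by omega))
      have h3 := hstep k (by omega)
      linarith
  exact absurd hlast (not_le.2 (hne (n - 1) (by omega) (by omega) (this _ (by omega) (by omega))))

end Wing

/-! ### Separation by a line -/

section Separation

theorem disjoint_interior_convexHull {s t : Set ℂ} {w : ℂ} (hw : w ≠ 0) {c : ℝ}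
    (hs : ∀ x ∈ s, (w * x).re ≤ c) (ht : ∀ x ∈ t, c ≤ (w * x).re) :
    Disjoint (interior (convexHull ℝ s)) (interior (convexHull ℝ t)) := by
  have hlin : IsLinearMap ℝ fun x : ℂ => (w * x).re :=
    ⟨fun x y => by rw [mul_add, Complex.add_re], fun a x => by
      rw [mul_smul_comm, Complex.smul_re]⟩
  have hs' : convexHull ℝ s ⊆ {x | (w * x).re ≤ c} :=
    convexHull_min hs (convex_halfSpace_le hlin c)
  have ht' : convexHull ℝ t ⊆ {x | c ≤ (w * x).re} :=
    convexHull_min ht (convex_halfSpace_ge hlin c)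
  rw [Set.disjoint_left]
  intro x hx hxt
  have h1 : c ≤ (w * x).re := ht' (interior_subset hxt)
  have hcont : ContinuousAt (fun ε : ℝ => x + ε * (starRingEnd ℂ) w) 0 := by fun_prop
  have ev := hcont.eventually_mem (isOpen_interior.mem_nhds (by simpa using hx))
  obtain ⟨ε, h2, hε⟩ := (ev.filter_mono nhdsWithin_le_nhds |>.and
      (self_mem_nhdsWithin (a := (0:ℝ)) (s := Set.Ioi 0))).exists
  have hε : 0 < ε := hε
  have h3 : (w * (x + ε * (starRingEnd ℂ) w)).re ≤ c := hs' (interior_subset h2)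
  have h4 : w * (x + ε * (starRingEnd ℂ) w) = w * x + ((ε * Complex.normSq w : ℝ) : ℂ) := by
    rw [mul_add, mul_left_comm, Complex.mul_conj]; push_cast; ring
  rw [h4, Complex.add_re, Complex.ofReal_re] at h3
  have := Complex.normSq_pos.2 hw
  have : 0 < ε * Complex.normSq w := by positivity
  linarith

end Separation

/-! ### Planar layouts and coordinates along the sides of the base -/

section Layout

open Complex

/-- Coordinate of `x` along the unit vector `e` from the origin `z`. -/
def dotAt (z e x : ℂ) : ℝ := ((x - z) * (starRingEnd ℂ) e).re

/-- Coordinate of `x` across the unit vector `e` from the origin `z`. -/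
def crossAt (z e x : ℂ) : ℝ := ((x - z) * (starRingEnd ℂ) e).im

theorem disjoint_interior_of_dotAt {s t : Set ℂ} {z e : ℂ} (he : ‖e‖ = 1) {c : ℝ}
    (hs : ∀ x ∈ s, dotAt z e x ≤ c) (ht : ∀ x ∈ t, c ≤ dotAt z e x) :
    Disjoint (interior (convexHull ℝ s)) (interior (convexHull ℝ t)) := by
  have he0 : e ≠ 0 := by rintro rfl; simp at he
  refine disjoint_interior_convexHull (w := (starRingEnd ℂ) e)
    ((map_ne_zero (starRingEnd ℂ)).2 he0) (c := c + (z * (starRingEnd ℂ) e).re) ?_ ?_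
  · intro x hx
    have := hs x hx
    rw [dotAt, sub_mul, sub_re] at this
    rw [mul_comm ((starRingEnd ℂ) e) x]; linarith
  · intro x hx
    have := ht x hx
    rw [dotAt, sub_mul, sub_re] at this
    rw [mul_comm ((starRingEnd ℂ) e) x]; linarith

theorem crossAt_eq_dotAt (z e x : ℂ) : crossAt z e x = dotAt z (e * I) x := by
  simp only [crossAt, dotAt, map_mul, conj_I, mul_neg, neg_re, ← mul_assoc, mul_I_re, neg_neg]

theorem disjoint_interior_of_crossAt {s t : Set ℂ} {z e : ℂ} (he : ‖e‖ = 1) {c : ℝ}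
    (hs : ∀ x ∈ s, crossAt z e x ≤ c) (ht : ∀ x ∈ t, c ≤ crossAt z e x) :
    Disjoint (interior (convexHull ℝ s)) (interior (convexHull ℝ t)) :=
  disjoint_interior_of_dotAt (z := z) (e := e * I) (c := c) (by simp [he])
    (fun x hx => by rw [← crossAt_eq_dotAt]; exact hs x hx)
    (fun x hx => by rw [← crossAt_eq_dotAt]; exact ht x hx)

theorem mul_conj_of_norm_eq_one {e : ℂ} (he : ‖e‖ = 1) : e * (starRingEnd ℂ) e = 1 := by
  rw [mul_conj, normSq_eq_norm_sq, he]; simp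

theorem polar_mul_conj {e : ℂ} (he : ‖e‖ = 1) (r φ ψ : ℝ) :
    r * (e * exp (φ * I)) * (starRingEnd ℂ) (e * exp (ψ * I)) = r * exp ((φ - ψ : ℝ) * I) := by
  have : (starRingEnd ℂ) (exp (ψ * I)) = exp (-(ψ * I)) := by
    rw [← exp_conj]; simp
  rw [map_mul, this]
  have h2 : exp ((φ - ψ : ℝ) * I) = exp (φ * I) * exp (-(ψ * I)) := by
    rw [← exp_add]; congr 1; push_cast; ring
  rw [h2]
  linear_combination (r * exp (φ * I) * exp (-(ψ * I))) * mul_conj_of_norm_eq_one he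

/-- Triangles of a group attached to one side of the base at a vertex, in polar coordinates
around that vertex: the `j`-th vertex has radius `r j` and direction `A j`, measured from the base
edge of length `c`; `β` is the angle of the base. -/
structure IsWing (r A : ℕ → ℝ) (k : ℕ) (c β : ℝ) : Prop where
  radius_pos : ∀ j ≤ k, 0 < r j
  radius_zero : r 0 = c
  angle_zero : A 0 = 0
  mono : ∀ j < k, A j ≤ A (j + 1)
  step : ∀ j < k, A (j + 1) ≤ A j + Real.pi / 2
  proj : ∀ j < k, r (j + 1) * Real.cos (A (j + 1) - A j) ≤ r j
  angle_le : A k ≤ 3 * Real.pi / 2 - β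
  beta_nonneg : 0 ≤ β

variable {r A : ℕ → ℝ} {k : ℕ} {c β : ℝ}

theorem IsWing.angle_mono (h : IsWing r A k c β) {i j : ℕ} (hij : i ≤ j) (hj : j ≤ k) :
    A i ≤ A j := by
  induction j, hij using Nat.le_induction with
  | base => exact le_rfl
  | succ j hij ih => exact (ih (by omega)).trans (h.mono j (by omega))

theorem IsWing.angle_nonneg (h : IsWing r A k c β) {j : ℕ} (hj : j ≤ k) : 0 ≤ A j := by
  have := h.angle_mono (Nat.zero_le j) hj
  rwa [h.angle_zero] at this

theorem IsWing.c_pos (h : IsWing r A k c β) : 0 < c :=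
  h.radius_zero ▸ h.radius_pos 0 (Nat.zero_le _)

theorem IsWing.mul_cos_le (h : IsWing r A k c β) {i j : ℕ} (hi : 0 ≤ r i * Real.cos (A i))
    (hij : i ≤ j) (hj : j ≤ k) : r j * Real.cos (A j) ≤ r i * Real.cos (A i) :=
  radius_mul_cos_le h.radius_pos h.mono h.angle_zero.ge
    (h.angle_le.trans (by linarith [h.beta_nonneg])) h.proj hi hij hj

theorem IsWing.mul_cos_le_base (h : IsWing r A k c β) {j : ℕ} (hj : j ≤ k) :
    r j * Real.cos (A j) ≤ c := by
  have e : r 0 * Real.cos (A 0) = c := by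
    rw [h.radius_zero, h.angle_zero, Real.cos_zero, mul_one]
  have := h.mul_cos_le (i := 0) (by rw [e]; exact h.c_pos.le) (Nat.zero_le j) hj
  rwa [e] at this

theorem IsWing.mul_cos_one_nonneg (h : IsWing r A k c β) (hk : 1 ≤ k) :
    0 ≤ r 1 * Real.cos (A 1) := by
  have h1 := h.step 0 hk
  have h2 := h.angle_nonneg hk
  simp only [h.angle_zero, zero_add] at h1
  exact mul_nonneg (h.radius_pos 1 hk).le
    (Real.cos_nonneg_of_mem_Icc ⟨by linarith [Real.pi_pos], h1⟩)

theorem IsWing.mul_sin_sub_nonneg (h : IsWing r A k c β) {β' : ℝ} (hβ' : 0 ≤ β')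
    (hβ'' : β' ≤ Real.pi / 2) (hββ' : Real.pi / 2 ≤ β + β') {j : ℕ} (hj : j ≤ k) :
    0 ≤ c * Real.sin β' + r j * Real.sin (A j - β') :=
  radius_mul_sin_sub_nonneg (h.radius_pos j hj) (h.angle_nonneg hj)
    ((h.angle_mono hj le_rfl).trans h.angle_le) hβ' hβ'' hββ' h.c_pos.le (h.mul_cos_le_base hj)

theorem IsWing.sin_nonneg_or (h : IsWing r A k c β) {j : ℕ} (hj : j < k) :
    (0 ≤ Real.sin (A j) ∧ 0 ≤ Real.sin (A (j + 1))) ∨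
      (Real.cos (A j + β) ≤ 0 ∧ Real.cos (A (j + 1) + β) ≤ 0) :=
  sin_nonneg_or_cos_add_nonpos (h.angle_nonneg hj.le) (h.mono j hj)
    ((h.angle_mono hj le_rfl).trans h.angle_le) (h.step j hj) h.beta_nonneg

/-- Planar data of a petal unfolding: the base triangle has vertices `z i`, counterclockwise, side
lengths `c i`, unit side vectors `e i` and angles `β i`; at `z i` the fan from the side `i` to the
side `i + 2` has radii `r i` and cumulative angles `A i`, and is cut at its `k i`-th edge. -/
structure IsPetalLayout (c β : Fin 3 → ℝ) (z e : Fin 3 → ℂ) (n k : Fin 3 → ℕ)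
    (r A : Fin 3 → ℕ → ℝ) : Prop where
  beta_pos : ∀ i, 0 < β i
  beta_le : ∀ i, β i ≤ Real.pi / 2
  beta_sum : β 0 + β 1 + β 2 = Real.pi
  norm_e : ∀ i, ‖e i‖ = 1
  z_succ : ∀ i, z (i + 1) = z i + c i * e i
  e_succ : ∀ i, e (i + 1) = -(e i * exp ((-β (i + 1) : ℝ) * I))
  radius_pos : ∀ i, ∀ j ≤ n i, 0 < r i j
  radius_zero : ∀ i, r i 0 = c i
  radius_last : ∀ i, r i (n i) = c (i + 2)
  angle_zero : ∀ i, A i 0 = 0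
  mono_lt : ∀ i, ∀ j < n i, A i j < A i (j + 1)
  step : ∀ i, ∀ j < n i, A i (j + 1) ≤ A i j + Real.pi / 2
  proj : ∀ i, ∀ j < n i, r i (j + 1) * Real.cos (A i (j + 1) - A i j) ≤ r i j
  proj' : ∀ i, ∀ j < n i, r i j * Real.cos (A i (j + 1) - A i j) ≤ r i (j + 1)
  total : ∀ i, A i (n i) + β i ≤ 2 * Real.pi
  k_pos : ∀ i, 0 < k i
  k_lt : ∀ i, k i < n i
  left_le : ∀ i, A i (k i) ≤ 3 * Real.pi / 2 - β i
  right_le : ∀ i, A i (n i) - A i (k i) ≤ 3 * Real.pi / 2 - β i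
  apex_cos : ∀ i, r i 1 * Real.cos (A i 1) + r (i + 1) (n (i + 1) - 1) *
    Real.cos (A (i + 1) (n (i + 1)) - A (i + 1) (n (i + 1) - 1)) = c i
  apex_sin : ∀ i, r i 1 * Real.sin (A i 1) = r (i + 1) (n (i + 1) - 1) *
    Real.sin (A (i + 1) (n (i + 1)) - A (i + 1) (n (i + 1) - 1))

/-- Direction angle of the `j`-th fan vertex at `z i` in the `l`-th triangle. -/
def fanAngle (β : Fin 3 → ℝ) (n k : Fin 3 → ℕ) (A : Fin 3 → ℕ → ℝ) (i : Fin 3) (l j : ℕ) : ℝ :=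
  if l < k i then -A i j else β i + (A i (n i) - A i j)

/-- Position of the `j`-th fan vertex at `z i` in the `l`-th triangle. -/
noncomputable def fanPoint (β : Fin 3 → ℝ) (z e : Fin 3 → ℂ) (n k : Fin 3 → ℕ)
    (r A : Fin 3 → ℕ → ℝ) (i : Fin 3) (l j : ℕ) : ℂ :=
  z i + r i j * (e i * exp (fanAngle β n k A i l j * I))

/-- The vertices of the `l`-th unfolded fan triangle at `z i`. -/
noncomputable def fanTriangle (β : Fin 3 → ℝ) (z e : Fin 3 → ℂ) (n k : Fin 3 → ℕ)
    (r A : Fin 3 → ℕ → ℝ) (i : Fin 3) (l : ℕ) : Set ℂ :=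
  {z i, fanPoint β z e n k r A i l l, fanPoint β z e n k r A i l (l + 1)}

namespace IsPetalLayout

variable {c β : Fin 3 → ℝ} {z e : Fin 3 → ℂ} {n k : Fin 3 → ℕ} {r A : Fin 3 → ℕ → ℝ}

theorem add_one_add_two (i : Fin 3) : i + 1 + 2 = i := by fin_cases i <;> rfl
theorem add_two_add_one (i : Fin 3) : i + 2 + 1 = i := by fin_cases i <;> rfl
theorem add_one_add_one (i : Fin 3) : i + 1 + 1 = i + 2 := by fin_cases i <;> rfl

theorem mono (h : IsPetalLayout c β z e n k r A) (i : Fin 3) (j : ℕ) (hj : j < n i) :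
    A i j ≤ A i (j + 1) :=
  (h.mono_lt i j hj).le

theorem beta_nonneg (h : IsPetalLayout c β z e n k r A) (i : Fin 3) : 0 ≤ β i :=
  (h.beta_pos i).le

theorem beta_sum' (h : IsPetalLayout c β z e n k r A) (i : Fin 3) :
    β i + β (i + 1) + β (i + 2) = Real.pi := by
  have := h.beta_sum
  fin_cases i
  · exact this
  · change β 1 + β 2 + β 0 = _; linarith
  · change β 2 + β 0 + β 1 = _; linarith

theorem leftWing (h : IsPetalLayout c β z e n k r A) (i : Fin 3) :
    IsWing (r i) (A i) (k i) (c i) (β i) :=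
  have hk := h.k_lt i
  ⟨fun j hj => h.radius_pos i j (by omega), h.radius_zero i, h.angle_zero i,
    fun j hj => h.mono i j (by omega), fun j hj => h.step i j (by omega),
    fun j hj => h.proj i j (by omega), h.left_le i, h.beta_nonneg i⟩

/-- Reading the fan backwards from side i + 2 turns the second group into a wing, so every wing
estimate also serves its mirror image; `proj'` takes the role of `proj`. -/
theorem rightWing (h : IsPetalLayout c β z e n k r A) (i : Fin 3) :
    IsWing (fun j => r i (n i - j)) (fun j => A i (n i) - A i (n i - j)) (n i - k i) (c (i + 2))
      (β i) := by
  have hk := h.k_lt i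
  have hs : ∀ j, j < n i → n i - (j + 1) + 1 = n i - j := fun j hj => by omega
  refine ⟨fun j hj => h.radius_pos i _ (by omega), h.radius_last i, by simp, fun j hj => ?_,
    fun j hj => ?_, fun j hj => ?_, ?_, h.beta_nonneg i⟩
  · have := h.mono i (n i - (j + 1)) (by omega)
    rw [hs j (by omega)] at this
    linarith
  · have := h.step i (n i - (j + 1)) (by omega)
    rw [hs j (by omega)] at this
    linarith
  · have := h.proj' i (n i - (j + 1)) (by omega)
    rw [hs j (by omega)] at this
    convert this using 3
    ring
  · have : n i - (n i - k i) = k i := by omega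
    rw [this]; exact h.right_le i

theorem angle_mono (h : IsPetalLayout c β z e n k r A) (i : Fin 3) {j j' : ℕ} (hj : j ≤ j')
    (hj' : j' ≤ n i) : A i j ≤ A i j' := by
  induction j', hj using Nat.le_induction with
  | base => exact le_rfl
  | succ j hij ih => exact (ih (by omega)).trans (h.mono i j (by omega))

theorem e_add_two (h : IsPetalLayout c β z e n k r A) (i : Fin 3) :
    e (i + 2) = -(e i * exp (β i * I)) := by
  have h1 := h.e_succ (i + 2)
  rw [add_two_add_one] at h1
  rw [h1, neg_mul, neg_neg, mul_assoc, ← exp_add]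
  simp

theorem z_eq (h : IsPetalLayout c β z e n k r A) (i : Fin 3) :
    z i = z (i + 2) + c (i + 2) * e (i + 2) := by
  have := h.z_succ (i + 2)
  rwa [add_two_add_one] at this

theorem dotAt_self (h : IsPetalLayout c β z e n k r A) (i : Fin 3) (ρ φ : ℝ) :
    dotAt (z i) (e i) (z i + ρ * (e i * exp (φ * I))) = ρ * Real.cos φ := by
  have := polar_mul_conj (h.norm_e i) ρ φ 0
  simp only [ofReal_zero, zero_mul, exp_zero, mul_one, sub_zero] at this
  rw [dotAt, add_sub_cancel_left, this, re_ofReal_mul, exp_ofReal_mul_I_re]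

theorem crossAt_self (h : IsPetalLayout c β z e n k r A) (i : Fin 3) (ρ φ : ℝ) :
    crossAt (z i) (e i) (z i + ρ * (e i * exp (φ * I))) = ρ * Real.sin φ := by
  have := polar_mul_conj (h.norm_e i) ρ φ 0
  simp only [ofReal_zero, zero_mul, exp_zero, mul_one, sub_zero] at this
  rw [crossAt, add_sub_cancel_left, this, im_ofReal_mul, exp_ofReal_mul_I_im]

theorem sub_mul_conj_add_two (h : IsPetalLayout c β z e n k r A) (i : Fin 3) (ρ φ : ℝ) :
    (z i + ρ * (e i * exp (φ * I)) - z (i + 2)) * (starRingEnd ℂ) (e (i + 2)) =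
      c (i + 2) - ρ * exp ((φ - β i : ℝ) * I) := by
  have h1 := polar_mul_conj (h.norm_e i) ρ φ (β i)
  have h2 := mul_conj_of_norm_eq_one (h.norm_e (i + 2))
  have h3 : (starRingEnd ℂ) (e (i + 2)) = -(starRingEnd ℂ) (e i * exp (β i * I)) := by
    rw [h.e_add_two, map_neg]
  rw [← h1, h.z_eq i]
  linear_combination (c (i + 2)) * h2 + ρ * (e i * exp (φ * I)) * h3

theorem dotAt_add_two (h : IsPetalLayout c β z e n k r A) (i : Fin 3) (ρ φ : ℝ) :
    dotAt (z (i + 2)) (e (i + 2)) (z i + ρ * (e i * exp (φ * I))) =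
      c (i + 2) - ρ * Real.cos (φ - β i) := by
  rw [dotAt, h.sub_mul_conj_add_two, sub_re, re_ofReal_mul, exp_ofReal_mul_I_re, ofReal_re]

theorem crossAt_add_two (h : IsPetalLayout c β z e n k r A) (i : Fin 3) (ρ φ : ℝ) :
    crossAt (z (i + 2)) (e (i + 2)) (z i + ρ * (e i * exp (φ * I))) =
      -(ρ * Real.sin (φ - β i)) := by
  rw [crossAt, h.sub_mul_conj_add_two, sub_im, im_ofReal_mul, exp_ofReal_mul_I_im, ofReal_im,
    zero_sub]

theorem crossAt_add_one (h : IsPetalLayout c β z e n k r A) (i : Fin 3) (ρ φ : ℝ) :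
    crossAt (z (i + 1)) (e (i + 1)) (z i + ρ * (e i * exp (φ * I))) =
      c i * Real.sin (β (i + 1)) - ρ * Real.sin (φ + β (i + 1)) := by
  have h1 := polar_mul_conj (h.norm_e i) ρ φ (-β (i + 1))
  have h2 := polar_mul_conj (h.norm_e i) (c i) 0 (-β (i + 1))
  have h3 : (starRingEnd ℂ) (e (i + 1)) =
      -(starRingEnd ℂ) (e i * exp ((-β (i + 1) : ℝ) * I)) := by
    rw [h.e_succ, map_neg]
  have : (z i + ρ * (e i * exp (φ * I)) - z (i + 1)) * (starRingEnd ℂ) (e (i + 1)) =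
      c i * exp ((β (i + 1) : ℝ) * I) - ρ * exp ((φ + β (i + 1) : ℝ) * I) := by
    rw [sub_neg_eq_add] at h1 h2
    rw [zero_add] at h2
    rw [← h1, ← h2, h3, h.z_succ i]
    simp
    ring
  rw [crossAt, this, sub_im, im_ofReal_mul, exp_ofReal_mul_I_im, im_ofReal_mul,
    exp_ofReal_mul_I_im]

/-- Both sides are the height of `z i` above side i + 1, computed from the two ends of that side. -/
theorem law_sin (h : IsPetalLayout c β z e n k r A) (i : Fin 3) :
    c i * Real.sin (β (i + 1)) = c (i + 2) * Real.sin (β (i + 2)) := by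
  have h1 := h.crossAt_add_one i 0 0
  have h2 := h.crossAt_add_two (i + 2) (c (i + 2)) 0
  have e1 : i + 2 + 2 = i + 1 := by fin_cases i <;> rfl
  rw [e1] at h2
  have h3 : z i + (0 : ℝ) * (e i * exp ((0 : ℝ) * I)) =
      z (i + 2) + c (i + 2) * (e (i + 2) * exp ((0 : ℝ) * I)) := by
    rw [h.z_eq i]; simp
  rw [h3, h2] at h1
  simp at h1
  linarith

end IsPetalLayout

end Layout

/-! ### Disjointness of the triangles of a layout -/

section Layout

open Complex

namespace IsPetalLayout

variable {c β : Fin 3 → ℝ} {z e : Fin 3 → ℂ} {n k : Fin 3 → ℕ} {r A : Fin 3 → ℕ → ℝ}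

/-- The centre is written as a polar point of radius 0, so that the same coordinate formulas apply
to all three vertices. -/
theorem forall_mem_fanTriangle {i : Fin 3} {l : ℕ} {p : ℂ → Prop}
    (h0 : p (z i + (0 : ℝ) * (e i * exp ((0 : ℝ) * I))))
    (h1 : p (fanPoint β z e n k r A i l l)) (h2 : p (fanPoint β z e n k r A i l (l + 1))) :
    ∀ x ∈ fanTriangle β z e n k r A i l, p x := by
  rintro x (rfl | rfl | rfl)
  · simpa using h0
  · exact h1
  · exact h2

theorem fanPoint_left {i : Fin 3} {l : ℕ} (hl : l < k i) (j : ℕ) :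
    fanPoint β z e n k r A i l j = z i + r i j * (e i * exp ((-A i j : ℝ) * I)) := by
  rw [fanPoint, fanAngle, if_pos hl]

theorem fanPoint_right {i : Fin 3} {l : ℕ} (hl : k i ≤ l) (j : ℕ) :
    fanPoint β z e n k r A i l j =
      z i + r i j * (e i * exp ((β i + (A i (n i) - A i j) : ℝ) * I)) := by
  rw [fanPoint, fanAngle, if_neg (not_lt.2 hl)]

theorem c_pos (h : IsPetalLayout c β z e n k r A) (i : Fin 3) : 0 < c i :=
  (h.leftWing i).c_pos

theorem sin_beta_nonneg (h : IsPetalLayout c β z e n k r A) (i : Fin 3) :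
    0 ≤ Real.sin (β i) :=
  Real.sin_nonneg_of_nonneg_of_le_pi (h.beta_nonneg i)
    ((h.beta_le i).trans (by linarith [Real.pi_pos]))

theorem left_opposite (h : IsPetalLayout c β z e n k r A) {i : Fin 3} {l j : ℕ} (hl : l < k i)
    (hj : j ≤ k i) :
    0 ≤ crossAt (z (i + 1)) (e (i + 1)) (fanPoint β z e n k r A i l j) := by
  rw [fanPoint_left hl, h.crossAt_add_one]
  have h1 := (h.leftWing i).mul_sin_sub_nonneg (h.beta_nonneg (i + 1)) (h.beta_le (i + 1))
    (by linarith [h.beta_sum' i, h.beta_le (i + 2)]) hj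
  have h2 : Real.sin (-A i j + β (i + 1)) = -Real.sin (A i j - β (i + 1)) := by
    rw [← Real.sin_neg]; congr 1; ring
  rw [h2]; linarith

theorem right_opposite (h : IsPetalLayout c β z e n k r A) {i : Fin 3} {l j : ℕ} (hl : k i ≤ l)
    (hj : k i ≤ j) (hj' : j ≤ n i) :
    0 ≤ crossAt (z (i + 1)) (e (i + 1)) (fanPoint β z e n k r A i l j) := by
  rw [fanPoint_right hl, h.crossAt_add_one, h.law_sin]
  have h1 := (h.rightWing i).mul_sin_sub_nonneg (h.beta_nonneg (i + 2)) (h.beta_le (i + 2))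
    (by linarith [h.beta_sum' i, h.beta_le (i + 1)]) (j := n i - j) (by omega)
  simp only [show n i - (n i - j) = j by omega] at h1
  have h2 : Real.sin (β i + (A i (n i) - A i j) + β (i + 1)) =
      -Real.sin (A i (n i) - A i j - β (i + 2)) := by
    rw [← Real.sin_add_pi]; congr 1; linarith [h.beta_sum' i]
  rw [h2]; linarith

theorem opposite_nonneg (h : IsPetalLayout c β z e n k r A) {i : Fin 3} {l : ℕ} (hl : l < n i) :
    ∀ x ∈ fanTriangle β z e n k r A i l, 0 ≤ crossAt (z (i + 1)) (e (i + 1)) x := by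
  refine forall_mem_fanTriangle ?_ ?_ ?_
  · rw [h.crossAt_add_one]
    have := mul_nonneg (h.c_pos i).le (h.sin_beta_nonneg (i + 1))
    linarith
  all_goals
    rcases Nat.lt_or_ge l (k i) with hk | hk
    · exact h.left_opposite hk (by omega)
    · exact h.right_opposite hk (by omega) (by omega)

/-- A triangle reaching past angle π has both directions beyond π/2, since a step is at most π/2.
The cap 3π/2 - β then puts it behind the perpendicular at `z i` to the other side. -/
theorem left_sides (h : IsPetalLayout c β z e n k r A) {i : Fin 3} {l : ℕ} (hl : l < k i) :
    (∀ x ∈ fanTriangle β z e n k r A i l, crossAt (z i) (e i) x ≤ 0) ∨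
      ∀ x ∈ fanTriangle β z e n k r A i l, c (i + 2) ≤ dotAt (z (i + 2)) (e (i + 2)) x := by
  have hk := h.k_lt i
  have r0 := h.radius_pos i l (by omega)
  have r1 := h.radius_pos i (l + 1) (by omega)
  rcases (h.leftWing i).sin_nonneg_or hl with ⟨h1, h2⟩ | ⟨h1, h2⟩
  · left
    refine forall_mem_fanTriangle (by rw [h.crossAt_self]; simp) ?_ ?_
    all_goals
      rw [fanPoint_left hl, h.crossAt_self, Real.sin_neg, mul_neg]
      exact neg_nonpos.2 (by positivity)
  · right
    have e0 : ∀ j, Real.cos (-A i j - β i) = Real.cos (A i j + β i) := fun j => by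
      rw [← Real.cos_neg]; congr 1; ring
    refine forall_mem_fanTriangle (by rw [h.dotAt_add_two]; simp) ?_ ?_
    all_goals
      rw [fanPoint_left hl, h.dotAt_add_two, e0]
      nlinarith

theorem right_sides (h : IsPetalLayout c β z e n k r A) {i : Fin 3} {l : ℕ} (hl : k i ≤ l)
    (hl' : l < n i) :
    (∀ x ∈ fanTriangle β z e n k r A i l, crossAt (z (i + 2)) (e (i + 2)) x ≤ 0) ∨
      ∀ x ∈ fanTriangle β z e n k r A i l, dotAt (z i) (e i) x ≤ 0 := by
  have r0 := h.radius_pos i l (by omega)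
  have r1 := h.radius_pos i (l + 1) (by omega)
  have hw := (h.rightWing i).sin_nonneg_or (j := n i - (l + 1)) (by omega)
  simp only [show n i - (n i - (l + 1)) = l + 1 by omega,
    show n i - (n i - (l + 1) + 1) = l by omega] at hw
  rcases hw with ⟨h1, h2⟩ | ⟨h1, h2⟩
  · left
    refine forall_mem_fanTriangle (by rw [h.crossAt_add_two]; simp) ?_ ?_
    all_goals
      rw [fanPoint_right hl, h.crossAt_add_two, add_sub_cancel_left]
      exact neg_nonpos.2 (by positivity)
  · right
    refine forall_mem_fanTriangle (by rw [h.dotAt_self]; simp) ?_ ?_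
    all_goals
      rw [fanPoint_right hl, h.dotAt_self, add_comm (β i)]
      nlinarith

/-- The bound is the foot of the altitude from the apex of the edge neighbour, which is the triangle
`l = 0`. By `apex_cos`, the group at the other end of the side is bounded by the same foot. -/
theorem left_altitude (h : IsPetalLayout c β z e n k r A) {i : Fin 3} {l : ℕ} (hl : l < k i)
    (hl0 : 0 < l) :
    ∀ x ∈ fanTriangle β z e n k r A i l, dotAt (z i) (e i) x ≤ r i 1 * Real.cos (A i 1) := by
  have hw := h.leftWing i
  have h0 := hw.mul_cos_one_nonneg (by omega)
  refine forall_mem_fanTriangle (by rw [h.dotAt_self]; simpa using h0) ?_ ?_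
  all_goals
    rw [fanPoint_left hl, h.dotAt_self, Real.cos_neg]
    exact hw.mul_cos_le h0 (by omega) (by omega)

theorem right_altitude (h : IsPetalLayout c β z e n k r A) {i : Fin 3} {l : ℕ} (hl : k i ≤ l)
    (hl' : l + 1 < n i) :
    ∀ x ∈ fanTriangle β z e n k r A i l,
      c (i + 2) - r i (n i - 1) * Real.cos (A i (n i) - A i (n i - 1)) ≤
        dotAt (z (i + 2)) (e (i + 2)) x := by
  have hw := h.rightWing i
  have h0 := hw.mul_cos_one_nonneg (by omega)
  have key : ∀ j, k i ≤ j → j < n i → r i j * Real.cos (A i (n i) - A i j) ≤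
      r i (n i - 1) * Real.cos (A i (n i) - A i (n i - 1)) := by
    intro j h1 h2
    have := hw.mul_cos_le (j := n i - j) h0 (by omega) (by omega)
    simpa only [show n i - (n i - j) = j by omega] using this
  refine forall_mem_fanTriangle (by rw [h.dotAt_add_two]; simpa using h0) ?_ ?_
  all_goals
    rw [fanPoint_right hl, h.dotAt_add_two, add_sub_cancel_left]
    linarith [key l (by omega) (by omega), key (l + 1) (by omega) (by omega)]

theorem apex_bounds (h : IsPetalLayout c β z e n k r A) (i : Fin 3) :
    0 ≤ r i 1 * Real.cos (A i 1) ∧ r i 1 * Real.cos (A i 1) ≤ c i := by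
  have h1 := h.k_pos i
  have h2 := h.k_pos (i + 1)
  have h3 := h.k_lt (i + 1)
  refine ⟨(h.leftWing i).mul_cos_one_nonneg (by omega), ?_⟩
  have h4 := (h.rightWing (i + 1)).mul_cos_one_nonneg (by omega)
  have := h.apex_cos i
  linarith

/-- Fan triangles at different vertices of the base do not overlap. -/
theorem disjoint_of_ne_vertex (h : IsPetalLayout c β z e n k r A) {i : Fin 3} {l l' : ℕ}
    (hl0 : 0 < l) (hl : l < n i) (hl' : l' + 1 < n (i + 1)) :
    Disjoint (interior (convexHull ℝ (fanTriangle β z e n k r A i l)))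
      (interior (convexHull ℝ (fanTriangle β z e n k r A (i + 1) l'))) := by
  obtain ⟨hm0, hmc⟩ := h.apex_bounds i
  have hap := h.apex_cos i
  have hopp := h.opposite_nonneg hl
  have hopp' := h.opposite_nonneg (show l' < n (i + 1) by omega)
  rw [add_one_add_one] at hopp'
  -- If `l'` is attached to side i + 1, it is either outside that side, which triangles at `z i` do
  -- not cross, or past the end of side i. If it is attached to side i, it stays beyond the altitude
  -- foot. A triangle at `z i` stays before that foot, or behind `z i`, or outside side i + 2, which
  -- triangles at `z (i + 1)` do not cross.
  rcases Nat.lt_or_ge l' (k (i + 1)) with hk' | hk'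
  · have hs := h.left_sides hk'
    rw [add_one_add_two] at hs
    rcases hs with hs | hs
    · exact (disjoint_interior_of_crossAt (h.norm_e _) hs hopp).symm
    · rcases Nat.lt_or_ge l (k i) with hk | hk
      · exact disjoint_interior_of_dotAt (h.norm_e i) (h.left_altitude hk hl0)
          fun x hx => hmc.trans (hs x hx)
      · rcases h.right_sides hk hl with ht | ht
        · exact disjoint_interior_of_crossAt (h.norm_e _) ht hopp'
        · exact disjoint_interior_of_dotAt (h.norm_e i) ht
            fun x hx => (h.c_pos i).le.trans (hs x hx)
  · have hs := h.right_altitude hk' hl'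
    rw [add_one_add_two] at hs
    rcases Nat.lt_or_ge l (k i) with hk | hk
    · exact disjoint_interior_of_dotAt (h.norm_e i) (h.left_altitude hk hl0)
        fun x hx => by linarith [hs x hx]
    · rcases h.right_sides hk hl with ht | ht
      · exact disjoint_interior_of_crossAt (h.norm_e _) ht hopp'
      · exact disjoint_interior_of_dotAt (h.norm_e i) ht fun x hx => by linarith [hs x hx]

theorem disjoint_of_sectors (h : IsPetalLayout c β z e n k r A) (i : Fin 3)
    {ρ₁ ρ₂ ρ₃ ρ₄ a₁ a₂ a₃ a₄ : ℝ} (hρ₁ : 0 ≤ ρ₁) (hρ₂ : 0 ≤ ρ₂) (hρ₃ : 0 ≤ ρ₃) (hρ₄ : 0 ≤ ρ₄)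
    (h12 : a₁ ≤ a₂) (h23 : a₂ ≤ a₃) (h34 : a₃ ≤ a₄) (h41 : a₄ ≤ a₁ + 2 * Real.pi)
    (h1 : a₂ - a₁ ≤ Real.pi / 2) (h2 : a₄ - a₃ ≤ Real.pi / 2) :
    Disjoint
      (interior (convexHull ℝ {z i, z i + ρ₂ * (e i * exp (a₂ * I)),
        z i + ρ₁ * (e i * exp (a₁ * I))}))
      (interior (convexHull ℝ {z i, z i + ρ₄ * (e i * exp (a₄ * I)),
        z i + ρ₃ * (e i * exp (a₃ * I))})) := by
  obtain ⟨τ, s1, s2, s3, s4⟩ := exists_sin_nonpos_and_nonneg h12 h23 h34 h41 h1 h2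
  have key : ∀ ρ φ : ℝ, crossAt (z i) (e i * exp (τ * I)) (z i + ρ * (e i * exp (φ * I))) =
      ρ * Real.sin (φ - τ) := by
    intro ρ φ
    rw [crossAt, add_sub_cancel_left, polar_mul_conj (h.norm_e i), im_ofReal_mul,
      exp_ofReal_mul_I_im]
  have key0 : crossAt (z i) (e i * exp (τ * I)) (z i) = 0 := by simp [crossAt]
  refine disjoint_interior_of_crossAt (z := z i) (e := e i * exp (τ * I)) (c := 0)
    (by rw [norm_mul, h.norm_e, norm_exp_ofReal_mul_I, one_mul]) ?_ ?_
  · rintro x (rfl | rfl | rfl)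
    · exact key0.le
    · rw [key]; exact mul_nonpos_of_nonneg_of_nonpos hρ₂ s2
    · rw [key]; exact mul_nonpos_of_nonneg_of_nonpos hρ₁ s1
  · rintro x (rfl | rfl | rfl)
    · exact key0.ge
    · rw [key]; exact mul_nonneg hρ₄ s4
    · rw [key]; exact mul_nonneg hρ₃ s3

theorem fanTriangle_eq_left {i : Fin 3} {l : ℕ} (hl : l < k i) :
    fanTriangle β z e n k r A i l = {z i, z i + r i l * (e i * exp ((-A i l : ℝ) * I)),
      z i + r i (l + 1) * (e i * exp ((-A i (l + 1) : ℝ) * I))} := by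
  rw [fanTriangle, fanPoint_left hl, fanPoint_left hl]

theorem fanTriangle_eq_right {i : Fin 3} {l : ℕ} (hl : k i ≤ l) :
    fanTriangle β z e n k r A i l =
      {z i, z i + r i l * (e i * exp ((β i + (A i (n i) - A i l) : ℝ) * I)),
      z i + r i (l + 1) * (e i * exp ((β i + (A i (n i) - A i (l + 1)) : ℝ) * I))} := by
  rw [fanTriangle, fanPoint_right hl, fanPoint_right hl]

/-- Distinct fan triangles at the same vertex of the base do not overlap. -/
theorem disjoint_of_same_vertex (h : IsPetalLayout c β z e n k r A) {i : Fin 3} {l l' : ℕ}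
    (hll : l < l') (hl' : l' < n i) :
    Disjoint (interior (convexHull ℝ (fanTriangle β z e n k r A i l)))
      (interior (convexHull ℝ (fanTriangle β z e n k r A i l'))) := by
  have r1 := (h.radius_pos i l (by omega)).le
  have r2 := (h.radius_pos i (l + 1) (by omega)).le
  have r3 := (h.radius_pos i l' (by omega)).le
  have r4 := (h.radius_pos i (l' + 1) (by omega)).le
  have m1 := h.mono i l (by omega)
  have m2 := h.mono i l' (by omega)
  have s1 := h.step i l (by omega)
  have s2 := h.step i l' (by omega)
  have m3 := h.angle_mono i (show l + 1 ≤ l' by omega) (by omega)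
  have m4 := h.angle_mono i (Nat.zero_le l) (by omega)
  have m5 := h.angle_mono i (show l' + 1 ≤ n i by omega) le_rfl
  rw [h.angle_zero] at m4
  have ht := h.total i
  have hβ := h.beta_nonneg i
  rcases Nat.lt_or_ge l' (k i) with hk' | hk'
  · rw [fanTriangle_eq_left (show l < k i by omega), fanTriangle_eq_left hk']
    exact (h.disjoint_of_sectors i r4 r3 r2 r1 (by linarith) (by linarith) (by linarith)
      (by linarith) (by linarith) (by linarith)).symm
  · rw [fanTriangle_eq_right hk']
    rcases Nat.lt_or_ge l (k i) with hk | hk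
    · rw [fanTriangle_eq_left hk]
      exact h.disjoint_of_sectors i r2 r1 r4 r3 (by linarith) (by linarith) (by linarith)
        (by linarith) (by linarith) (by linarith)
    · rw [fanTriangle_eq_right hk]
      exact (h.disjoint_of_sectors i r4 r3 r2 r1 (by linarith) (by linarith) (by linarith)
        (by linarith) (by linarith) (by linarith)).symm

theorem z_add_one_eq (h : IsPetalLayout c β z e n k r A) (i : Fin 3) :
    z (i + 1) = z i + c i * (e i * exp ((0 : ℝ) * I)) := by
  rw [h.z_succ]; simp

theorem z_add_two_eq (h : IsPetalLayout c β z e n k r A) (i : Fin 3) :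
    z (i + 2) = z i + c (i + 2) * (e i * exp (β i * I)) := by
  have h1 := h.z_eq i
  have h2 := h.e_add_two i
  linear_combination (-1 : ℂ) * h1 + (-c (i + 2) : ℂ) * h2

/-- Fan triangles do not overlap the base. -/
theorem disjoint_base (h : IsPetalLayout c β z e n k r A) {i : Fin 3} {l : ℕ} (hl : l < n i) :
    Disjoint (interior (convexHull ℝ {z i, z (i + 1), z (i + 2)}))
      (interior (convexHull ℝ (fanTriangle β z e n k r A i l))) := by
  have r1 := (h.radius_pos i l (by omega)).le
  have r2 := (h.radius_pos i (l + 1) (by omega)).le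
  have r3 := (h.c_pos i).le
  have r4 := (h.c_pos (i + 2)).le
  have m1 := h.mono i l (by omega)
  have s1 := h.step i l (by omega)
  have m4 := h.angle_mono i (Nat.zero_le l) (by omega)
  have m5 := h.angle_mono i (show l + 1 ≤ n i by omega) le_rfl
  rw [h.angle_zero] at m4
  have ht := h.total i
  have hβ := h.beta_nonneg i
  have hβ' := h.beta_le i
  rw [Set.pair_comm (z (i + 1)), h.z_add_one_eq, h.z_add_two_eq]
  rcases Nat.lt_or_ge l (k i) with hk | hk
  · rw [fanTriangle_eq_left hk]
    exact (h.disjoint_of_sectors i r2 r1 r3 r4 (by linarith) (by linarith) (by linarith)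
        (by linarith) (by linarith) (by linarith)).symm
  · rw [fanTriangle_eq_right hk]
    exact h.disjoint_of_sectors i r3 r4 r2 r1 (by linarith) (by linarith) (by linarith)
        (by linarith) (by linarith) (by linarith)

theorem fanPoint_first (h : IsPetalLayout c β z e n k r A) (i : Fin 3) :
    fanPoint β z e n k r A i 0 0 = z (i + 1) := by
  rw [fanPoint_left (h.k_pos i), h.angle_zero, h.radius_zero, neg_zero, ← h.z_add_one_eq]

theorem fanPoint_last (h : IsPetalLayout c β z e n k r A) (i : Fin 3) :
    fanPoint β z e n k r A i (n i - 1) (n i) = z (i + 2) := by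
  have := h.k_lt i
  rw [fanPoint_right (by omega), h.radius_last, sub_self, add_zero, ← h.z_add_two_eq]

/-- The neighbour across side i is first in one fan and last in the next. This is the agreement of
its two descriptions; `apex_cos` and `apex_sin` are its real and imaginary parts. -/
theorem fanPoint_apex (h : IsPetalLayout c β z e n k r A) (i : Fin 3) :
    fanPoint β z e n k r A i 0 1 =
      fanPoint β z e n k r A (i + 1) (n (i + 1) - 1) (n (i + 1) - 1) := by
  have hk := h.k_lt (i + 1)
  rw [fanPoint_left (h.k_pos i), fanPoint_right (by omega)]
  have h1 := h.apex_cos i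
  have h2 := h.apex_sin i
  have h3 := h.e_succ i
  set ρ := r (i + 1) (n (i + 1) - 1)
  set a := A (i + 1) (n (i + 1)) - A (i + 1) (n (i + 1) - 1)
  have h4 : (r i 1 : ℂ) * exp ((-A i 1 : ℝ) * I) = c i - ρ * exp (a * I) := by
    apply Complex.ext
    · rw [re_ofReal_mul, exp_ofReal_mul_I_re, sub_re, re_ofReal_mul, exp_ofReal_mul_I_re,
        Real.cos_neg, ofReal_re]
      linarith
    · rw [im_ofReal_mul, exp_ofReal_mul_I_im, sub_im, im_ofReal_mul, exp_ofReal_mul_I_im,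
        Real.sin_neg, ofReal_im]
      linarith
  have h5 : e (i + 1) * exp ((β (i + 1) + a : ℝ) * I) = -(e i * exp (a * I)) := by
    rw [h3, neg_mul, mul_assoc, ← exp_add]
    congr 3; push_cast; ring
  rw [h5, h.z_succ i]
  linear_combination (e i) * h4

theorem dist_fanPoint_self (h : IsPetalLayout c β z e n k r A) {i : Fin 3} {l j : ℕ}
    (hj : j ≤ n i) : dist (z i) (fanPoint β z e n k r A i l j) = r i j := by
  rw [fanPoint, dist_self_add_right, norm_mul, norm_mul, norm_exp_ofReal_mul_I, h.norm_e,
    norm_real, Real.norm_of_nonneg (h.radius_pos i j hj).le, one_mul, mul_one]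

theorem dist_fanPoint_sq (h : IsPetalLayout c β z e n k r A) (i : Fin 3) (l : ℕ) :
    dist (fanPoint β z e n k r A i l l) (fanPoint β z e n k r A i l (l + 1)) ^ 2 =
      r i l ^ 2 + r i (l + 1) ^ 2 -
        2 * (r i l * r i (l + 1) * Real.cos (A i (l + 1) - A i l)) := by
  have e1 : fanAngle β n k A i l l - fanAngle β n k A i l (l + 1) = A i (l + 1) - A i l := by
    unfold fanAngle; split_ifs <;> ring
  rw [← e1]
  set φ := fanAngle β n k A i l l
  set ψ := fanAngle β n k A i l (l + 1)
  rw [dist_eq_norm, fanPoint, fanPoint, add_sub_add_left_eq_sub, mul_left_comm,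
    mul_left_comm (r i (l + 1) : ℂ), ← mul_sub, norm_mul, h.norm_e, one_mul, ← normSq_eq_norm_sq,
    normSq_apply, sub_re, sub_im, re_ofReal_mul, re_ofReal_mul, im_ofReal_mul, im_ofReal_mul]
  simp only [exp_ofReal_mul_I_re, exp_ofReal_mul_I_im, Real.cos_sub]
  linear_combination (r i l) ^ 2 * Real.cos_sq_add_sin_sq φ +
    (r i (l + 1)) ^ 2 * Real.cos_sq_add_sin_sq ψ

end IsPetalLayout

end Layout

open Geometry

/-! ### The base triangle and its three fans in space -/

section Petal

open EuclideanGeometry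

theorem law_cos_projection {V : Type*} [NormedAddCommGroup V] [InnerProductSpace ℝ V] {a b : V}
    (c : V) (hab : a ≠ b) :
    dist a c * Real.cos (∠ b a c) + dist b c * Real.cos (∠ a b c) = dist a b := by
  have h1 := dist_sq_eq_dist_sq_add_dist_sq_sub_two_mul_dist_mul_dist_mul_cos_angle b a c
  have h2 := dist_sq_eq_dist_sq_add_dist_sq_sub_two_mul_dist_mul_dist_mul_cos_angle a b c
  have h3 : 0 < dist a b := dist_pos.2 hab
  rw [dist_comm b a, dist_comm c a] at h1
  rw [dist_comm c b] at h2
  apply mul_left_cancel₀ h3.ne'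
  nlinarith

theorem law_sin_projection {V : Type*} [NormedAddCommGroup V] [InnerProductSpace ℝ V] (a b c : V) :
    dist a c * Real.sin (∠ b a c) = dist b c * Real.sin (∠ a b c) := by
  have := EuclideanGeometry.law_sin a b c
  rw [angle_comm c a b, dist_comm c a] at this
  linarith

variable {K : SimplicialComplex ℝ Space3}

theorem ne_of_mem_triangles {t : Finset Space3} (ht : t ∈ triangles K) {a b c : Space3}
    (h : (t : Set Space3) = {a, b, c}) : a ≠ b ∧ a ≠ c ∧ b ≠ c := by
  classical
  have h1 : t = {a, b, c} := by apply Finset.coe_injective; rw [h]; simp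
  have h2 := ht.2
  rw [h1] at h2
  refine ⟨?_, ?_, ?_⟩
  · rintro rfl
    have := Finset.card_le_two (a := a) (b := c)
    simp at h2; omega
  · rintro rfl
    have := Finset.card_le_two (a := a) (b := b)
    rw [Finset.pair_comm b a] at h2
    simp at h2; omega
  · rintro rfl
    have := Finset.card_le_two (a := a) (b := b)
    simp at h2; omega

theorem angle_pos_of_mem_triangles {t : Finset Space3} (ht : t ∈ triangles K) {a b c : Space3}
    (h : (t : Set Space3) = {a, b, c}) : 0 < ∠ b a c := by
  obtain ⟨hab, hac, hbc⟩ := ne_of_mem_triangles ht h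
  refine lt_of_le_of_ne (angle_nonneg _ _ _) fun h0 => ?_
  have hcol := collinear_of_angle_eq_zero h0.symm
  have hmem : ∀ x ∈ ({a, b, c} : Set Space3), x ∈ t := by
    intro x hx; rw [← h] at hx; exact hx
  have hind := K.indep ht.1
  have hinj : Function.Injective (![⟨b, hmem b (by simp)⟩, ⟨a, hmem a (by simp)⟩,
      ⟨c, hmem c (by simp)⟩] : Fin 3 → t) := by
    intro i j hij
    fin_cases i <;> fin_cases j <;> simp_all
  have h3 := hind.comp_embedding ⟨_, hinj⟩
  have h4 : ((↑) : t → Space3) ∘ ![⟨b, hmem b (by simp)⟩, ⟨a, hmem a (by simp)⟩,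
      ⟨c, hmem c (by simp)⟩] = ![b, a, c] := by
    ext i; fin_cases i <;> rfl
  have h5 : AffineIndependent ℝ ![b, a, c] := by
    rw [← h4]; exact h3
  exact (affineIndependent_iff_not_collinear_set.1 h5) hcol

theorem angle_le_of_mem_triangles {P : Set Space3} (hP : IsNonobtuselyTriangulated P K)
    {t : Finset Space3} (ht : t ∈ triangles K) {a b c : Space3}
    (h : (t : Set Space3) = {a, b, c}) : ∠ b a c ≤ Real.pi / 2 := by
  obtain ⟨hab, hac, hbc⟩ := ne_of_mem_triangles ht h
  have hmem : ∀ x ∈ ({a, b, c} : Set Space3), x ∈ t := by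
    intro x hx; rw [← h] at hx; exact hx
  exact hP.nonobtuse t ht b (hmem b (by simp)) a (hmem a (by simp)) c (hmem c (by simp))
    hab.symm hac hbc

/-- By `law_cos_projection` the rest of the side `ab` is the projection of `bc`, nonnegative because
the angle at `b` is nonobtuse. This yields the monotone projections of a wing. -/
theorem dist_mul_cos_le {P : Set Space3} (hP : IsNonobtuselyTriangulated P K)
    {t : Finset Space3} (ht : t ∈ triangles K) {a b c : Space3}
    (h : (t : Set Space3) = {a, b, c}) : dist a c * Real.cos (∠ b a c) ≤ dist a b := by
  obtain ⟨hab, hac, hbc⟩ := ne_of_mem_triangles ht h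
  have h1 := law_cos_projection c hab
  have h2 := angle_le_of_mem_triangles hP ht (a := b) (b := a) (c := c)
    (by rw [h, Set.insert_comm])
  have h3 : 0 ≤ Real.cos (∠ a b c) :=
    Real.cos_nonneg_of_mem_Icc ⟨by linarith [angle_nonneg a b c, Real.pi_pos], h2⟩
  have : 0 ≤ dist b c * Real.cos (∠ a b c) := by positivity
  linarith

/-- The base triangle `B = {p 0, p 1, p 2}` together with the fans at its vertices. -/
structure IsPetalFrame (K : SimplicialComplex ℝ Space3) (B : Finset Space3) (p : Fin 3 → Space3)
    (n : Fin 3 → ℕ) (v : Fin 3 → ℕ → Space3) : Prop where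
  mem : B ∈ triangles K
  coe : ∀ i, (B : Set Space3) = {p i, p (i + 1), p (i + 2)}
  fan : ∀ i, IsVertexFan K (p i) (p (i + 1)) (p (i + 2)) (n i) (v i)

theorem exists_isPetalFrame {P : Set Space3} (hP : IsNonobtuselyTriangulated P K)
    {B : Finset Space3} (hB : B ∈ triangles K) :
    ∃ p n v, IsPetalFrame K B p n v := by
  classical
  obtain ⟨a, b, c, hab, hac, hbc, rfl⟩ := Finset.card_eq_three.1 hB.2
  have hcoe : ∀ i : Fin 3, ((({a, b, c} : Finset Space3)) : Set Space3) =
      {![a, b, c] i, ![a, b, c] (i + 1), ![a, b, c] (i + 2)} := by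
    intro i
    fin_cases i <;> ext x <;> simp <;> tauto
  have hfan : ∀ i : Fin 3, ∃ (n : ℕ) (v : ℕ → Space3),
      IsVertexFan K (![a, b, c] i) (![a, b, c] (i + 1)) (![a, b, c] (i + 2)) n v := by
    intro i
    obtain ⟨h1, h2, h3⟩ := ne_of_mem_triangles hB (hcoe i)
    refine exists_isVertexFan hP h1.symm h2.symm h3 ?_
    convert hB.1 using 1
    apply Finset.coe_injective
    rw [hcoe i]; simp
  choose n v hv using hfan
  exact ⟨_, n, v, hB, hcoe, hv⟩

namespace IsPetalFrame

variable {B : Finset Space3} {p : Fin 3 → Space3} {n : Fin 3 → ℕ} {v : Fin 3 → ℕ → Space3}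

theorem ne (h : IsPetalFrame K B p n v) (i : Fin 3) :
    p i ≠ p (i + 1) ∧ p i ≠ p (i + 2) ∧ p (i + 1) ≠ p (i + 2) :=
  ne_of_mem_triangles h.mem (h.coe i)

theorem fan_ne (h : IsPetalFrame K B p n v) {i : Fin 3} {l : ℕ} (hl : l < n i) :
    p i ≠ v i l ∧ p i ≠ v i (l + 1) ∧ v i l ≠ v i (l + 1) := by
  obtain ⟨t, ht, h1⟩ := (h.fan i).triangle l hl
  exact ne_of_mem_triangles ht h1

theorem index_of_mem (h : IsPetalFrame K B p n v) {i : Fin 3} {l j : ℕ} (hl : l < n i)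
    (hj : j ≤ n i) (hmem : v i j ∈ ({p i, v i l, v i (l + 1)} : Set Space3)) :
    j = l ∨ j = l + 1 := by
  rcases hmem with h1 | h1 | h1
  · exact absurd h1 ((h.fan i).ne j hj)
  · exact Or.inl ((h.fan i).inj _ hj _ hl.le h1)
  · exact Or.inr ((h.fan i).inj _ hj _ hl h1)

theorem eq_zero_of_mem (h : IsPetalFrame K B p n v) {i : Fin 3} {l : ℕ} (hl : l < n i)
    (hmem : p (i + 1) ∈ ({p i, v i l, v i (l + 1)} : Set Space3)) : l = 0 := by
  rw [← (h.fan i).first] at hmem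
  rcases h.index_of_mem hl (Nat.zero_le _) hmem with h1 | h1 <;> omega

theorem eq_last_of_mem (h : IsPetalFrame K B p n v) {i : Fin 3} {l : ℕ} (hl : l < n i)
    (hmem : p (i + 2) ∈ ({p i, v i l, v i (l + 1)} : Set Space3)) : l = n i - 1 := by
  rw [← (h.fan i).last] at hmem
  rcases h.index_of_mem hl le_rfl hmem with h1 | h1 <;> omega

theorem eq_of_fan_eq (h : IsPetalFrame K B p n v) {i : Fin 3} {l l' : ℕ} (hl : l < n i)
    (hl' : l' < n i)
    (he : ({p i, v i l, v i (l + 1)} : Set Space3) = {p i, v i l', v i (l' + 1)}) : l = l' := by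
  have h1 := h.index_of_mem hl' hl.le (by rw [← he]; simp)
  have h2 := h.index_of_mem hl' hl (by rw [← he]; simp)
  omega

theorem base_ne_fan (h : IsPetalFrame K B p n v) {i : Fin 3} {l : ℕ} (hl : l < n i) :
    (B : Set Space3) ≠ {p i, v i l, v i (l + 1)} := by
  intro he
  have h2 := (h.fan i).two_le
  have h3 := h.eq_zero_of_mem hl (by rw [← he, h.coe i]; simp)
  have h4 := h.eq_last_of_mem hl (by rw [← he, h.coe i]; simp)
  omega

theorem fan_last (h : IsPetalFrame K B p n v) (i : Fin 3) : v (i + 1) (n (i + 1)) = p i := by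
  rw [(h.fan (i + 1)).last, IsPetalLayout.add_one_add_two]

/-- The neighbour across the edge from `p i` to `p (i + 1)` contains `p i`, the last vertex of the
next fan, so it is the last triangle there. -/
theorem apex_eq (h : IsPetalFrame K B p n v) (i : Fin 3) :
    v i 1 = v (i + 1) (n (i + 1) - 1) := by
  have h2 := (h.fan i).two_le
  have h2' := (h.fan (i + 1)).two_le
  obtain ⟨t, ht, he⟩ := (h.fan i).triangle 0 (by omega)
  rw [(h.fan i).first, zero_add] at he
  obtain ⟨h3, h4, h5⟩ := ne_of_mem_triangles ht he
  have hpt : p (i + 1) ∈ t := by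
    have : p (i + 1) ∈ (t : Set Space3) := by rw [he]; simp
    exact this
  rcases (h.fan (i + 1)).exhaust t ht hpt with h6 | ⟨j, hj, h6⟩
  · exfalso
    rw [← h.coe (i + 1)] at h6
    apply h.base_ne_fan (i := i) (l := 0) (by omega)
    rw [← h6, he, (h.fan i).first]
  · have h7 : j = n (i + 1) - 1 := by
      apply h.eq_last_of_mem hj
      rw [← h6, he, IsPetalLayout.add_one_add_two]; simp
    have h8 : v i 1 ∈ ({p (i + 1), v (i + 1) j, v (i + 1) (j + 1)} : Set Space3) := by
      rw [← h6, he]; simp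
    rw [h7, Nat.sub_add_cancel (by omega), h.fan_last] at h8
    rcases h8 with h8 | h8 | h8
    · exact absurd h8.symm h5
    · exact h8
    · exact absurd h8.symm h4

theorem fan_first_eq_last (h : IsPetalFrame K B p n v) (i : Fin 3) :
    ({p i, v i 0, v i (0 + 1)} : Set Space3) =
      {p (i + 1), v (i + 1) (n (i + 1) - 1), v (i + 1) (n (i + 1) - 1 + 1)} := by
  have h2' := (h.fan (i + 1)).two_le
  rw [Nat.sub_add_cancel (by omega), h.fan_last, ← h.apex_eq, (h.fan i).first, zero_add]
  ext x; simp; tauto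

end IsPetalFrame

end Petal

open Geometry

/-! ### Reading a planar layout off the fans -/

section FrameLayout

open EuclideanGeometry

/-- Side lengths of the base triangle. -/
noncomputable def sideLength (p : Fin 3 → Space3) (i : Fin 3) : ℝ := dist (p i) (p (i + 1))

/-- Angles of the base triangle. -/
noncomputable def baseAngle (p : Fin 3 → Space3) (i : Fin 3) : ℝ :=
  ∠ (p (i + 1)) (p i) (p (i + 2))

/-- Lengths of the edges of the fans. -/
noncomputable def fanRadius (p : Fin 3 → Space3) (v : Fin 3 → ℕ → Space3) (i : Fin 3) (j : ℕ) :
    ℝ :=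
  dist (p i) (v i j)

/-- Cumulative angles of the fans. -/
noncomputable def fanSum (p : Fin 3 → Space3) (v : Fin 3 → ℕ → Space3) (i : Fin 3) (j : ℕ) : ℝ :=
  ∑ l ∈ Finset.range j, ∠ (v i l) (p i) (v i (l + 1))

theorem fanSum_succ_sub (p : Fin 3 → Space3) (v : Fin 3 → ℕ → Space3) (i : Fin 3) (j : ℕ) :
    fanSum p v i (j + 1) - fanSum p v i j = ∠ (v i j) (p i) (v i (j + 1)) := by
  rw [fanSum, fanSum, Finset.sum_range_succ, add_sub_cancel_left]

namespace IsPetalFrame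

variable {K : SimplicialComplex ℝ Space3} {P : Set Space3}
  {B : Finset Space3} {p : Fin 3 → Space3} {n : Fin 3 → ℕ} {v : Fin 3 → ℕ → Space3}

theorem baseAngle_sum (h : IsPetalFrame K B p n v) :
    baseAngle p 0 + baseAngle p 1 + baseAngle p 2 = Real.pi := by
  obtain ⟨h1, h2, h3⟩ := h.ne 0
  have := angle_add_angle_add_angle_eq_pi (p₁ := p 1) (p₂ := p 0) (p 2) h1
  change ∠ (p 1) (p 0) (p 2) + ∠ (p 2) (p 1) (p 0) + ∠ (p 0) (p 2) (p 1) = _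
  linarith

theorem sideLength_cos (h : IsPetalFrame K B p n v) :
    sideLength p 2 * Real.cos (baseAngle p 0) + sideLength p 1 * Real.cos (baseAngle p 1) =
      sideLength p 0 := by
  have := law_cos_projection (p 2) (h.ne 0).1
  change dist (p 2) (p 0) * Real.cos (∠ (p 1) (p 0) (p 2)) +
    dist (p 1) (p 2) * Real.cos (∠ (p 2) (p 1) (p 0)) = dist (p 0) (p 1)
  rw [dist_comm (p 2), angle_comm (p 2)]
  exact this

theorem sideLength_sin (p : Fin 3 → Space3) :
    sideLength p 2 * Real.sin (baseAngle p 0) = sideLength p 1 * Real.sin (baseAngle p 1) := by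
  have := law_sin_projection (p 0) (p 1) (p 2)
  change dist (p 2) (p 0) * Real.sin (∠ (p 1) (p 0) (p 2)) =
    dist (p 1) (p 2) * Real.sin (∠ (p 2) (p 1) (p 0))
  rw [dist_comm (p 2), angle_comm (p 2)]
  exact this

open Complex in
theorem exists_base (h : IsPetalFrame K B p n v) :
    ∃ z e : Fin 3 → ℂ, (∀ i, ‖e i‖ = 1) ∧ (∀ i, z (i + 1) = z i + sideLength p i * e i) ∧
      ∀ i, e (i + 1) = -(e i * exp ((-baseAngle p (i + 1) : ℝ) * I)) := by
  have hs := h.baseAngle_sum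
  have hsin := sideLength_sin p
  have hcos := h.sideLength_cos
  set β := baseAngle p
  set c := sideLength p
  have hπ : exp ((-(β 1 + β 2) : ℝ) * I) = -exp ((β 0 : ℝ) * I) := by
    rw [show -(β 1 + β 2) = β 0 - Real.pi by linarith, ofReal_sub, sub_mul, exp_sub, exp_pi_mul_I,
      div_neg, div_one]
  have hπ' : exp ((-β 1 : ℝ) * I) * exp ((-β 2 : ℝ) * I) = exp ((-(β 1 + β 2) : ℝ) * I) := by
    rw [← exp_add]; congr 1; push_cast; ring
  have h0 : exp ((β 0 : ℝ) * I) * exp ((-β 0 : ℝ) * I) = 1 := by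
    rw [← exp_add]; simp
  -- The closing condition of the triangle drawn side by side from 0; its real and imaginary parts
  -- are the laws of cosines and sines.
  have hclose : (c 0 : ℂ) = c 1 * exp ((-β 1 : ℝ) * I) + c 2 * exp ((β 0 : ℝ) * I) := by
    apply Complex.ext
    · rw [add_re, re_ofReal_mul, re_ofReal_mul, exp_ofReal_mul_I_re, exp_ofReal_mul_I_re,
        Real.cos_neg, ofReal_re]
      linarith
    · rw [add_im, im_ofReal_mul, im_ofReal_mul, exp_ofReal_mul_I_im, exp_ofReal_mul_I_im,
        Real.sin_neg, ofReal_im]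
      linarith
  refine ⟨![0, c 0, c 0 - c 1 * exp ((-β 1 : ℝ) * I)],
    ![1, -exp ((-β 1 : ℝ) * I), exp ((-(β 1 + β 2) : ℝ) * I)], ?_, ?_, ?_⟩
  · intro i
    fin_cases i
    · exact norm_one
    · change ‖-exp _‖ = 1
      rw [norm_neg, norm_exp_ofReal_mul_I]
    · exact norm_exp_ofReal_mul_I _
  · intro i
    fin_cases i
    · change (c 0 : ℂ) = 0 + c 0 * 1
      ring
    · change (c 0 : ℂ) - c 1 * exp ((-β 1 : ℝ) * I) = c 0 + c 1 * -exp ((-β 1 : ℝ) * I)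
      ring
    · change (0 : ℂ) = c 0 - c 1 * exp ((-β 1 : ℝ) * I) + c 2 * exp ((-(β 1 + β 2) : ℝ) * I)
      rw [hπ]
      linear_combination -hclose
  · intro i
    fin_cases i
    · change -exp ((-β 1 : ℝ) * I) = -(1 * exp ((-β 1 : ℝ) * I))
      ring
    · change exp ((-(β 1 + β 2) : ℝ) * I) = -(-exp ((-β 1 : ℝ) * I) * exp ((-β 2 : ℝ) * I))
      rw [← hπ']; ring
    · change (1 : ℂ) = -(exp ((-(β 1 + β 2) : ℝ) * I) * exp ((-β 0 : ℝ) * I))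
      rw [hπ]
      linear_combination -h0

theorem total_le (h : IsPetalFrame K B p n v) (i : Fin 3) :
    fanSum p v i (n i) + baseAngle p i ≤ 2 * Real.pi :=
  (h.fan i).sum_angle

theorem baseAngle_le (hP : IsNonobtuselyTriangulated P K) (h : IsPetalFrame K B p n v)
    (i : Fin 3) : baseAngle p i ≤ Real.pi / 2 :=
  angle_le_of_mem_triangles hP h.mem (h.coe i)

theorem fanSum_step (hP : IsNonobtuselyTriangulated P K) (h : IsPetalFrame K B p n v)
    {i : Fin 3} {j : ℕ} (hj : j < n i) :
    fanSum p v i (j + 1) ≤ fanSum p v i j + Real.pi / 2 := by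
  obtain ⟨t, ht, he⟩ := (h.fan i).triangle j hj
  have := angle_le_of_mem_triangles hP ht he
  rw [← fanSum_succ_sub] at this
  linarith

theorem exists_cut (hP : IsNonobtuselyTriangulated P K) (h : IsPetalFrame K B p n v)
    (i : Fin 3) : ∃ k, 0 < k ∧ k < n i ∧ fanSum p v i k ≤ 3 * Real.pi / 2 - baseAngle p i ∧
      fanSum p v i (n i) - fanSum p v i k ≤ 3 * Real.pi / 2 - baseAngle p i := by
  have h2 := (h.fan i).two_le
  have hβ := baseAngle_le hP h i
  have ht := h.total_le i
  obtain ⟨k, h1, h2, h3, h4⟩ := exists_split (A := fanSum p v i) (n := n i)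
    (M := 3 * Real.pi / 2 - baseAngle p i) h2 (fun j hj => fanSum_step hP h hj)
    (by
      have := fanSum_step hP h (i := i) (j := 0) (by omega)
      simp only [zero_add] at this
      have h0 : fanSum p v i 0 = 0 := by simp [fanSum]
      linarith [Real.pi_pos])
    (by
      have := fanSum_step hP h (i := i) (j := n i - 1) (by omega)
      rw [Nat.sub_add_cancel (by omega)] at this
      linarith [Real.pi_pos])
    -- Here 2M - π/2 = 5π/2 - 2β, which is at least 2π - β because β ≤ π/2.
    (by linarith)
  exact ⟨k, h1, h2, h3, h4⟩

theorem exists_isPetalLayout (hP : IsNonobtuselyTriangulated P K) (h : IsPetalFrame K B p n v) :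
    ∃ z e k, IsPetalLayout (sideLength p) (baseAngle p) z e n k (fanRadius p v) (fanSum p v) := by
  obtain ⟨z, e, he, hz, hee⟩ := h.exists_base
  choose k hk0 hkn hk1 hk2 using exists_cut hP h
  have hn := fun i => (h.fan i).two_le
  have hlast : ∀ i, fanSum p v (i + 1) (n (i + 1)) - fanSum p v (i + 1) (n (i + 1) - 1) =
      ∠ (p i) (p (i + 1)) (v i 1) := by
    intro i
    have := fanSum_succ_sub p v (i + 1) (n (i + 1) - 1)
    have h2 := hn (i + 1)
    rw [Nat.sub_add_cancel (by omega), h.fan_last, ← h.apex_eq, angle_comm] at this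
    exact this
  have hfirst : ∀ i, fanSum p v i 1 = ∠ (p (i + 1)) (p i) (v i 1) := by
    intro i
    simp [fanSum, (h.fan i).first]
  refine ⟨z, e, k, ⟨fun i => angle_pos_of_mem_triangles h.mem (h.coe i), baseAngle_le hP h,
    h.baseAngle_sum, he, hz, hee, fun i j hj => dist_pos.2 ((h.fan i).ne j hj).symm, ?_, ?_,
    fun i => by simp [fanSum], ?_, fun i j hj => fanSum_step hP h hj, ?_, ?_, h.total_le,
    hk0, hkn, hk1, hk2, ?_, ?_⟩⟩
  · intro i; rw [fanRadius, (h.fan i).first, sideLength]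
  · intro i
    rw [fanRadius, (h.fan i).last, sideLength, IsPetalLayout.add_two_add_one, dist_comm]
  · intro i j hj
    obtain ⟨t, ht, hte⟩ := (h.fan i).triangle j hj
    have := angle_pos_of_mem_triangles ht hte
    rw [← fanSum_succ_sub] at this
    linarith
  · intro i j hj
    obtain ⟨t, ht, hte⟩ := (h.fan i).triangle j hj
    rw [fanSum_succ_sub]
    exact dist_mul_cos_le hP ht hte
  · intro i j hj
    obtain ⟨t, ht, hte⟩ := (h.fan i).triangle j hj
    rw [fanSum_succ_sub, angle_comm]
    rw [Set.pair_comm] at hte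
    exact dist_mul_cos_le hP ht hte
  · intro i
    rw [hlast, hfirst, fanRadius, fanRadius, ← h.apex_eq]
    exact law_cos_projection _ (h.ne i).1
  · intro i
    rw [hlast, hfirst, fanRadius, fanRadius, ← h.apex_eq]
    exact law_sin_projection _ _ _

end IsPetalFrame

end FrameLayout

open Geometry

/-! ### Consistent placement of the faces -/

section Placement

open Complex

/-- Each point differs from its foot on the line by a real multiple of the normal `w * I`, and the
two multiples have opposite signs. -/
theorem sOppSide_polar {a w : ℂ} (hw : w ≠ 0) {ρ r s δ ε : ℝ} (hρ : 0 < ρ) (hr : 0 < r)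
    (hs : 0 < s) (hδ : 0 < δ) (hδ' : δ < Real.pi) (hε : 0 < ε) (hε' : ε < Real.pi) :
    (affineSpan ℝ {a, a + ρ * w}).SOppSide (a + r * (w * exp ((δ : ℝ) * I)))
      (a + s * (w * exp ((-ε : ℝ) * I))) := by
  have hdec : ∀ q θ : ℝ, a + q * (w * exp ((θ : ℝ) * I)) -
      AffineMap.lineMap a (a + ρ * w) (q * Real.cos θ / ρ) = (q * Real.sin θ) • (w * I) := by
    intro q θ
    have hρ' : (ρ : ℂ) ≠ 0 := ofReal_ne_zero.2 hρ.ne'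
    rw [AffineMap.lineMap_apply, vsub_eq_sub, add_sub_cancel_left, vadd_eq_add, exp_mul_I,
      real_smul, real_smul]
    push_cast
    field_simp
    ring
  have hnot : ∀ q θ : ℝ, q * Real.sin θ ≠ 0 →
      a + q * (w * exp ((θ : ℝ) * I)) ∉ affineSpan ℝ {a, a + ρ * w} := by
    intro q θ h0 hmem
    rw [add_comm a (q * _ : ℂ), ← vadd_eq_add (q * _ : ℂ)] at hmem
    obtain ⟨t, ht⟩ := vadd_left_mem_affineSpan_pair.1 hmem
    rw [vsub_eq_sub, add_sub_cancel_left, real_smul] at ht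
    have h1 : w * ((t * ρ : ℝ) : ℂ) = w * (q * exp (θ * I)) := by
      push_cast; linear_combination ht
    have h2 := congrArg Complex.im (mul_left_cancel₀ hw h1)
    rw [ofReal_im, im_ofReal_mul, exp_ofReal_mul_I_im] at h2
    exact h0 h2.symm
  have s1 : 0 < r * Real.sin δ := mul_pos hr (Real.sin_pos_of_pos_of_lt_pi hδ hδ')
  have s2 : s * Real.sin (-ε) < 0 := by
    rw [Real.sin_neg]
    have := mul_pos hs (Real.sin_pos_of_pos_of_lt_pi hε hε')
    linarith
  exact AffineSubspace.sOppSide_of_vsub_eq_smul (AffineMap.lineMap_mem_affineSpan_pair _ _ _)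
    (AffineMap.lineMap_mem_affineSpan_pair _ _ _) (hdec r δ) (hdec s (-ε))
    (mul_nonpos_of_nonneg_of_nonpos s1.le s2.le) (hnot _ _ s1.ne') (hnot _ _ s2.ne)

theorem IsPetalLayout.sOppSide {c β : Fin 3 → ℝ} {z e : Fin 3 → ℂ} {n k : Fin 3 → ℕ}
    {r A : Fin 3 → ℕ → ℝ} (h : IsPetalLayout c β z e n k r A) (i : Fin 3) {ρ r₁ r₂ φ φ₁ φ₂ : ℝ}
    (hρ : 0 < ρ) (hr₁ : 0 < r₁) (hr₂ : 0 < r₂) (h₁ : φ < φ₁) (h₁' : φ₁ ≤ φ + Real.pi / 2)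
    (h₂ : φ₂ < φ) (h₂' : φ ≤ φ₂ + Real.pi / 2) :
    (affineSpan ℝ {z i, z i + ρ * (e i * exp (φ * I))}).SOppSide
      (z i + r₁ * (e i * exp (φ₁ * I))) (z i + r₂ * (e i * exp (φ₂ * I))) := by
  have he : e i ≠ 0 := by
    intro h0
    have := h.norm_e i
    simp [h0] at this
  have hπ := Real.pi_pos
  have := sOppSide_polar (a := z i) (mul_ne_zero he (exp_ne_zero (φ * I))) (δ := φ₁ - φ)
    (ε := φ - φ₂) hρ hr₁ hr₂ (by linarith) (by linarith) (by linarith) (by linarith)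
  have e1 : e i * exp (φ * I) * exp ((φ₁ - φ : ℝ) * I) = e i * exp (φ₁ * I) := by
    rw [mul_assoc, ← exp_add]; congr 2; push_cast; ring
  have e2 : e i * exp (φ * I) * exp ((-(φ - φ₂) : ℝ) * I) = e i * exp (φ₂ * I) := by
    rw [mul_assoc, ← exp_add]; congr 2; push_cast; ring
  rwa [e1, e2] at this

theorem eq_or_eq_add_one (i j : Fin 3) : i = j ∨ j = i + 1 ∨ i = j + 1 := by
  revert i j; decide

namespace IsPetalFrame

variable {K : SimplicialComplex ℝ Space3} {B : Finset Space3} {p : Fin 3 → Space3}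
  {n k : Fin 3 → ℕ} {v : Fin 3 → ℕ → Space3} {c β : Fin 3 → ℝ} {z e : Fin 3 → ℂ}
  {r A : Fin 3 → ℕ → ℝ}

theorem injective (h : IsPetalFrame K B p n v) : Function.Injective p := by
  intro i j hij
  rcases eq_or_eq_add_one i j with h1 | rfl | rfl
  · exact h1
  · exact absurd hij (h.ne i).1
  · exact absurd hij.symm (h.ne j).1

theorem eq_fan_cases (h : IsPetalFrame K B p n v) {i i' : Fin 3} {l l' : ℕ} (hl : l < n i)
    (hl' : l' < n i')
    (he : ({p i, v i l, v i (l + 1)} : Set Space3) = {p i', v i' l', v i' (l' + 1)}) :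
    (i = i' ∧ l = l') ∨ (i' = i + 1 ∧ l = 0 ∧ l' = n i' - 1) ∨
      (i = i' + 1 ∧ l' = 0 ∧ l = n i - 1) := by
  rcases eq_or_eq_add_one i i' with rfl | rfl | rfl
  · exact Or.inl ⟨rfl, h.eq_of_fan_eq hl hl' he⟩
  · refine Or.inr (Or.inl ⟨rfl, h.eq_zero_of_mem hl (by rw [he]; simp), h.eq_last_of_mem hl' ?_⟩)
    rw [← he, IsPetalLayout.add_one_add_two]; simp
  · refine Or.inr (Or.inr ⟨rfl, h.eq_zero_of_mem hl' (by rw [← he]; simp), h.eq_last_of_mem hl ?_⟩)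
    rw [he, IsPetalLayout.add_one_add_two]; simp

variable (β z e n k r A p v) in
/-- The vertices of a fan triangle with their images. -/
def placedFan (i : Fin 3) (l : ℕ) : Set (Space3 × ℂ) :=
  {(p i, z i), (v i l, fanPoint β z e n k r A i l l),
    (v i (l + 1), fanPoint β z e n k r A i l (l + 1))}

theorem placedFan_first_eq_last (h : IsPetalFrame K B p n v)
    (hL : IsPetalLayout c β z e n k r A) (i : Fin 3) :
    placedFan p n k v β z e r A i 0 = placedFan p n k v β z e r A (i + 1) (n (i + 1) - 1) := by
  have h2' := (h.fan (i + 1)).two_le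
  have hz : z i = fanPoint β z e n k r A (i + 1) (n (i + 1) - 1) (n (i + 1)) := by
    rw [hL.fanPoint_last, IsPetalLayout.add_one_add_two]
  rw [placedFan, placedFan, Nat.sub_add_cancel (by omega), h.fan_last, ← h.apex_eq,
    (h.fan i).first, zero_add, hL.fanPoint_first, hL.fanPoint_apex, ← hz]
  ext x; simp; tauto

theorem placedFan_unique (h : IsPetalFrame K B p n v) {i : Fin 3} {l : ℕ} (hl : l < n i)
    {x : Space3} {w w' : ℂ} (hw : (x, w) ∈ placedFan p n k v β z e r A i l)
    (hw' : (x, w') ∈ placedFan p n k v β z e r A i l) : w = w' := by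
  obtain ⟨h1, h2, h3⟩ := h.fan_ne hl
  simp only [placedFan, Set.mem_insert_iff, Set.mem_singleton_iff, Prod.mk.injEq] at hw hw'
  rcases hw with ⟨rfl, rfl⟩ | ⟨rfl, rfl⟩ | ⟨rfl, rfl⟩ <;>
    rcases hw' with ⟨h4, rfl⟩ | ⟨h4, rfl⟩ | ⟨h4, rfl⟩ <;>
    first
      | rfl
      | exact absurd h4 h1
      | exact absurd h4 h2
      | exact absurd h4 h3
      | exact absurd h4.symm h1
      | exact absurd h4.symm h2
      | exact absurd h4.symm h3

theorem placedFan_congr (h : IsPetalFrame K B p n v) (hL : IsPetalLayout c β z e n k r A)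
    {i i' : Fin 3} {l l' : ℕ} (hl : l < n i) (hl' : l' < n i')
    (he : ({p i, v i l, v i (l + 1)} : Set Space3) = {p i', v i' l', v i' (l' + 1)}) :
    placedFan p n k v β z e r A i l = placedFan p n k v β z e r A i' l' := by
  rcases h.eq_fan_cases hl hl' he with ⟨rfl, rfl⟩ | ⟨rfl, rfl, rfl⟩ | ⟨rfl, rfl, rfl⟩
  · rfl
  · exact h.placedFan_first_eq_last hL i
  · exact (h.placedFan_first_eq_last hL i').symm

end IsPetalFrame

/-- `φ` places the base triangle and the fan triangles in the plane as the layout prescribes. -/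
structure IsPlacement (B : Finset Space3) (p : Fin 3 → Space3) (n k : Fin 3 → ℕ)
    (v : Fin 3 → ℕ → Space3) (β : Fin 3 → ℝ) (z e : Fin 3 → ℂ) (r A : Fin 3 → ℕ → ℝ)
    (φ : Finset Space3 → Space3 → ℂ) : Prop where
  base : ∀ i, φ B (p i) = z i
  center : ∀ {i l} {t : Finset Space3}, l < n i → (t : Set Space3) = {p i, v i l, v i (l + 1)} → φ t (p i) = z i
  left : ∀ {i l} {t : Finset Space3}, l < n i → (t : Set Space3) = {p i, v i l, v i (l + 1)} →
    φ t (v i l) = fanPoint β z e n k r A i l l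
  right : ∀ {i l} {t : Finset Space3}, l < n i → (t : Set Space3) = {p i, v i l, v i (l + 1)} →
    φ t (v i (l + 1)) = fanPoint β z e n k r A i l (l + 1)

theorem IsPetalFrame.exists_isPlacement {K : SimplicialComplex ℝ Space3} {B : Finset Space3}
    {p : Fin 3 → Space3} {n k : Fin 3 → ℕ} {v : Fin 3 → ℕ → Space3} {c β : Fin 3 → ℝ}
    {z e : Fin 3 → ℂ} {r A : Fin 3 → ℕ → ℝ} (h : IsPetalFrame K B p n v)
    (hL : IsPetalLayout c β z e n k r A) : ∃ φ, IsPlacement B p n k v β z e r A φ := by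
  classical
  -- A neighbour across a side of `B` carries two labels, so the placement is first a relation. It
  -- is single-valued because both labels give the same `placedFan`; the default 0 is used only
  -- where the relation prescribes nothing.
  let R : Finset Space3 → Space3 → ℂ → Prop := fun t x w =>
    (t = B ∧ ∃ i, x = p i ∧ w = z i) ∨ ∃ i l, l < n i ∧
      (t : Set Space3) = {p i, v i l, v i (l + 1)} ∧ (x, w) ∈ placedFan p n k v β z e r A i l
  have hR : ∀ t x w w', R t x w → R t x w' → w = w' := by
    rintro t x w w' (⟨rfl, i, rfl, rfl⟩ | ⟨i, l, hl, ht, hw⟩) (⟨hB, i', hi, rfl⟩ |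
      ⟨i', l', hl', ht', hw'⟩)
    · rw [h.injective hi]
    · exact absurd ht' (h.base_ne_fan hl')
    · rw [hB] at ht
      exact absurd ht (h.base_ne_fan hl)
    · rw [h.placedFan_congr hL hl hl' (ht.symm.trans ht')] at hw
      exact h.placedFan_unique hl' hw hw'
  have key : ∀ {t x w}, R t x w → (if hx : ∃ w, R t x w then hx.choose else 0) = w := by
    intro t x w hw
    have hx : ∃ w, R t x w := ⟨w, hw⟩
    rw [dif_pos hx]
    exact hR t x _ _ hx.choose_spec hw
  refine ⟨fun t x => if hx : ∃ w, R t x w then hx.choose else 0, fun i => ?_,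
    fun {i l t} hl ht => ?_, fun {i l t} hl ht => ?_, fun {i l t} hl ht => ?_⟩
  · exact key (Or.inl ⟨rfl, i, rfl, rfl⟩)
  all_goals exact key (Or.inr ⟨i, l, hl, ht, by simp [placedFan]⟩)

end Placement

open Geometry

/-! ### Cut edges, attachment, congruence and disjointness -/

section Unfolding

open EuclideanGeometry

namespace IsPetalFrame

variable {K : SimplicialComplex ℝ Space3} {B : Finset Space3} {p : Fin 3 → Space3}
  {n k : Fin 3 → ℕ} {v : Fin 3 → ℕ → Space3} {c β : Fin 3 → ℝ} {z e : Fin 3 → ℂ}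
  {r A : Fin 3 → ℕ → ℝ} {φ : Finset Space3 → Space3 → ℂ}

theorem exists_of_mem_base (h : IsPetalFrame K B p n v) {x : Space3} (hx : x ∈ B) :
    ∃ i, x = p i := by
  have hx' : x ∈ (B : Set Space3) := hx
  rw [h.coe 0] at hx'
  rcases hx' with rfl | rfl | rfl
  exacts [⟨_, rfl⟩, ⟨_, rfl⟩, ⟨_, rfl⟩]

theorem fan_mem_base (h : IsPetalFrame K B p n v) {i : Fin 3} {j : ℕ} (hj : j ≤ n i)
    (hB : v i j ∈ B) : j = 0 ∨ j = n i := by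
  have hB' : v i j ∈ (B : Set Space3) := hB
  rw [h.coe i, ← (h.fan i).first, ← (h.fan i).last] at hB'
  rcases hB' with h1 | h1 | h1
  · exact absurd h1 ((h.fan i).ne j hj)
  · exact Or.inl ((h.fan i).inj _ hj _ (Nat.zero_le _) h1)
  · exact Or.inr ((h.fan i).inj _ hj _ le_rfl h1)

variable (K B p k v) in
/-- The edges cut by the petal unfolding: those without a vertex on the base, and the `k i`-th
edge of the fan at `p i`. -/
def cutEdges : Set (Finset Space3) :=
  {e | e ∈ edges K ∧ (Disjoint e B ∨ ∃ i, (e : Set Space3) = {p i, v i (k i)})}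

theorem isPetalCut (h : IsPetalFrame K B p n v) (hk0 : ∀ i, 0 < k i) (hkn : ∀ i, k i < n i) :
    IsPetalCut K B (cutEdges K B p k v) := by
  -- Strictness of 0 < k < n matters here: fan vertices 0 and n are the other two vertices of `B`.
  have hkB : ∀ i, v i (k i) ∉ B := by
    intro i hB
    have := hk0 i
    have := hkn i
    rcases h.fan_mem_base (hkn i).le hB with h1 | h1 <;> omega
  refine ⟨fun e he => he.1, ?_, fun e he hd => ⟨he, Or.inl hd⟩, ?_⟩
  · rintro e ⟨he, hd | ⟨i, hi⟩⟩ hsub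
    · have h0 := (Finset.disjoint_self_iff_empty _).1 (hd.mono_right hsub)
      have := he.2
      rw [h0] at this
      simp at this
    · have : v i (k i) ∈ (e : Set Space3) := by rw [hi]; simp
      exact hkB i (hsub this)
  · intro b hb
    obtain ⟨i, rfl⟩ := h.exists_of_mem_base hb
    obtain ⟨e, he, hee⟩ := (h.fan i).edge (k i) (hkn i).le
    have hpe : p i ∈ (e : Set Space3) := by rw [hee]; simp
    refine ⟨e, ⟨⟨he, Or.inr ⟨i, hee⟩⟩, hpe⟩, ?_⟩
    rintro e' ⟨⟨he', hd | ⟨i', hi'⟩⟩, hpe'⟩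
    · exact absurd hb (Finset.disjoint_left.1 hd hpe')
    · have h1 : p i ∈ (e' : Set Space3) := hpe'
      rw [hi'] at h1
      rcases h1 with h1 | h1
      · rw [← h.injective h1, ← hee] at hi'
        exact Finset.coe_injective hi'
      · rw [h1] at hb
        exact absurd hb (hkB i')

theorem base_or_fan (h : IsPetalFrame K B p n v) {t : Finset Space3} (ht : t ∈ triangles K)
    {i : Fin 3} (hi : p i ∈ t) :
    t = B ∨ ∃ l < n i, (t : Set Space3) = {p i, v i l, v i (l + 1)} := by
  rcases (h.fan i).exhaust t ht hi with h1 | h1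
  · rw [← h.coe i] at h1
    exact Or.inl (Finset.coe_injective h1)
  · exact Or.inr h1

theorem base_or_fan_of_mem (h : IsPetalFrame K B p n v) {t : Finset Space3}
    (ht : t ∈ vertexNeighborhood K B) :
    t = B ∨ ∃ i, ∃ l < n i, (t : Set Space3) = {p i, v i l, v i (l + 1)} := by
  obtain ⟨h1, x, hxt, hxB⟩ := ht
  obtain ⟨i, rfl⟩ := h.exists_of_mem_base hxB
  exact (h.base_or_fan h1 hxt).imp id fun h2 => ⟨i, h2⟩

/-- Two triangles at the base sharing an uncut edge are consecutive in a fan on one side of the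
cut, or are the base and the first triangle of a fan. -/
theorem adjacent_cases (h : IsPetalFrame K B p n v)
    {Q : Finset Space3 → Finset Space3 → Finset Space3 → Prop}
    (hsymm : ∀ t t' s, Q t t' s → Q t' t s)
    (hfan : ∀ i l, ∀ t t' s : Finset Space3, l + 1 < n i → l + 1 ≠ k i →
      (t : Set Space3) = {p i, v i l, v i (l + 1)} →
      (t' : Set Space3) = {p i, v i (l + 1), v i (l + 1 + 1)} →
      (s : Set Space3) = {p i, v i (l + 1)} → Q t t' s)
    (hbase : ∀ i, ∀ t s : Finset Space3, (t : Set Space3) = {p i, v i 0, v i (0 + 1)} →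
      (s : Set Space3) = {p i, p (i + 1)} → Q B t s)
    {t t' : Finset Space3} (ht : t ∈ vertexNeighborhood K B) (ht' : t' ∈ vertexNeighborhood K B)
    (htt : t ≠ t') {s : Finset Space3} (hs : s.card = 2) (hst : s ⊆ t) (hst' : s ⊆ t')
    (hcut : s ∉ cutEdges K B p k v) : Q t t' s := by
  have hsK : s ∈ edges K :=
    ⟨K.down_closed ht.1.1 hst (Finset.card_pos.1 (by omega)), hs⟩
  obtain ⟨x, hxs, hxB⟩ : ∃ x ∈ s, x ∈ B := by
    by_contra! hc
    exact hcut ⟨hsK, Or.inl (Finset.disjoint_left.2 hc)⟩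
  obtain ⟨i, rfl⟩ := h.exists_of_mem_base hxB
  obtain ⟨j, hj, hsj⟩ := (h.fan i).exhaust_edge s hsK hxs
  have hjk : j ≠ k i := by
    rintro rfl
    exact hcut ⟨hsK, Or.inr ⟨i, hsj⟩⟩
  have hvs : v i j ∈ s := by
    have : v i j ∈ (s : Set Space3) := by rw [hsj]; simp
    exact this
  have hidx : ∀ {u : Finset Space3} {l : ℕ}, s ⊆ u → l < n i →
      (u : Set Space3) = {p i, v i l, v i (l + 1)} → j = l ∨ j = l + 1 := by
    intro u l hsu hl hu
    have : v i j ∈ (u : Set Space3) := hsu hvs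
    rw [hu] at this
    exact h.index_of_mem hl hj this
  have hQB : ∀ {u : Finset Space3} {l : ℕ}, s ⊆ B → s ⊆ u → l < n i →
      (u : Set Space3) = {p i, v i l, v i (l + 1)} → Q B u s := by
    intro u l hsB hsu hl hu
    have h2 := (h.fan i).two_le
    have h1 := hidx hsu hl hu
    rcases h.fan_mem_base hj (hsB hvs) with rfl | rfl
    · obtain rfl : l = 0 := by omega
      exact hbase i u s hu (by rw [hsj, (h.fan i).first])
    · obtain rfl : l = n i - 1 := by omega
      -- The last triangle of the fan at `p i` is the first of the fan at `p (i + 2)`, so attachment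
      -- to `B` need only be checked for first triangles.
      apply hbase (i + 2) u s
      · rw [h.fan_first_eq_last, IsPetalLayout.add_two_add_one, hu]
      · rw [hsj, (h.fan i).last, IsPetalLayout.add_two_add_one, Set.pair_comm]
  rcases h.base_or_fan ht.1 (hst hxs) with rfl | ⟨l, hl, hlt⟩ <;>
    rcases h.base_or_fan ht'.1 (hst' hxs) with rfl | ⟨l', hl', hlt'⟩
  · exact absurd rfl htt
  · exact hQB hst hst' hl' hlt'
  · exact hsymm _ _ _ (hQB hst' hst hl hlt)
  · have h1 := hidx hst hl hlt
    have h2 := hidx hst' hl' hlt'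
    have hll : l ≠ l' := by
      rintro rfl
      exact htt (Finset.coe_injective (hlt.trans hlt'.symm))
    rcases (show (l' = l + 1 ∧ j = l + 1) ∨ (l = l' + 1 ∧ j = l' + 1) by omega) with
      ⟨rfl, rfl⟩ | ⟨rfl, rfl⟩
    · exact hfan i l t t' s hl' hjk hlt hlt' hsj
    · exact hsymm _ _ _ (hfan i l' t' t s hl hjk hlt' hlt hsj)

/-- `t` and `t'` are attached along the edge `s` and lie on opposite sides of it. -/
def IsAttached (φ : Finset Space3 → Space3 → ℂ) (t t' s : Finset Space3) : Prop :=
  (∀ x ∈ s, φ t x = φ t' x) ∧ ∀ x ∈ t, x ∉ s → ∀ y ∈ t', y ∉ s →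
    (affineSpan ℝ (φ t '' (s : Set Space3))).SOppSide (φ t x) (φ t' y)

theorem IsAttached.symm {t t' s : Finset Space3} (h : IsAttached φ t t' s) :
    IsAttached φ t' t s := by
  refine ⟨fun x hx => (h.1 x hx).symm, fun x hx hxs y hy hys => ?_⟩
  have : φ t' '' (s : Set Space3) = φ t '' (s : Set Space3) :=
    Set.image_congr fun a ha => (h.1 a ha).symm
  rw [this]
  exact (h.2 y hy hys x hx hxs).symm

theorem isAttached_fan (hL : IsPetalLayout c β z e n k r A)
    (hφ : IsPlacement B p n k v β z e r A φ) {i : Fin 3} {l : ℕ} {t t' s : Finset Space3}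
    (hl : l + 1 < n i) (hlk : l + 1 ≠ k i)
    (ht : (t : Set Space3) = {p i, v i l, v i (l + 1)})
    (ht' : (t' : Set Space3) = {p i, v i (l + 1), v i (l + 1 + 1)})
    (hs : (s : Set Space3) = {p i, v i (l + 1)}) : IsAttached φ t t' s := by
  have hside : ∀ j, fanPoint β z e n k r A i (l + 1) j = fanPoint β z e n k r A i l j := by
    intro j
    have : l + 1 < k i ↔ l < k i := by omega
    simp only [fanPoint, fanAngle, this]
  have e1 := hφ.center (by omega) ht
  have e2 := hφ.left (by omega) ht
  have e3 := hφ.right (by omega) ht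
  have e1' := hφ.center hl ht'
  have e2' := hφ.left hl ht'
  have e3' := hφ.right hl ht'
  rw [hside] at e2' e3'
  have hp : p i ∈ s := by
    have : p i ∈ (s : Set Space3) := by rw [hs]; simp
    exact this
  have hv : v i (l + 1) ∈ s := by
    have : v i (l + 1) ∈ (s : Set Space3) := by rw [hs]; simp
    exact this
  refine ⟨fun x hx => ?_, fun x hx hxs y hy hys => ?_⟩
  · have hx' : x ∈ (s : Set Space3) := hx
    rw [hs] at hx'
    rcases hx' with rfl | rfl
    · rw [e1, e1']
    · rw [e3, e2']
  · have hx' : x ∈ (t : Set Space3) := hx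
    have hy' : y ∈ (t' : Set Space3) := hy
    rw [ht] at hx'
    rw [ht'] at hy'
    rcases hx' with rfl | rfl | rfl
    · exact absurd hp hxs
    · rcases hy' with rfl | rfl | rfl
      · exact absurd hp hys
      · exact absurd hv hys
      · rw [hs, Set.image_pair, e1, e2, e3, e3']
        have hd : ∀ j, fanAngle β n k A i l j = fanAngle β n k A i l 0 - A i j := by
          intro j
          unfold fanAngle
          rw [hL.angle_zero]
          split_ifs <;> ring
        have m1 := hL.mono_lt i l (by omega)
        have m2 := hL.mono_lt i (l + 1) hl
        have s1 := hL.step i l (by omega)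
        have s2 := hL.step i (l + 1) hl
        have h1 := hd l
        have h2 := hd (l + 1)
        have h3 := hd (l + 1 + 1)
        exact hL.sOppSide i (hL.radius_pos i _ (by omega)) (hL.radius_pos i _ (by omega))
          (hL.radius_pos i _ (by omega)) (by linarith) (by linarith) (by linarith) (by linarith)
    · exact absurd hv hxs

theorem isAttached_base (h : IsPetalFrame K B p n v) (hL : IsPetalLayout c β z e n k r A)
    (hφ : IsPlacement B p n k v β z e r A φ) {i : Fin 3} {t s : Finset Space3}
    (ht : (t : Set Space3) = {p i, v i 0, v i (0 + 1)})
    (hs : (s : Set Space3) = {p i, p (i + 1)}) : IsAttached φ B t s := by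
  have hn := (h.fan i).two_le
  have e1 := hφ.center (by omega) ht
  have e2 := hφ.left (by omega) ht
  have e3 := hφ.right (by omega) ht
  rw [(h.fan i).first, hL.fanPoint_first] at e2
  rw [(h.fan i).first] at ht
  have hp : p i ∈ s := by
    have : p i ∈ (s : Set Space3) := by rw [hs]; simp
    exact this
  have hp' : p (i + 1) ∈ s := by
    have : p (i + 1) ∈ (s : Set Space3) := by rw [hs]; simp
    exact this
  refine ⟨fun x hx => ?_, fun x hx hxs y hy hys => ?_⟩
  · have hx' : x ∈ (s : Set Space3) := hx
    rw [hs] at hx'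
    rcases hx' with rfl | rfl
    · rw [e1, hφ.base]
    · rw [e2, hφ.base]
  · have hx' : x ∈ (B : Set Space3) := hx
    have hy' : y ∈ (t : Set Space3) := hy
    rw [h.coe i] at hx'
    rw [ht] at hy'
    rcases hx' with rfl | rfl | rfl
    · exact absurd hp hxs
    · exact absurd hp' hxs
    · rcases hy' with rfl | rfl | rfl
      · exact absurd hp hys
      · exact absurd hp' hys
      · rw [hs, Set.image_pair, hφ.base, hφ.base, hφ.base, e3,
          IsPetalLayout.fanPoint_left (hL.k_pos i), hL.z_add_two_eq, hL.z_add_one_eq]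
        have m1 := hL.mono_lt i 0 (by omega)
        have s1 := hL.step i 0 (by omega)
        rw [hL.angle_zero] at m1 s1
        exact hL.sOppSide i (hL.c_pos i) (hL.c_pos _)
          (hL.radius_pos i _ (by omega)) (hL.beta_pos i) (by linarith [hL.beta_le i])
          (by linarith) (by linarith)

theorem isAttached (h : IsPetalFrame K B p n v) (hL : IsPetalLayout c β z e n k r A)
    (hφ : IsPlacement B p n k v β z e r A φ) {t t' : Finset Space3}
    (ht : t ∈ vertexNeighborhood K B) (ht' : t' ∈ vertexNeighborhood K B)
    (htt : t ≠ t') {s : Finset Space3} (hs : s.card = 2) (hst : s ⊆ t) (hst' : s ⊆ t')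
    (hcut : s ∉ cutEdges K B p k v) : IsAttached φ t t' s :=
  h.adjacent_cases (Q := IsAttached φ) (fun _ _ _ => IsAttached.symm)
    (fun _ _ _ _ _ hl hlk h1 h2 h3 => isAttached_fan hL hφ hl hlk h1 h2 h3)
    (fun _ _ _ h1 h2 => h.isAttached_base hL hφ h1 h2) ht ht' htt hs hst hst' hcut

theorem dist_eq_of_triple {X Y : Type*} [PseudoMetricSpace X] [PseudoMetricSpace Y] {f : X → Y}
    {a b c : X} (hab : dist (f a) (f b) = dist a b) (hac : dist (f a) (f c) = dist a c)
    (hbc : dist (f b) (f c) = dist b c) {x y : X} (hx : x ∈ ({a, b, c} : Set X))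
    (hy : y ∈ ({a, b, c} : Set X)) : dist (f x) (f y) = dist x y := by
  rcases hx with rfl | rfl | rfl <;> rcases hy with rfl | rfl | rfl <;>
    first
      | simp only [dist_self]
      | assumption
      | (rw [dist_comm, dist_comm x]; assumption)

theorem congruent (h : IsPetalFrame K B p n v)
    (hL : IsPetalLayout (sideLength p) (baseAngle p) z e n k (fanRadius p v) (fanSum p v))
    (hφ : IsPlacement B p n k v (baseAngle p) z e (fanRadius p v) (fanSum p v) φ)
    {t : Finset Space3} (ht : t ∈ vertexNeighborhood K B) {x y : Space3} (hx : x ∈ t)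
    (hy : y ∈ t) : dist (φ t x) (φ t y) = dist x y := by
  have hx' : x ∈ (t : Set Space3) := hx
  have hy' : y ∈ (t : Set Space3) := hy
  have hz : ∀ i, dist (z i) (z (i + 1)) = dist (p i) (p (i + 1)) := by
    intro i
    rw [hL.z_succ, dist_self_add_right, norm_mul, hL.norm_e, mul_one, Complex.norm_real,
      Real.norm_of_nonneg (hL.c_pos i).le, sideLength]
  rcases h.base_or_fan_of_mem ht with rfl | ⟨i, l, hl, hlt⟩
  · rw [h.coe 0] at hx' hy'
    refine dist_eq_of_triple ?_ ?_ ?_ hx' hy'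
    · rw [hφ.base, hφ.base, hz]
    · rw [hφ.base, hφ.base, dist_comm, dist_comm (p 0)]
      exact hz 2
    · rw [hφ.base, hφ.base]
      exact hz 1
  · rw [hlt] at hx' hy'
    refine dist_eq_of_triple ?_ ?_ ?_ hx' hy'
    · rw [hφ.center hl hlt, hφ.left hl hlt, hL.dist_fanPoint_self hl.le, fanRadius]
    · rw [hφ.center hl hlt, hφ.right hl hlt, hL.dist_fanPoint_self hl, fanRadius]
    · rw [hφ.left hl hlt, hφ.right hl hlt, ← sq_eq_sq₀ dist_nonneg dist_nonneg,
        hL.dist_fanPoint_sq, fanSum_succ_sub, fanRadius, fanRadius, pow_two (dist (v i l) _),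
        dist_sq_eq_dist_sq_add_dist_sq_sub_two_mul_dist_mul_dist_mul_cos_angle _ (p i),
        dist_comm (v i l), dist_comm (v i (l + 1))]
      ring

theorem image_base (h : IsPetalFrame K B p n v) (hφ : IsPlacement B p n k v β z e r A φ)
    (i : Fin 3) : φ B '' (B : Set Space3) = {z i, z (i + 1), z (i + 2)} := by
  rw [h.coe i, Set.image_insert_eq, Set.image_pair, hφ.base, hφ.base, hφ.base]

theorem image_fan (hφ : IsPlacement B p n k v β z e r A φ) {i : Fin 3} {l : ℕ} (hl : l < n i)
    {t : Finset Space3} (ht : (t : Set Space3) = {p i, v i l, v i (l + 1)}) :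
    φ t '' (t : Set Space3) = fanTriangle β z e n k r A i l := by
  conv_lhs => rw [ht]
  rw [Set.image_insert_eq, Set.image_pair, hφ.center hl ht, hφ.left hl ht, hφ.right hl ht,
    fanTriangle]

/-- The altitude argument excludes the edge neighbour shared by the two fans. If it occurs, it is
relabelled in the other fan, and both triangles then sit at one vertex. -/
theorem disjoint_succ (h : IsPetalFrame K B p n v) (hL : IsPetalLayout c β z e n k r A)
    (hφ : IsPlacement B p n k v β z e r A φ) {t t' : Finset Space3} (htt : t ≠ t') {i : Fin 3}
    {l l' : ℕ} (hl : l < n i) (hl' : l' < n (i + 1))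
    (ht : (t : Set Space3) = {p i, v i l, v i (l + 1)})
    (ht' : (t' : Set Space3) = {p (i + 1), v (i + 1) l', v (i + 1) (l' + 1)}) :
    Disjoint (interior (convexHull ℝ (φ t '' t))) (interior (convexHull ℝ (φ t' '' t'))) := by
  by_cases h1 : l' = n (i + 1) - 1
  · subst h1
    rw [← h.fan_first_eq_last] at ht'
    have hn := (h.fan i).two_le
    rw [image_fan hφ hl ht, image_fan hφ (l := 0) (by omega) ht']
    have : l ≠ 0 := by
      rintro rfl
      exact htt (Finset.coe_injective (ht.trans ht'.symm))
    exact (hL.disjoint_of_same_vertex (by omega) hl).symm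
  · by_cases h2 : l = 0
    · subst h2
      rw [h.fan_first_eq_last] at ht
      rw [image_fan hφ (by omega) ht, image_fan hφ hl' ht']
      exact (hL.disjoint_of_same_vertex (by omega) (by omega)).symm
    · rw [image_fan hφ hl ht, image_fan hφ hl' ht']
      exact hL.disjoint_of_ne_vertex (by omega) hl (by omega)

theorem disjoint (h : IsPetalFrame K B p n v) (hL : IsPetalLayout c β z e n k r A)
    (hφ : IsPlacement B p n k v β z e r A φ) {t t' : Finset Space3}
    (ht : t ∈ vertexNeighborhood K B) (ht' : t' ∈ vertexNeighborhood K B) (htt : t ≠ t') :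
    Disjoint (interior (convexHull ℝ (φ t '' t))) (interior (convexHull ℝ (φ t' '' t'))) := by
  rcases h.base_or_fan_of_mem ht with rfl | ⟨i, l, hl, hlt⟩ <;>
    rcases h.base_or_fan_of_mem ht' with rfl | ⟨i', l', hl', hlt'⟩
  · exact absurd rfl htt
  · rw [h.image_base hφ i', image_fan hφ hl' hlt']
    exact hL.disjoint_base hl'
  · rw [h.image_base hφ i, image_fan hφ hl hlt]
    exact (hL.disjoint_base hl).symm
  · rcases eq_or_eq_add_one i i' with rfl | rfl | rfl
    · rw [image_fan hφ hl hlt, image_fan hφ hl' hlt']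
      rcases lt_trichotomy l l' with h1 | rfl | h1
      · exact hL.disjoint_of_same_vertex h1 hl'
      · exact absurd (Finset.coe_injective (hlt.trans hlt'.symm)) htt
      · exact (hL.disjoint_of_same_vertex h1 hl).symm
    · exact h.disjoint_succ hL hφ htt hl hl' hlt hlt'
    · exact (h.disjoint_succ hL hφ htt.symm hl' hl hlt' hlt).symm

end IsPetalFrame

end Unfolding

theorem mainTheorem2 (P : Set Space3) (K : Geometry.SimplicialComplex ℝ Space3)
    (hP : IsNonobtuselyTriangulated P K) (B : Finset Space3) (hB : B ∈ triangles K) :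
    HasPetalUnfolding K B := by
  obtain ⟨p, n, v, hF⟩ := exists_isPetalFrame hP hB
  obtain ⟨z, e, k, hL⟩ := hF.exists_isPetalLayout hP
  obtain ⟨φ, hφ⟩ := hF.exists_isPlacement hL
  -- The layout lives in ℂ; a linear isometry preserves distances, opposite sides, convex hulls and
  -- interiors.
  let f : ℂ ≃ₗᵢ[ℝ] Plane2 := Complex.orthonormalBasisOneI.repr
  have himage : ∀ (t : Finset Space3) (s : Set Space3),
      (fun x => f (φ t x)) '' s = f '' (φ t '' s) := fun t s => (Set.image_image f (φ t) s).symm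
  refine ⟨IsPetalFrame.cutEdges K B p k v, fun t x => f (φ t x),
    hF.isPetalCut hL.k_pos hL.k_lt, ⟨?_, ?_, ?_⟩, ?_⟩
  · intro t ht x hx y hy
    rw [f.dist_map]
    exact hF.congruent hL hφ ht hx hy
  · intro t ht t' ht' htt s hs hst hst' hcut x hx
    exact congrArg f ((hF.isAttached hL hφ ht ht' htt hs hst hst' hcut).1 x hx)
  · intro t ht t' ht' htt s hs hst hst' hcut x hx hxs y hy hys
    have h1 := (hF.isAttached hL hφ ht ht' htt hs hst hst' hcut).2 x hx hxs y hy hys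
    have h2 := (f.toLinearEquiv.toAffineEquiv.sOppSide_map_iff).2 h1
    rw [AffineSubspace.map_span] at h2
    rw [himage]
    exact h2
  · intro t ht t' ht' htt
    have h1 := hF.disjoint hL hφ ht ht' htt
    have himg : ∀ s : Set ℂ, interior (convexHull ℝ (f '' s)) =
        f '' interior (convexHull ℝ s) := by
      intro s
      have e1 := f.toLinearEquiv.toLinearMap.image_convexHull s
      have e2 := f.toHomeomorph.image_interior (convexHull ℝ s)
      exact (congrArg interior e1.symm).trans e2.symm
    rw [unfoldedTriangle, unfoldedTriangle, himage, himage, himg, himg]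
    exact (Set.disjoint_image_iff f.injective).2 h1
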